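/- **Theorem (one-dimensional block-encoding).** *Setting.* Consider $\partial_t u=\sum_{k=0}^{\eta-1} f_k(x)\,\partial_x^{p_k}u+v(x)$ on $[a,b]$, $a<b$, $\eta\ge 1$, with pairwise distinct orders $p_k$, where each $h\in\{v,f_0,\dots,f_{\eta-1}\}$ is a complex-valued piecewise polynomial with $G_h\ge1$ pieces $[K_0,K_1],(K_1,K_2],\dots$, $a=K_0<\dots<K_{G_h}=b$, and polynomials $h_1,\dots,h_{G_h}$ of degrees $Q^h_1,\dots,Q^h_{G_h}$. Put $\mathcal N_h=\max_g\sup_{|x|\le\max(|a|,|b|)}|h_g(x)|$ and $G=\max(G_v,\max_k G_{f_k})$. For each $n$ let $N=2^n$, $\Delta x=(b-a)/(N-1)$, $x_i=a+i\Delta x$ ($0\le i<N$), and let $(\gamma^{p_k}_{ij})$ be the $N\times N$ coefficient matrix of a finite-difference scheme for $\partial_x^{p_k}$. That is: there are $w\in\mathbb N$ and, for every $k$, a real stencil $(c^k_m)_{|m|\le w}$ independent of $n$ with $\sum_m c^k_m m^q=p_k!\,\delta_{q,p_k}$ for $0\le q\le p_k$ (with $0^0=1$), such that for $w\le i<N-w$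 one has $\gamma^{p_k}_{ij}=c^k_{j-i}$ if $|j-i|\le w$ and $\gamma^{p_k}_{ij}=0$ otherwise; the first and last $w$ rows, which carry the (Robin) boundary conditions, are arbitrary complex, with $\gamma^{p_k}_{ij}$ bounded uniformly in $n$. Let $v'(x_i)\in\mathbb C$ be boundary corrections (depending on $n$), zero for $w\le i<N-w$. Put $(D_k)_{ij}=\gamma^{p_k}_{ij}/(\Delta x)^{p_k}$, $(A_k)_{ij}=f_k(x_i)\gamma^{p_k}_{ij}/(\Delta x)^{p_k}$, $A=\sum_k A_k$, $B=\sqrt{2^n}\,\mathrm{diag}(v(x_i)+v'(x_i))$, $$S_1=\begin{pmatrix}\frac{A+A^\dagger}2&\frac B2\\ \frac{B^\dagger}2&0\end{pmatrix},\quad S_2=\begin{pmatrix}\frac{A-A^\dagger}{2i}&\frac B{2i}\\-\frac{B^\dagger}{2i}&0\end{pmatrix},\quad H=S_1\otimes\mathbf x_\xi+S_2\otimes\mathbf 1_\xi,$$ with $\mathbf x_\xi=\mathrm{diag}\big(a_\xi+\tfrac{b_\xi-a_\xi}{2^{n_\xi}-1}\,l\big)_{0\le l<2^{n_\xi}}$,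 $a_\xi<b_\xi$. The sparsity of an $M\times M$ matrix is the number of its cyclic diagonals $\{(i,j):j-i\equiv d \bmod M\}$ containing a nonzero entry; let $\kappa$ be that of $H$ and $\kappa_k$ that of $A_k$. $\|\cdot\|_{\max}$ is the largest modulus of an entry. A circuit is a sequence of arbitrary one-qubit unitaries and C-NOTs, each counted as one gate. A unitary $U$ on $r+s+m$ qubits is an $(\alpha,s,\epsilon)$-block-encoding ($\alpha,\epsilon\ge0$) of an $m$-qubit operator $M$ with $r$ pure ancillas if for every $|\psi\rangle$ one has $U|0\rangle^r|0\rangle^s|\psi\rangle=|0\rangle^r|\phi\rangle$, where $(\langle0|^s\otimes I)|\phi\rangle=\tilde M|\psi\rangle$ and $\|M-\alpha\tilde M\|\le\epsilon$, and if moreover $U$ maps $|0\rangle^r\otimes|\chi\rangle$ into $|0\rangle^r\otimes(\cdot)$ for every state $|\chi\rangle$ of the other $s+m$ qubits. *Claim.* There is an absolute constant $C$, and for every problem with its discretization as above (everything except $n,n_\xi$; the families $\gamma^{p_k}$, $v'$ being given for all $n$) a constant $C'$, such that for all $n\ge2$ with $2^n>2w$ and all $n_\xi\ge1$ there is a circuit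 whose unitary is an $$\big(\alpha,\ \lceil\log_2n_\xi\rceil+\lceil\log_2n\rceil+\lceil\log_2G\rceil+\lceil\log_2\kappa\rceil+\lceil\log_2\eta\rceil+7,\ 0\big)\text{-block-encoding of }H$$ (reading $\lceil\log_2 0\rceil=0$ when $H=0$) with $2n+2$ pure ancillas and at most $$C(1+w)\Big(\sum_g\max(1,Q^v_g)\,n\log n+\sum_{k=0}^{\eta-1}\Big(\kappa_kn+\sum_g\max(1,Q^{f_k}_g)\,n\log n\Big)+n_\xi\log n_\xi\Big)$$ gates, where $\alpha\le C'\kappa\|H\|_{\max}$ and also $$\alpha\le C\,\kappa\,(1+\max(|a_\xi|,|b_\xi|))\Big(\sum_k\mathcal N_{f_k}\|D_k\|_{\max}+\sqrt{2^n}\,\big(\mathcal N_v+\max_i|v'(x_i)|\big)\Big).$$ -/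

import Mathlib

open scoped Matrix Kronecker

noncomputable section

namespace SchroPDE

/-! ### Quantum circuits -/

/-- Elementary gates on a set `Q` of qubits: an arbitrary one-qubit unitary, or a C-NOT. -/
inductive Gate (Q : Type) where
  | single (q : Q) (u : Matrix.unitaryGroup (Fin 2) ℂ) : Gate Q
  | cnot (c t : Q) (h : c ≠ t) : Gate Q

/-- The matrix of a gate in the computational basis `Q → Fin 2`. -/
def Gate.matrix {Q : Type} [Fintype Q] [DecidableEq Q] :
    Gate Q → Matrix (Q → Fin 2) (Q → Fin 2) ℂ
  | .single q u => Matrix.of fun x y =>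
      if ∀ r, r ≠ q → x r = y r then (u : Matrix (Fin 2) (Fin 2) ℂ) (x q) (y q) else 0
  | .cnot c t _ => Matrix.of fun x y =>
      if x = Function.update y t (y t + y c) then 1 else 0

/-- A circuit is a list of gates, the head being applied first; its length is its gate count. -/
abbrev Circuit (Q : Type) := List (Gate Q)

/-- The unitary implemented by a circuit. -/
def Circuit.matrix {Q : Type} [Fintype Q] [DecidableEq Q] (c : Circuit Q) :
    Matrix (Q → Fin 2) (Q → Fin 2) ℂ :=
  c.foldl (fun M g => g.matrix * M) 1

/-- Qubits of a block-encoding: `a` pure ancillas, `s` signal ancillas, `m` system qubits. -/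
abbrev Qubits (a s m : ℕ) := Fin a ⊕ Fin s ⊕ Fin m

/-- The basis state `|0⟩^a |0⟩^s |k⟩`, where `k` is written in binary on the system qubits. -/
def ketZero (a s : ℕ) {m : ℕ} (k : Fin (2 ^ m)) : Qubits a s m → Fin 2 :=
  Sum.elim 0 (Sum.elim 0 (finFunctionFinEquiv.symm k))

/-- The first `a` qubits are pure ancillas of `U`: for every input `|ψ⟩` of all other qubits,
`U |0⟩^a |ψ⟩ = |0⟩^a |φ⟩` for some `|φ⟩`. -/
def IsPureAncilla {a s m : ℕ}
    (U : Matrix (Qubits a s m → Fin 2) (Qubits a s m → Fin 2) ℂ) : Prop :=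
  ∀ x y : Qubits a s m → Fin 2,
    (∀ i : Fin a, y (Sum.inl i) = 0) → (∃ i : Fin a, x (Sum.inl i) ≠ 0) → U x y = 0

/-- The block `Ã = (⟨0|^a ⟨0|^s ⊗ I) U (|0⟩^a |0⟩^s ⊗ I)`. -/
def encodedBlock {a s m : ℕ}
    (U : Matrix (Qubits a s m → Fin 2) (Qubits a s m → Fin 2) ℂ) :
    Matrix (Fin (2 ^ m)) (Fin (2 ^ m)) ℂ :=
  Matrix.of fun i j => U (ketZero a s i) (ketZero a s j)

/-- `U` is an `(α, s, ε)`-block-encoding of the `m`-qubit operator `A`, with `a` pure ancillas: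
`U |0⟩^a |0⟩^s |ψ⟩ = |0⟩^a |φ⟩` with `(⟨0|^s ⊗ I) |φ⟩ = Ã |ψ⟩` and `‖A - α Ã‖ ≤ ε` in the
spectral norm. -/
structure IsBlockEncoding {a s m : ℕ}
    (U : Matrix (Qubits a s m → Fin 2) (Qubits a s m → Fin 2) ℂ)
    (A : Matrix (Fin (2 ^ m)) (Fin (2 ^ m)) ℂ) (α ε : ℝ) : Prop where
  unitary : U ∈ Matrix.unitaryGroup (Qubits a s m → Fin 2) ℂ
  alpha_nonneg : 0 ≤ α
  eps_nonneg : 0 ≤ ε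
  ancilla : ∀ (x : Qubits a s m → Fin 2) (j : Fin (2 ^ m)),
    (∃ i : Fin a, x (Sum.inl i) ≠ 0) → U x (ketZero a s j) = 0
  close : ‖Matrix.toEuclideanCLM (n := Fin (2 ^ m)) (𝕜 := ℂ)
    (A - (α : ℂ) • encodedBlock U)‖ ≤ ε

/-! ### Matrix quantities -/

/-- Largest absolute value of an entry. -/
def maxNorm {ι κ : Type*} (M : Matrix ι κ ℂ) : ℝ := ⨆ p : ι × κ, ‖M p.1 p.2‖

/-- Diagonal sparsity: the number of cyclic diagonals `{(i, j) : j - i ≡ d mod N}` that contain a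
nonzero entry. -/
def diagSparsity {N : ℕ} (M : Matrix (Fin N) (Fin N) ℂ) : ℕ :=
  Set.ncard {d : ℤ | ∃ i j : Fin N, M i j ≠ 0 ∧ d = ((j : ℤ) - (i : ℤ)) % (N : ℤ)}

/-! ### Piecewise polynomial functions -/

/-- A complex-valued function on `[a, b]` that is polynomial on each of `G` consecutive pieces
`[K 0, K 1], (K 1, K 2], …, (K (G - 1), K G]`, where `a = K 0 < K 1 < ⋯ < K G = b`. -/
structure PiecewisePoly (a b : ℝ) where
  G : ℕ
  G_pos : 0 < G
  K : Fin (G + 1) → ℝ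
  K_strictMono : StrictMono K
  K_first : K 0 = a
  K_last : K (Fin.last G) = b
  poly : Fin G → Polynomial ℂ

/-- The `g`-th piece of the domain. -/
def PiecewisePoly.piece {a b : ℝ} (f : PiecewisePoly a b) (g : Fin f.G) : Set ℝ :=
  if g.val = 0 then Set.Icc (f.K g.castSucc) (f.K g.succ)
  else Set.Ioc (f.K g.castSucc) (f.K g.succ)

open Classical in
/-- The value at `x ∈ [a, b]`: that of the polynomial of the piece containing `x`. -/
def PiecewisePoly.eval {a b : ℝ} (f : PiecewisePoly a b) (x : ℝ) : ℂ :=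
  ∑ g : Fin f.G, if x ∈ f.piece g then (f.poly g).eval (x : ℂ) else 0

/-- The normalization `max_g sup_{|x| ≤ max(|a|, |b|)} |f_g(x)|`, with `f_g` the `g`-th
polynomial. -/
def PiecewisePoly.normalization {a b : ℝ} (f : PiecewisePoly a b) : ℝ :=
  ⨆ g : Fin f.G, ⨆ x : Set.Icc (-max |a| |b|) (max |a| |b|), ‖(f.poly g).eval ((x : ℝ) : ℂ)‖

/-- `∑_g max(1, Q_g)` with `Q_g` the degree of the `g`-th polynomial. -/
def PiecewisePoly.degreeSum {a b : ℝ} (f : PiecewisePoly a b) : ℕ :=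
  ∑ g : Fin f.G, max 1 (f.poly g).natDegree

/-! ### Finite differences and the Schrodingerised Hamiltonian -/

/-- A finite-difference scheme for the `p`-th derivative, on the grids of `2 ^ n` points for all
`n`. In every row at distance at least `w` from both ends of the grid the coefficients are those of
a fixed consistent stencil of half-width at most `w`. The first `w` and the last `w` rows, which
incorporate the (Robin) boundary conditions, e.g. after elimination of ghost points, may be
arbitrary; all that is asked of them is that their coefficients stay bounded as `n` grows. -/
structure FDScheme (w p : ℕ) where
  stencil : ℤ → ℝ
  consistent : ∀ q : ℕ, q ≤ p →
    ∑ m ∈ Finset.Icc (-(w : ℤ)) (w : ℤ), stencil m * (m : ℝ) ^ q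
      = if q = p then (Nat.factorial p : ℝ) else 0
  coeff : (n : ℕ) → Matrix (Fin (2 ^ n)) (Fin (2 ^ n)) ℂ
  bulk : ∀ (n : ℕ) (i j : Fin (2 ^ n)), w ≤ i.val → i.val + w < 2 ^ n →
    coeff n i j = if |(j : ℤ) - (i : ℤ)| ≤ (w : ℤ)
      then (stencil ((j : ℤ) - (i : ℤ)) : ℂ) else 0
  bounded : ∃ M : ℝ, ∀ (n : ℕ) (i j : Fin (2 ^ n)), ‖coeff n i j‖ ≤ M

/-- A one-dimensional problem `∂u/∂t = ∑_{k < η} f_k(x) ∂^{p_k} u/∂x^{p_k} + v(x)` on `[a, b]` with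
distinct derivative orders `p_k`, together with its discretization: a finite-difference scheme for
every term, the corrections `v'` of the source term due to the boundary conditions (supported in
the `w` first and `w` last grid points), and the domain `[aξ, bξ]` of the auxiliary
Schrodingerisation variable. -/
structure DiscretizedPDE where
  a : ℝ
  b : ℝ
  a_lt_b : a < b
  η : ℕ
  η_pos : 0 < η
  p : Fin η → ℕ
  p_injective : Function.Injective p
  f : Fin η → PiecewisePoly a b
  v : PiecewisePoly a b
  w : ℕ
  scheme : (k : Fin η) → FDScheme w (p k)
  vCorr : (n : ℕ) → Fin (2 ^ n) → ℂ
  vCorr_bulk : ∀ (n : ℕ) (i : Fin (2 ^ n)), w ≤ i.val → i.val + w < 2 ^ n → vCorr n i = 0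
  aξ : ℝ
  bξ : ℝ
  aξ_lt_bξ : aξ < bξ

namespace DiscretizedPDE

variable (P : DiscretizedPDE)

/-- Grid spacing `(b - a) / (2 ^ n - 1)`. -/
def dx (n : ℕ) : ℝ := (P.b - P.a) / (2 ^ n - 1)

/-- Grid points `x_i = a + i Δx`. -/
def grid (n : ℕ) (i : Fin (2 ^ n)) : ℝ := P.a + (i.val : ℝ) * P.dx n

/-- The discretized derivative `D_k`, with entries `γ_{ij} / (Δx) ^ p_k`. -/
def D (n : ℕ) (k : Fin P.η) : Matrix (Fin (2 ^ n)) (Fin (2 ^ n)) ℂ :=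
  Matrix.of fun i j => (P.scheme k).coeff n i j / (P.dx n : ℂ) ^ P.p k

/-- The `k`-th term, with entries `f_k(x_i) γ_{ij} / (Δx) ^ p_k`. -/
def Ak (n : ℕ) (k : Fin P.η) : Matrix (Fin (2 ^ n)) (Fin (2 ^ n)) ℂ :=
  Matrix.of fun i j =>
    (P.f k).eval (P.grid n i) / (P.dx n : ℂ) ^ P.p k * (P.scheme k).coeff n i j

/-- `A = ∑_k A_k`. -/
def A (n : ℕ) : Matrix (Fin (2 ^ n)) (Fin (2 ^ n)) ℂ := ∑ k, P.Ak n k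

/-- `B = √(2 ^ n) diag(v(x_i) + v'(x_i))`. -/
def B (n : ℕ) : Matrix (Fin (2 ^ n)) (Fin (2 ^ n)) ℂ :=
  (Real.sqrt (2 ^ n) : ℂ) • Matrix.diagonal fun i => P.v.eval (P.grid n i) + P.vCorr n i

/-- `S₁ = (S + S†) / 2` for `S = [A, B; 0, 0]`. -/
def S₁ (n : ℕ) :
    Matrix (Fin (2 ^ n) ⊕ Fin (2 ^ n)) (Fin (2 ^ n) ⊕ Fin (2 ^ n)) ℂ :=
  Matrix.fromBlocks
    ((1 / 2 : ℂ) • (P.A n + (P.A n)ᴴ)) ((1 / 2 : ℂ) • P.B n)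
    ((1 / 2 : ℂ) • (P.B n)ᴴ) 0

/-- `S₂ = (S - S†) / (2i)` for `S = [A, B; 0, 0]`. -/
def S₂ (n : ℕ) :
    Matrix (Fin (2 ^ n) ⊕ Fin (2 ^ n)) (Fin (2 ^ n) ⊕ Fin (2 ^ n)) ℂ :=
  Matrix.fromBlocks
    ((1 / (2 * Complex.I)) • (P.A n - (P.A n)ᴴ)) ((1 / (2 * Complex.I)) • P.B n)
    (-((1 / (2 * Complex.I)) • (P.B n)ᴴ)) 0

/-- The coordinate operator `diag(aξ, aξ + (bξ - aξ) / (2 ^ nξ - 1), …, bξ)`. -/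
def xξ (nξ : ℕ) : Matrix (Fin (2 ^ nξ)) (Fin (2 ^ nξ)) ℂ :=
  Matrix.diagonal fun l =>
    ((P.aξ + (P.bξ - P.aξ) / (2 ^ nξ - 1) * (l.val : ℝ) : ℝ) : ℂ)

/-- The ordering of the rows of `S ⊗ xξ` (the auxiliary register is the least significant). -/
def indexEquiv (n nξ : ℕ) :
    (Fin (2 ^ n) ⊕ Fin (2 ^ n)) × Fin (2 ^ nξ) ≃ Fin (2 ^ (n + 1 + nξ)) :=
  ((Equiv.prodCongr finSumFinEquiv (Equiv.refl _)).trans finProdFinEquiv).trans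
    (finCongr (by ring))

/-- The Schrodingerised Hamiltonian `H = S₁ ⊗ xξ + S₂ ⊗ 1`, on `n + 1 + nξ` qubits. -/
def H (n nξ : ℕ) : Matrix (Fin (2 ^ (n + 1 + nξ))) (Fin (2 ^ (n + 1 + nξ))) ℂ :=
  Matrix.reindex (indexEquiv n nξ) (indexEquiv n nξ)
    (P.S₁ n ⊗ₖ P.xξ nξ + P.S₂ n ⊗ₖ (1 : Matrix (Fin (2 ^ nξ)) (Fin (2 ^ nξ)) ℂ))

/-- Maximal number of pieces among `v` and the `f_k`. -/
def G : ℕ := max P.v.G (Finset.univ.sup fun k => (P.f k).G)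

/-- The sparsity `κ` of `H`. -/
def sparsity (n nξ : ℕ) : ℕ := diagSparsity (P.H n nξ)

/-- The number of signal qubits of the block-encoding. -/
def signalQubits (n nξ : ℕ) : ℕ :=
  Nat.clog 2 nξ + Nat.clog 2 n + Nat.clog 2 P.G + Nat.clog 2 (P.sparsity n nξ)
    + Nat.clog 2 P.η + 7

/-- `∑_g Q^v_g n log n + ∑_k (κ_k n + ∑_g Q^{f_k}_g n log n) + nξ log nξ`. -/
def gateScale (n nξ : ℕ) : ℝ :=
  P.v.degreeSum * (n * Real.log n)
    + ∑ k, ((diagSparsity (P.Ak n k) : ℝ) * n + (P.f k).degreeSum * (n * Real.log n))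
    + nξ * Real.log nξ

/-- `(1 + max(|aξ|, |bξ|)) (∑_k 𝒩_{f_k} ‖D_k‖_max + √(2 ^ n) (𝒩_v + max_i |v'(x_i)|))`. -/
def hamiltonianScale (n : ℕ) : ℝ :=
  (1 + max |P.aξ| |P.bξ|) *
    (∑ k, (P.f k).normalization * maxNorm (P.D n k)
      + Real.sqrt (2 ^ n) * (P.v.normalization + ⨆ i, ‖P.vCorr n i‖))

end DiscretizedPDE

end SchroPDE

end

/-!
The Hamiltonian is the Hermitian part of `S ⊗ (x - i)`, where `S = [A, B; 0, 0]` and `x` is the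
auxiliary coordinate (`DiscretizedPDE.H_apply`). A block-encoding of `S ⊗ (x - i)` thus gives one of
`H` with the same normalization, by averaging it with its adjoint (`DiscretizedPDE.blockEnc_H`), and
it suffices to block-encode the two factors. The coordinate is affine in the number held by its
register, hence a combination of a phase and of Pauli operators `Z`
(`blockEnc_coordinate_sub_I`).

The matrix `[A, B; B, A]` is a linear combination of diagonal operators followed by permutations
(`DiscretizedPDE.sum_weight_term`). A bulk row of `A` holds, on each of the at most `2 * w + 1`
cyclic diagonals reached by the stencils and for each derivative, a constant times the piecewise
polynomial coefficient; the remaining `2 * w` rows contribute, on each nonzero cyclic diagonal of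
`A`, a diagonal operator with at most `2 * w` nonzero entries; the source contributes a piecewise
polynomial and a sparse correction. A linear combination of unitaries, whose weights are the moduli
of the coefficients, followed by the projector onto the first component, block-encodes `S`
(`DiscretizedPDE.blockEnc_gen`). The sum of the weights is at most three times the sparsity times the
scale of the coefficients (`DiscretizedPDE.genNorm_le`).

Three constructions carry the summands. The shift along a cyclic diagonal is the addition of a
constant, by a ripple-carry adder with `n` clean ancillas (`impl_addBits`). Comparisons of the
position with constants are automata that read the position digit by digit; their states are written
to qubits of unknown content, which are restored (`exists_circuit_automaton`), so that no clean
ancillas are spent. A polynomial of the position is obtained by quantum signal processing: the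
rescaled position is a block of a reflection (`exists_impl_coordinate`); the reflection multiplied
by the one about the zero state is a unitary `W` whose Hermitian part restricts to the position
(`restrictsTo_walk`); a polynomial of degree `Q` of that Hermitian part is, up to `W ^ Q`, a
polynomial of `W`, which a Fejér–Riesz factorization (`fejer_riesz`) completes to a unit column, and
unit columns of polynomials factor into `2 * Q` rotations (`exists_impl_gqsp`). The polynomials of a
piecewise polynomial are selected by comparisons (`Impl.mux`), so that their gate counts add up while
the normalization is that of a single piece (`blockEnc_piecewisePoly`).

For the resources, the consistency conditions on a stencil with `2 * w + 1` entries bound the order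
by `2 * w`, hence `η ≤ 2 * w + 1` (`DiscretizedPDE.eta_le`), and the register that selects the
summands fits into the ancillas. The nonzero cyclic diagonals of `A` lie on distinct cyclic diagonals
of `H` (`DiscretizedPDE.card_diagonals_le_sparsity`), which gives the dependence on the sparsity.

Finally, the scale of the coefficients is bounded by the largest entry of `H`
(`DiscretizedPDE.exists_hamiltonianScale_le`). Two values of the auxiliary coordinate recover `S`
from `H`. Among the derivatives with a nonzero coefficient, the one of highest order dominates in the
bulk as the grid is refined, at a point where its coefficient is bounded away from zero, and the
source without its correction is seen in the bulk as well. This settles all but finitely many `n`,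
and those are absorbed by the constant.
-/

noncomputable section

namespace SchroPDE

set_option linter.unusedSectionVars false

/-! ### Operators on registers of qubits -/

/-- Operators on the qubits `Q`, as matrices in the computational basis. -/
abbrev Op (Q : Type) := Matrix (Q → Fin 2) (Q → Fin 2) ℂ

section

variable {Q A α : Type}

/-- `U` never changes the classical information `φ` of a basis state. -/
def Keeps (φ : (Q → Fin 2) → α) (U : Op Q) : Prop := ∀ x y, U x y ≠ 0 → φ x = φ y

open Classical in
/-- The operator that applies `U` to the basis states satisfying `p`, and `V` to the others. -/
def cond (p : (Q → Fin 2) → Prop) (U V : Op Q) : Op Q :=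
  Matrix.of fun x y => if p y then U x y else V x y

open Classical in
/-- The operator that acts as `U` on the qubits `ι a` and trivially on all others. -/
def emb (ι : A → Q) (U : Op A) : Op Q :=
  Matrix.of fun x y => if ∀ q, q ∉ Set.range ι → x q = y q then U (x ∘ ι) (y ∘ ι) else 0

/-- The operator `|y⟩ ↦ d(y) |f(y)⟩`. -/
def mono [DecidableEq (Q → Fin 2)] (f : (Q → Fin 2) → (Q → Fin 2)) (d : (Q → Fin 2) → ℂ) : Op Q :=
  Matrix.of fun x y => if x = f y then d y else 0

/-- The operator `|y⟩ ↦ |f(y)⟩`. -/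
abbrev permOp [DecidableEq (Q → Fin 2)] (f : (Q → Fin 2) → (Q → Fin 2)) : Op Q := mono f 1

/-- The same gate on a larger set of qubits. -/
def Gate.map (ι : A ↪ Q) : Gate A → Gate Q
  | .single q u => .single (ι q) u
  | .cnot c t h => .cnot (ι c) (ι t) fun e => h (ι.injective e)

/-- The same circuit on a larger set of qubits. -/
def Circuit.map (ι : A ↪ Q) (c : Circuit A) : Circuit Q := List.map (Gate.map ι) c

/-- The inverse of a gate. -/
def Gate.inv : Gate Q → Gate Q
  | .single q u => .single q u⁻¹
  | .cnot c t h => .cnot c t h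

/-- The inverse of a circuit. -/
def Circuit.inv (c : Circuit Q) : Circuit Q := (List.map Gate.inv c).reverse

end

section Operators

variable {Q A R α : Type} [Fintype Q] [DecidableEq Q] [Fintype A] [DecidableEq A]
  [Fintype R] [DecidableEq R]

theorem Keeps.one (φ : (Q → Fin 2) → α) : Keeps φ (1 : Op Q) := by
  intro x y h
  by_contra hxy
  exact h (Matrix.one_apply_ne fun e => hxy (by rw [e]))

theorem Keeps.mul {φ : (Q → Fin 2) → α} {U V : Op Q} (hU : Keeps φ U) (hV : Keeps φ V) :
    Keeps φ (U * V) := by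
  intro x y h
  rw [Matrix.mul_apply] at h
  obtain ⟨z, -, hz⟩ := Finset.exists_ne_zero_of_sum_ne_zero h
  exact (hU x z (left_ne_zero_of_mul hz)).trans (hV z y (right_ne_zero_of_mul hz))

theorem Keeps.pow {φ : (Q → Fin 2) → α} {U : Op Q} (hU : Keeps φ U) (k : ℕ) :
    Keeps φ (U ^ k) := by
  induction k with
  | zero => simpa using Keeps.one φ
  | succ k ih => rw [pow_succ]; exact ih.mul hU

theorem Keeps.conjTranspose {φ : (Q → Fin 2) → α} {U : Op Q} (hU : Keeps φ U) :
    Keeps φ Uᴴ := by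
  intro x y h
  refine (hU y x fun e => h ?_).symm
  simp [Matrix.conjTranspose_apply, e]

theorem Keeps.diagonal (φ : (Q → Fin 2) → α) (d : (Q → Fin 2) → ℂ) :
    Keeps φ (Matrix.diagonal d : Op Q) := by
  intro x y h
  by_contra hxy
  exact h (Matrix.diagonal_apply_ne _ fun e => hxy (by rw [e]))

theorem Keeps.comp {β : Type} {φ : (Q → Fin 2) → α} {U : Op Q} (hU : Keeps φ U) (g : α → β) :
    Keeps (fun x => g (φ x)) U := fun x y h => congrArg g (hU x y h)

theorem cond_apply_pos {p : (Q → Fin 2) → Prop} {U V : Op Q} {x y : Q → Fin 2} (h : p y) :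
    cond p U V x y = U x y := by simp [cond, h]

theorem cond_apply_neg {p : (Q → Fin 2) → Prop} {U V : Op Q} {x y : Q → Fin 2} (h : ¬ p y) :
    cond p U V x y = V x y := by simp [cond, h]

@[simp] theorem cond_self (p : (Q → Fin 2) → Prop) (U : Op Q) : cond p U U = U := by
  ext x y; simp [cond]

/-- Conditioning is multiplicative in both branches if the factors that act first preserve the
condition. -/
theorem cond_mul {p : (Q → Fin 2) → Prop} (U V : Op Q) {U' V' : Op Q}
    (hU : Keeps p U') (hV : Keeps p V') :
    cond p U V * cond p U' V' = cond p (U * U') (V * V') := by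
  ext x y
  by_cases h : p y
  · rw [cond_apply_pos h, Matrix.mul_apply, Matrix.mul_apply]
    refine Finset.sum_congr rfl fun z _ => ?_
    rw [cond_apply_pos h]
    by_cases hz : U' z y = 0
    · simp [hz]
    · rw [cond_apply_pos ((hU z y hz).symm ▸ h)]
  · rw [cond_apply_neg h, Matrix.mul_apply, Matrix.mul_apply]
    refine Finset.sum_congr rfl fun z _ => ?_
    rw [cond_apply_neg h]
    by_cases hz : V' z y = 0
    · simp [hz]
    · rw [cond_apply_neg ((hV z y hz).symm ▸ h)]

theorem Keeps.cond {φ : (Q → Fin 2) → α} {U V : Op Q} (hU : Keeps φ U) (hV : Keeps φ V)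
    (p : (Q → Fin 2) → Prop) : Keeps φ (cond p U V) := by
  intro x y h
  by_cases hp : p y
  · exact hU x y (by rwa [cond_apply_pos hp] at h)
  · exact hV x y (by rwa [cond_apply_neg hp] at h)

theorem emb_apply_pos {ι : A → Q} {U : Op A} {x y : Q → Fin 2}
    (h : ∀ q, q ∉ Set.range ι → x q = y q) : emb ι U x y = U (x ∘ ι) (y ∘ ι) := by
  simp only [emb, Matrix.of_apply]; rw [if_pos h]

theorem emb_apply_neg {ι : A → Q} {U : Op A} {x y : Q → Fin 2}
    (h : ¬ ∀ q, q ∉ Set.range ι → x q = y q) : emb ι U x y = 0 := by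
  simp only [emb, Matrix.of_apply]; rw [if_neg h]

theorem ext_of_comp_of_off {ι : A → Q} {x y : Q → Fin 2} (h : x ∘ ι = y ∘ ι)
    (h' : ∀ q, q ∉ Set.range ι → x q = y q) : x = y := by
  funext q
  by_cases hq : q ∈ Set.range ι
  · obtain ⟨a, rfl⟩ := hq
    exact congrFun h a
  · exact h' q hq

theorem emb_one (ι : A → Q) : emb ι (1 : Op A) = 1 := by
  ext x y
  by_cases h : ∀ q, q ∉ Set.range ι → x q = y q
  · rw [emb_apply_pos h]
    by_cases hxy : x = y
    · subst hxy; simp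
    · rw [Matrix.one_apply_ne hxy, Matrix.one_apply_ne fun e => hxy (ext_of_comp_of_off e h)]
  · rw [emb_apply_neg h, Matrix.one_apply_ne]
    rintro rfl
    exact h fun _ _ => rfl

theorem extend_off {ι : A → Q} (w : A → Fin 2) (y : Q → Fin 2) {q : Q}
    (hq : q ∉ Set.range ι) : Function.extend ι w y q = y q :=
  Function.extend_apply' _ _ _ fun ⟨a, ha⟩ => hq ⟨a, ha⟩

theorem emb_mul {ι : A → Q} (hι : Function.Injective ι) (U V : Op A) :
    emb ι (U * V) = emb ι U * emb ι V := by
  ext x y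
  rw [Matrix.mul_apply]
  have key : ∑ w : A → Fin 2, emb ι U x (Function.extend ι w y) *
      emb ι V (Function.extend ι w y) y = ∑ z, emb ι U x z * emb ι V z y := by
    refine Fintype.sum_of_injective (fun w => Function.extend ι w y) ?_ _ _ ?_ fun _ => rfl
    · intro w w' h
      funext a
      have := congrFun h (ι a)
      simpa [hι.extend_apply] using this
    · intro z hz
      rw [emb_apply_neg (U := V), mul_zero]
      intro h
      refine hz ⟨z ∘ ι, ?_⟩
      refine ext_of_comp_of_off (ι := ι) (Function.extend_comp hι _ _) fun q hq => ?_
      rw [h q hq]; exact extend_off _ _ hq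
  rw [← key]
  have hV : ∀ w : A → Fin 2, emb ι V (Function.extend ι w y) y = V w (y ∘ ι) := fun w => by
    rw [emb_apply_pos (fun q hq => extend_off _ _ hq), Function.extend_comp hι]
  by_cases h : ∀ q, q ∉ Set.range ι → x q = y q
  · rw [emb_apply_pos h, Matrix.mul_apply]
    refine Finset.sum_congr rfl fun w _ => ?_
    rw [hV, emb_apply_pos, Function.extend_comp hι]
    intro q hq; rw [h q hq, extend_off _ _ hq]
  · rw [emb_apply_neg h]
    symm
    refine Finset.sum_eq_zero fun w _ => ?_
    rw [emb_apply_neg (U := U), zero_mul]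
    intro h'
    refine h fun q hq => ?_
    rw [h' q hq, extend_off _ _ hq]

theorem emb_conjTranspose (ι : A → Q) (U : Op A) : emb ι Uᴴ = (emb ι U)ᴴ := by
  ext x y
  rw [Matrix.conjTranspose_apply]
  by_cases h : ∀ q, q ∉ Set.range ι → x q = y q
  · rw [emb_apply_pos h, emb_apply_pos fun q hq => (h q hq).symm]; rfl
  · rw [emb_apply_neg h, emb_apply_neg fun h' => h fun q hq => (h' q hq).symm]; simp

theorem Keeps.emb_off {ι : A → Q} (U : Op A) {φ : (Q → Fin 2) → α}
    (hφ : ∀ x y : Q → Fin 2, (∀ q, q ∉ Set.range ι → x q = y q) → φ x = φ y) :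
    Keeps φ (emb ι U) := by
  intro x y h
  refine hφ x y ?_
  by_contra h'
  exact h (emb_apply_neg h')

theorem Keeps.emb {ι : A → Q} {U : Op A} {φ : (A → Fin 2) → α} (h : Keeps φ U) :
    Keeps (fun x => φ (x ∘ ι)) (emb ι U) := by
  intro x y hxy
  by_cases h' : ∀ q, q ∉ Set.range ι → x q = y q
  · rw [emb_apply_pos h'] at hxy
    exact h _ _ hxy
  · exact absurd (emb_apply_neg h') hxy

/-! ### Monomial operators -/

theorem mono_mul (f g : (Q → Fin 2) → (Q → Fin 2)) (d e : (Q → Fin 2) → ℂ) :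
    mono f d * mono g e = mono (f ∘ g) fun y => d (g y) * e y := by
  ext x y
  rw [Matrix.mul_apply, Finset.sum_eq_single (g y)]
  · by_cases h : x = f (g y) <;> simp [mono, h]
  · intro z _ hz; simp [mono, hz]
  · simp

theorem diagonal_eq_mono (d : (Q → Fin 2) → ℂ) : (Matrix.diagonal d : Op Q) = mono id d := by
  ext x y
  by_cases h : x = y
  · subst h; simp [mono]
  · simp [mono, h]

theorem one_eq_mono : (1 : Op Q) = mono id 1 := by
  rw [← Matrix.diagonal_one, diagonal_eq_mono]; rfl

theorem permOp_mul (f g : (Q → Fin 2) → (Q → Fin 2)) :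
    permOp f * permOp g = permOp (f ∘ g) := by
  rw [permOp, mono_mul]; congr 1; funext y; simp

theorem Gate.matrix_cnot (c t : Q) (h : c ≠ t) :
    (Gate.cnot c t h).matrix = permOp fun y => Function.update y t (y t + y c) := rfl

/-! ### Circuits -/

theorem foldl_gate_mul (c : Circuit Q) (M : Op Q) :
    c.foldl (fun M g => g.matrix * M) M = Circuit.matrix c * M := by
  induction c generalizing M with
  | nil => simp [Circuit.matrix]
  | cons g c ih =>
    rw [Circuit.matrix, List.foldl_cons, List.foldl_cons, ih, ih (g.matrix * 1),
      Matrix.mul_one, Matrix.mul_assoc]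

@[simp] theorem Circuit.matrix_nil : Circuit.matrix ([] : Circuit Q) = 1 := rfl

theorem Circuit.matrix_append (c d : Circuit Q) :
    Circuit.matrix (c ++ d) = Circuit.matrix d * Circuit.matrix c := by
  rw [Circuit.matrix, List.foldl_append, foldl_gate_mul]; rfl

@[simp] theorem Circuit.matrix_singleton (g : Gate Q) : Circuit.matrix [g] = g.matrix := by
  simp [Circuit.matrix]

theorem Circuit.matrix_cons (g : Gate Q) (c : Circuit Q) :
    Circuit.matrix (g :: c) = Circuit.matrix c * g.matrix := by
  rw [← List.singleton_append, Circuit.matrix_append, Circuit.matrix_singleton]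

theorem Gate.matrix_map (ι : A ↪ Q) (g : Gate A) : (g.map ι).matrix = emb ι g.matrix := by
  ext x y
  cases g with
  | single q u =>
    by_cases h : ∀ r, r ≠ ι q → x r = y r
    · rw [emb_apply_pos]
      · simp only [Gate.map, Gate.matrix, Matrix.of_apply, Function.comp]
        rw [if_pos h, if_pos]
        intro r hr
        exact h _ fun e => hr (ι.injective e)
      · intro r hr
        exact h r fun e => hr ⟨q, e.symm⟩
    · simp only [Gate.map, Gate.matrix, Matrix.of_apply]
      rw [if_neg h]
      by_cases h' : ∀ r, r ∉ Set.range ι → x r = y r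
      · rw [emb_apply_pos h', Matrix.of_apply, if_neg]
        intro h''
        refine h fun r hr => ?_
        by_cases hr' : r ∈ Set.range ι
        · obtain ⟨a, rfl⟩ := hr'
          exact h'' a fun e => hr (by rw [e])
        · exact h' r hr'
      · rw [emb_apply_neg h']
  | cnot c t hct =>
    simp only [Gate.map, Gate.matrix, Matrix.of_apply]
    by_cases h : ∀ r, r ∉ Set.range ι → x r = y r
    · rw [emb_apply_pos h, Matrix.of_apply]
      refine if_congr ?_ rfl rfl
      constructor
      · intro e
        rw [e]; funext a
        by_cases ha : a = t
        · subst ha; simp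
        · simp [ha]
      · intro e
        refine ext_of_comp_of_off (ι := ι) (e.trans ?_) fun q hq => ?_
        · funext a
          by_cases ha : a = t
          · subst ha; simp
          · simp [ha]
        · rw [h q hq, Function.update_of_ne]
          rintro rfl
          exact hq ⟨t, rfl⟩
    · rw [emb_apply_neg h, if_neg]
      intro e
      refine h fun r hr => ?_
      rw [e, Function.update_of_ne]
      rintro rfl
      exact hr ⟨t, rfl⟩

theorem Circuit.matrix_map (ι : A ↪ Q) (c : Circuit A) :
    (c.map ι).matrix = emb ι c.matrix := by
  induction c with
  | nil => simp [Circuit.map, emb_one]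
  | cons g c ih =>
    rw [Circuit.matrix_cons, emb_mul ι.injective, ← ih, ← Gate.matrix_map,
      ← Circuit.matrix_cons]
    rfl

@[simp] theorem Circuit.length_map (ι : A ↪ Q) (c : Circuit A) : (c.map ι).length = c.length :=
  List.length_map _

theorem Gate.matrix_single_mul (q : Q) (u v : Matrix.unitaryGroup (Fin 2) ℂ) :
    (Gate.single q u).matrix * (Gate.single q v).matrix = (Gate.single q (u * v)).matrix := by
  ext x y
  rw [Matrix.mul_apply]
  have hq : ∀ (b : Fin 2), Function.update y q b q = b := fun b => Function.update_self ..
  have key : ∑ b : Fin 2, (Gate.single q u).matrix x (Function.update y q b) *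
      (Gate.single q v).matrix (Function.update y q b) y =
      ∑ z, (Gate.single q u).matrix x z * (Gate.single q v).matrix z y := by
    refine Fintype.sum_of_injective (fun b => Function.update y q b)
      (Function.update_injective y q) _ _ ?_ fun _ => rfl
    intro z hz
    simp only [Gate.matrix, Matrix.of_apply]
    rw [if_neg (c := ∀ r, r ≠ q → z r = y r), mul_zero]
    intro h
    refine hz ⟨z q, ?_⟩
    funext r
    by_cases hr : r = q
    · subst hr; simp
    · simp [hr, h r hr]
  rw [← key]
  simp only [Gate.matrix, Matrix.of_apply, hq]
  have h1 : ∀ b, (∀ r, r ≠ q → Function.update y q b r = y r) := fun b r hr => by simp [hr]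
  have h2 : ∀ b, (∀ r, r ≠ q → x r = Function.update y q b r) ↔ ∀ r, r ≠ q → x r = y r :=
    fun b => forall_congr' fun r => imp_congr_right fun hr => by simp [hr]
  by_cases h : ∀ r, r ≠ q → x r = y r
  · rw [if_pos h, Submonoid.coe_mul, Matrix.mul_apply]
    exact Finset.sum_congr rfl fun b _ => by rw [if_pos ((h2 b).2 h), if_pos (h1 b)]
  · rw [if_neg h]
    exact Finset.sum_eq_zero fun b _ => by rw [if_neg fun h' => h ((h2 b).1 h'), zero_mul]

theorem Gate.matrix_single_one (q : Q) :
    (Gate.single q (1 : Matrix.unitaryGroup (Fin 2) ℂ)).matrix = 1 := by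
  ext x y
  simp only [Gate.matrix, Matrix.of_apply]
  by_cases hxy : x = y
  · subst hxy; simp
  · rw [Matrix.one_apply_ne hxy]
    split_ifs with h
    · rw [Matrix.UnitaryGroup.one_val, Matrix.one_apply_ne]
      intro e
      refine hxy (funext fun r => ?_)
      by_cases hr : r = q
      · subst hr; exact e
      · exact h r hr
    · rfl

theorem Gate.matrix_single_conjTranspose (q : Q) (u : Matrix.unitaryGroup (Fin 2) ℂ) :
    ((Gate.single q u).matrix)ᴴ = (Gate.single q u⁻¹).matrix := by
  ext x y
  rw [Matrix.conjTranspose_apply]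
  simp only [Gate.matrix, Matrix.of_apply]
  by_cases h : ∀ r, r ≠ q → x r = y r
  · rw [if_pos h, if_pos fun r hr => (h r hr).symm]
    rfl
  · rw [if_neg h, if_neg fun h' => h fun r hr => (h' r hr).symm]
    simp

theorem cnot_involutive {c t : Q} (h : c ≠ t) :
    Function.Involutive fun y : Q → Fin 2 => Function.update y t (y t + y c) := by
  intro y
  funext r
  by_cases hr : r = t
  · subst hr
    simp only [Function.update_self, Function.update_of_ne h]
    generalize y r = a; generalize y c = b
    revert a b; decide
  · simp [hr]

theorem permOp_conjTranspose {f : (Q → Fin 2) → (Q → Fin 2)} (hf : Function.Involutive f) :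
    (permOp f)ᴴ = permOp f := by
  ext x y
  rw [Matrix.conjTranspose_apply]
  simp only [permOp, mono, Matrix.of_apply, Pi.one_apply]
  have : y = f x ↔ x = f y := ⟨fun e => by rw [e, hf], fun e => by rw [e, hf]⟩
  by_cases h : x = f y
  · rw [if_pos h, if_pos (this.2 h)]; simp
  · rw [if_neg h, if_neg fun e => h (this.1 e)]; simp

theorem Gate.matrix_inv (g : Gate Q) : g.inv.matrix = g.matrixᴴ := by
  cases g with
  | single q u => rw [Gate.matrix_single_conjTranspose]; rfl
  | cnot c t h => rw [Gate.matrix_cnot, permOp_conjTranspose (cnot_involutive h)]; rfl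

theorem Gate.conjTranspose_mul_self (g : Gate Q) : g.matrixᴴ * g.matrix = 1 := by
  cases g with
  | single q u =>
    rw [Gate.matrix_single_conjTranspose, Gate.matrix_single_mul, inv_mul_cancel,
      Gate.matrix_single_one]
  | cnot c t h =>
    rw [Gate.matrix_cnot, permOp_conjTranspose (cnot_involutive h), permOp_mul,
      (cnot_involutive h).comp_self, one_eq_mono]

theorem Circuit.conjTranspose_mul_self (c : Circuit Q) : c.matrixᴴ * c.matrix = 1 := by
  induction c with
  | nil => simp
  | cons g c ih =>
    rw [Circuit.matrix_cons, Matrix.conjTranspose_mul, Matrix.mul_assoc,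
      ← Matrix.mul_assoc _ (Circuit.matrix c), ih, Matrix.one_mul, g.conjTranspose_mul_self]

theorem Circuit.matrix_inv (c : Circuit Q) : c.inv.matrix = c.matrixᴴ := by
  induction c with
  | nil => simp [Circuit.inv]
  | cons g c ih =>
    rw [Circuit.matrix_cons, Matrix.conjTranspose_mul, ← ih, Circuit.inv, List.map_cons,
      List.reverse_cons, Circuit.matrix_append, Circuit.matrix_singleton, Gate.matrix_inv]
    rfl

@[simp] theorem Circuit.length_inv (c : Circuit Q) : c.inv.length = c.length := by
  simp [Circuit.inv]

end Operators

/-! ### Controlled gates -/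

theorem fin2_cases (a : Fin 2) : a = 0 ∨ a = 1 := by
  revert a; decide

/-- The one-qubit gate `diag(z₀, z₁)`. -/
def diagU (z₀ z₁ : Circle) : Matrix.unitaryGroup (Fin 2) ℂ :=
  ⟨Matrix.diagonal ![(z₀ : ℂ), (z₁ : ℂ)], by
    rw [Matrix.mem_unitaryGroup_iff, Matrix.star_eq_conjTranspose,
      Matrix.diagonal_conjTranspose, Matrix.diagonal_mul_diagonal, ← Matrix.diagonal_one]
    congr 1
    funext i
    fin_cases i <;> simp [Complex.mul_conj]⟩

theorem exists_circle_sq (z : Circle) : ∃ s : Circle, s * s = z := by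
  refine ⟨Circle.exp (Complex.arg z / 2), ?_⟩
  rw [← Circle.exp_add, add_halves, Circle.exp_arg]

/-- Completion of a unit vector of `ℂ²` to a unitary matrix. -/
def completeU (a b : ℂ) (h : ‖a‖ ^ 2 + ‖b‖ ^ 2 = 1) : Matrix.unitaryGroup (Fin 2) ℂ :=
  ⟨!![a, -star b; b, star a], by
    have h' : (starRingEnd ℂ) a * a + (starRingEnd ℂ) b * b = 1 := by
      rw [mul_comm, Complex.mul_conj, mul_comm, Complex.mul_conj, Complex.normSq_eq_norm_sq,
        Complex.normSq_eq_norm_sq]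
      exact_mod_cast h
    rw [Matrix.mem_unitaryGroup_iff', Matrix.star_eq_conjTranspose]
    ext i j
    fin_cases i <;> fin_cases j <;>
      simp [Matrix.mul_apply, Fin.sum_univ_two, Matrix.conjTranspose_apply]
    · exact h'
    · ring
    · ring
    · linear_combination h'⟩

theorem diagU_of_lower_zero (d : Matrix.unitaryGroup (Fin 2) ℂ)
    (h : (d : Matrix (Fin 2) (Fin 2) ℂ) 1 0 = 0) : ∃ z₀ z₁ : Circle, d = diagU z₀ z₁ := by
  have hd := (Matrix.mem_unitaryGroup_iff' (A := (d : Matrix (Fin 2) (Fin 2) ℂ))).1 d.2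
  rw [Matrix.star_eq_conjTranspose] at hd
  have h00 := congrFun (congrFun hd 0) 0
  have h01 := congrFun (congrFun hd 0) 1
  have h11 := congrFun (congrFun hd 1) 1
  simp only [Matrix.mul_apply, Fin.sum_univ_two, Matrix.conjTranspose_apply, h, star_zero,
    zero_mul, add_zero, Matrix.one_apply_eq] at h00 h01 h11
  rw [Matrix.one_apply_ne (by decide)] at h01
  have hz : (d : Matrix (Fin 2) (Fin 2) ℂ) 0 1 = 0 := by
    rcases mul_eq_zero.1 h01 with h1 | h1
    · rw [h1, zero_mul] at h00; exact absurd h00 (by norm_num)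
    · exact h1
  simp only [hz, star_zero, zero_mul, zero_add] at h11
  have nrm : ∀ z : ℂ, star z * z = 1 → ‖z‖ = 1 := fun z hz => by
    have : ‖star z * z‖ = 1 := by rw [hz]; simp
    rw [norm_mul, norm_star] at this
    nlinarith [norm_nonneg z]
  refine ⟨⟨_, mem_sphere_zero_iff_norm.2 (nrm _ h00)⟩,
    ⟨_, mem_sphere_zero_iff_norm.2 (nrm _ h11)⟩, ?_⟩
  apply Subtype.ext
  ext i j
  fin_cases i <;> fin_cases j <;> simp [diagU, h, hz]

/-- Every one-qubit unitary is unitarily diagonalizable. -/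
theorem exists_diagonalization (u : Matrix.unitaryGroup (Fin 2) ℂ) :
    ∃ (v : Matrix.unitaryGroup (Fin 2) ℂ) (z₀ z₁ : Circle), u = v * diagU z₀ z₁ * v⁻¹ := by
  obtain ⟨l, hl⟩ := Module.End.exists_eigenvalue (Matrix.toLin' (u : Matrix (Fin 2) (Fin 2) ℂ))
  obtain ⟨w, hw⟩ := hl.exists_hasEigenvector
  have hw1 := hw.apply_eq_smul
  have hw0 := hw.2
  rw [Matrix.toLin'_apply] at hw1
  set s : ℝ := ‖w 0‖ ^ 2 + ‖w 1‖ ^ 2 with hs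
  have hspos : 0 < s := by
    by_contra h
    have h0 : ‖w 0‖ ^ 2 = 0 := by nlinarith [sq_nonneg ‖w 0‖, sq_nonneg ‖w 1‖]
    have h1 : ‖w 1‖ ^ 2 = 0 := by nlinarith [sq_nonneg ‖w 0‖, sq_nonneg ‖w 1‖]
    refine hw0 (funext fun i => ?_)
    fin_cases i
    · simpa using h0
    · simpa using h1
  have hsq := Real.sq_sqrt hspos.le
  have hne := Real.sqrt_pos.2 hspos
  have hn : ∀ z : ℂ, ‖z / (Real.sqrt s : ℂ)‖ ^ 2 = ‖z‖ ^ 2 / s := fun z => by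
    rw [norm_div, div_pow, Complex.norm_real, Real.norm_of_nonneg hne.le, hsq]
  let v := completeU (w 0 / (Real.sqrt s : ℂ)) (w 1 / (Real.sqrt s : ℂ)) (by
    rw [hn, hn, ← add_div, ← hs, div_self hspos.ne'])
  have e0 := congrFun hw1 0
  have e1 := congrFun hw1 1
  simp only [Matrix.mulVec, dotProduct, Fin.sum_univ_two, Pi.smul_apply, smul_eq_mul] at e0 e1
  obtain ⟨z₀, z₁, hz⟩ := diagU_of_lower_zero (v⁻¹ * u * v) (by
    have hv : ((v⁻¹ * u * v : Matrix.unitaryGroup (Fin 2) ℂ) : Matrix (Fin 2) (Fin 2) ℂ)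
      = (v : Matrix (Fin 2) (Fin 2) ℂ)ᴴ * u * v := rfl
    rw [hv, Matrix.mul_assoc]
    simp only [v, completeU, Matrix.mul_apply, Fin.sum_univ_two, Matrix.conjTranspose_apply,
      Matrix.of_apply, Matrix.cons_val_zero, Matrix.cons_val_one, Matrix.cons_val']
    simp
    have hc : (Real.sqrt s : ℂ) ≠ 0 := by exact_mod_cast hne.ne'
    field_simp
    linear_combination w 0 * e1 - w 1 * e0)
  refine ⟨v, z₀, z₁, ?_⟩
  rw [← hz]; group

/-- Completion of a contraction on `ℂ` to a unitary matrix on `ℂ²`. -/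
theorem exists_unitary_entry (a : ℂ) (h : ‖a‖ ≤ 1) :
    ∃ u : Matrix.unitaryGroup (Fin 2) ℂ, (u : Matrix (Fin 2) (Fin 2) ℂ) 0 0 = a := by
  refine ⟨completeU a (Real.sqrt (1 - ‖a‖ ^ 2) : ℂ) ?_, by simp [completeU]⟩
  rw [Complex.norm_real, Real.norm_of_nonneg (Real.sqrt_nonneg _), Real.sq_sqrt]
  · ring
  · nlinarith [norm_nonneg a]

section

variable {Q : Type} [Fintype Q] [DecidableEq Q]

theorem Gate.matrix_single_apply_self {q : Q} {u : Matrix.unitaryGroup (Fin 2) ℂ}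
    {x y : Q → Fin 2} (h : ∀ r, r ≠ q → x r = y r) :
    (Gate.single q u).matrix x y = (u : Matrix (Fin 2) (Fin 2) ℂ) (x q) (y q) := by
  simp only [Gate.matrix, Matrix.of_apply]; rw [if_pos h]

theorem Gate.keeps_single {α : Type} (q : Q) (u : Matrix.unitaryGroup (Fin 2) ℂ)
    {φ : (Q → Fin 2) → α} (hφ : ∀ x y : Q → Fin 2, (∀ r, r ≠ q → x r = y r) → φ x = φ y) :
    Keeps φ (Gate.single q u).matrix := by
  intro x y h
  refine hφ x y ?_
  by_contra h'
  refine h ?_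
  simp only [Gate.matrix, Matrix.of_apply]; rw [if_neg h']

theorem Gate.matrix_single_diagU (q : Q) (z₀ z₁ : Circle) :
    (Gate.single q (diagU z₀ z₁)).matrix =
      Matrix.diagonal fun y => if y q = 1 then (z₁ : ℂ) else z₀ := by
  ext x y
  by_cases hxy : x = y
  · subst hxy
    rw [Gate.matrix_single_apply_self fun _ _ => rfl, Matrix.diagonal_apply_eq]
    rcases fin2_cases (x q) with h | h <;> simp [diagU, h]
  · rw [Matrix.diagonal_apply_ne _ hxy]
    simp only [Gate.matrix, Matrix.of_apply]
    split_ifs with h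
    · simp only [diagU]
      rw [Matrix.diagonal_apply_ne]
      intro e
      refine hxy (funext fun r => ?_)
      by_cases hr : r = q
      · subst hr; exact e
      · exact h r hr
    · rfl

theorem cnot_conj_diagonal {c t : Q} (h : c ≠ t) (d : (Q → Fin 2) → ℂ) :
    (Gate.cnot c t h).matrix * Matrix.diagonal d * (Gate.cnot c t h).matrix =
      Matrix.diagonal fun y => d (Function.update y t (y t + y c)) := by
  rw [Gate.matrix_cnot, permOp, diagonal_eq_mono, diagonal_eq_mono, mono_mul, mono_mul]
  congr 1
  · simpa using (cnot_involutive h).comp_self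
  · funext y; simp

/-- A controlled diagonal gate: `5` gates, as `2ct = c + t - (c ⊕ t)`. -/
theorem exists_circuit_cphase {c t : Q} (h : c ≠ t) (z₀ z₁ : Circle) :
    ∃ C : Circuit Q, C.length ≤ 5 ∧ C.matrix =
      Matrix.diagonal fun y => if y c = 1 then (if y t = 1 then (z₁ : ℂ) else z₀) else 1 := by
  obtain ⟨s, hs⟩ := exists_circle_sq (z₁ / z₀)
  refine ⟨[.single c (diagU 1 (z₀ * s)), .single t (diagU 1 s), .cnot c t h,
    .single t (diagU 1 s⁻¹), .cnot c t h], by simp, ?_⟩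
  have e : (z₁ : ℂ) = z₀ * s * s := by
    have : z₁ = z₀ * (s * s) := by rw [hs]; simp
    rw [this]; push_cast; ring
  have hs0 : (s : ℂ) * (s : ℂ)⁻¹ = 1 := mul_inv_cancel₀ (Circle.coe_ne_zero s)
  simp only [Circuit.matrix_cons, Circuit.matrix_nil, Matrix.one_mul, Gate.matrix_single_diagU]
  rw [cnot_conj_diagonal, Matrix.diagonal_mul_diagonal, Matrix.diagonal_mul_diagonal]
  congr 1
  funext y
  simp only [Function.update_self]
  rcases fin2_cases (y c) with hc | hc <;> rcases fin2_cases (y t) with ht | ht <;>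
    simp [hc, ht, e]
  · linear_combination (z₀ : ℂ) * hs0
  · ring

/-- A controlled one-qubit gate. -/
theorem exists_circuit_csingle {c t : Q} (h : c ≠ t) (u : Matrix.unitaryGroup (Fin 2) ℂ) :
    ∃ C : Circuit Q, C.length ≤ 7 ∧
      C.matrix = cond (fun y => y c = 1) (Gate.single t u).matrix 1 := by
  obtain ⟨v, z₀, z₁, hu⟩ := exists_diagonalization u
  obtain ⟨C, hC, hCm⟩ := exists_circuit_cphase h z₀ z₁
  refine ⟨.single t v⁻¹ :: (C ++ [.single t v]), by simp; omega, ?_⟩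
  have hk : ∀ w : Matrix.unitaryGroup (Fin 2) ℂ,
      Keeps (fun y : Q → Fin 2 => y c = 1) (Gate.single t w).matrix := fun w =>
    Gate.keeps_single t w fun x y hxy => by rw [hxy c h]
  have hD : (Matrix.diagonal fun y : Q → Fin 2 =>
      if y c = 1 then (if y t = 1 then (z₁ : ℂ) else z₀) else 1) =
      cond (fun y => y c = 1) (Gate.single t (diagU z₀ z₁)).matrix 1 := by
    rw [Gate.matrix_single_diagU]
    ext x y
    by_cases hxy : x = y
    · subst hxy; simp [cond]
    · simp [cond, hxy, Matrix.one_apply]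
  rw [Circuit.matrix_cons, Circuit.matrix_append, Circuit.matrix_singleton, hCm, hD,
    ← cond_self (fun y => y c = 1) (Gate.single t v).matrix, cond_mul _ _ (hk _) (Keeps.one _),
    ← cond_self (fun y => y c = 1) (Gate.single t v⁻¹).matrix, cond_mul _ _ (hk _) (hk _),
    Gate.matrix_single_mul, Gate.matrix_single_mul, ← hu, Matrix.mul_one,
    Gate.matrix_single_mul, mul_inv_cancel, Gate.matrix_single_one]

/-- The Hadamard gate. -/
def hadamardU : Matrix.unitaryGroup (Fin 2) ℂ :=
  ⟨((1 / Real.sqrt 2 : ℝ) : ℂ) • !![1, 1; 1, -1], by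
    have h2 : ((1 / Real.sqrt 2 : ℝ) : ℂ) * ((1 / Real.sqrt 2 : ℝ) : ℂ) = 1 / 2 := by
      rw [← Complex.ofReal_mul, div_mul_div_comm, Real.mul_self_sqrt (by norm_num)]; norm_num
    rw [Matrix.mem_unitaryGroup_iff', Matrix.star_eq_conjTranspose]
    ext i j
    fin_cases i <;> fin_cases j <;>
      simp [Matrix.mul_apply, Fin.sum_univ_two, Matrix.conjTranspose_apply] <;>
      simp at h2 <;> linear_combination 2 * h2⟩

/-- The Pauli `X` gate. -/
def pauliX : Matrix.unitaryGroup (Fin 2) ℂ :=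
  ⟨!![0, 1; 1, 0], by
    rw [Matrix.mem_unitaryGroup_iff', Matrix.star_eq_conjTranspose]
    ext i j
    fin_cases i <;> fin_cases j <;>
      simp [Matrix.mul_apply, Fin.sum_univ_two, Matrix.conjTranspose_apply]⟩

theorem pauliX_mul_pauliX : pauliX * pauliX = 1 := by
  apply Subtype.ext
  ext i j
  fin_cases i <;> fin_cases j <;> simp [pauliX]

theorem hadamardU_mul_self : hadamardU * hadamardU = 1 := by
  apply Subtype.ext
  have h2 : ((1 / Real.sqrt 2 : ℝ) : ℂ) * ((1 / Real.sqrt 2 : ℝ) : ℂ) = 1 / 2 := by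
    rw [← Complex.ofReal_mul, div_mul_div_comm, Real.mul_self_sqrt (by norm_num)]; norm_num
  simp at h2
  ext i j
  fin_cases i <;> fin_cases j <;>
    simp [hadamardU] <;> linear_combination 2 * h2

theorem hadamardU_conj_Z : hadamardU * diagU 1 (-1) * hadamardU = pauliX := by
  apply Subtype.ext
  have h2 : ((1 / Real.sqrt 2 : ℝ) : ℂ) * ((1 / Real.sqrt 2 : ℝ) : ℂ) = 1 / 2 := by
    rw [← Complex.ofReal_mul, div_mul_div_comm, Real.mul_self_sqrt (by norm_num)]; norm_num
  simp at h2
  have hd : (diagU 1 (-1) : Matrix (Fin 2) (Fin 2) ℂ) = !![1, 0; 0, -1] := by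
    ext i j
    fin_cases i <;> fin_cases j <;> simp [diagU]
  change (hadamardU : Matrix (Fin 2) (Fin 2) ℂ) * (diagU 1 (-1) : Matrix (Fin 2) (Fin 2) ℂ) *
    (hadamardU : Matrix (Fin 2) (Fin 2) ℂ) = pauliX
  rw [hd]
  ext i j
  fin_cases i <;> fin_cases j <;>
    simp [hadamardU, pauliX] <;> linear_combination 2 * h2

theorem Gate.matrix_pauliX (q : Q) :
    (Gate.single q pauliX).matrix = permOp fun y => Function.update y q (y q + 1) := by
  ext x y
  simp only [Gate.matrix, permOp, mono, Matrix.of_apply, Pi.one_apply]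
  by_cases h : ∀ r, r ≠ q → x r = y r
  · rw [if_pos h]
    have : x = Function.update y q (y q + 1) ↔ x q = y q + 1 := by
      constructor
      · intro e; rw [e]; simp
      · intro e; funext r
        by_cases hr : r = q
        · subst hr; simp [e]
        · simp [hr, h r hr]
    simp only [this]
    generalize x q = a; generalize y q = b
    fin_cases a <;> fin_cases b <;> simp [pauliX]
  · rw [if_neg h, if_neg]
    intro e
    exact h fun r hr => by rw [e]; simp [hr]

/-- The Toffoli gate. -/
theorem exists_circuit_toffoli {a b t : Q} (hab : a ≠ b) (hat : a ≠ t) (hbt : b ≠ t) :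
    ∃ C : Circuit Q, C.length ≤ 20 ∧
      C.matrix = permOp fun y => Function.update y t (y t + y a * y b) := by
  let i : Circle := Circle.exp (Real.pi / 2)
  have hi : (i : ℂ) = Complex.I := by
    simp only [i, Circle.coe_exp]; push_cast; exact Complex.exp_pi_div_two_mul_I
  obtain ⟨C₁, h₁, e₁⟩ := exists_circuit_cphase hat 1 i
  obtain ⟨C₂, h₂, e₂⟩ := exists_circuit_cphase hbt 1 i
  obtain ⟨C₃, h₃, e₃⟩ := exists_circuit_cphase hbt 1 i⁻¹
  let p : (Q → Fin 2) → Prop := fun y => y a = 1 ∧ y b = 1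
  have hk : ∀ w : Matrix.unitaryGroup (Fin 2) ℂ, Keeps p (Gate.single t w).matrix := fun w =>
    Gate.keeps_single t w fun x y hxy => by simp only [p]; rw [hxy a hat, hxy b hbt]
  -- `i ^ (t (a + b - (a ⊕ b))) = (-1) ^ (a b t)`
  have hZ : Circuit.matrix (C₁ ++ C₂ ++ [.cnot a b hab] ++ C₃ ++ [.cnot a b hab]) =
      cond p (Gate.single t (diagU 1 (-1))).matrix 1 := by
    simp only [Circuit.matrix_append, Circuit.matrix_singleton, e₁, e₂, e₃, ← Matrix.mul_assoc]
    rw [cnot_conj_diagonal, Matrix.mul_assoc, Matrix.diagonal_mul_diagonal,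
      Matrix.diagonal_mul_diagonal, Gate.matrix_single_diagU]
    ext x y
    by_cases hxy : x = y
    · subst hxy
      rw [Matrix.diagonal_apply_eq]
      simp only [Function.update_self, Function.update_of_ne hbt.symm, cond, Matrix.of_apply,
        Matrix.diagonal_apply_eq, Matrix.one_apply_eq, p, Circle.coe_inv, hi]
      rcases fin2_cases (x a) with ha | ha <;> rcases fin2_cases (x b) with hb | hb <;>
        rcases fin2_cases (x t) with ht | ht <;> simp [ha, hb, ht]
    · simp [cond, hxy, Matrix.one_apply]
  refine ⟨[.single t hadamardU] ++ (C₁ ++ C₂ ++ [.cnot a b hab] ++ C₃ ++ [.cnot a b hab]) ++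
    [.single t hadamardU], by simp; omega, ?_⟩
  rw [Circuit.matrix_append, Circuit.matrix_append, hZ, Circuit.matrix_singleton,
    ← cond_self p (Gate.single t hadamardU).matrix, cond_mul _ _ (hk _) (hk _),
    cond_mul _ _ ((hk _).mul (hk _)) ((Keeps.one _).mul (hk _)), Gate.matrix_single_mul,
    Matrix.one_mul, Gate.matrix_single_mul, Gate.matrix_single_mul, hadamardU_mul_self,
    ← mul_assoc, hadamardU_conj_Z, Gate.matrix_single_one, Gate.matrix_pauliX]
  ext x y
  simp only [cond, permOp, mono, Matrix.of_apply, p, Pi.one_apply, Matrix.one_apply]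
  rcases fin2_cases (y a) with ha | ha <;> rcases fin2_cases (y b) with hb | hb <;>
    simp [ha, hb]

/-- The gate `g`, controlled by an additional qubit. -/
theorem Gate.exists_circuit_controlled (g : Gate Q) :
    ∃ C : Circuit (Unit ⊕ Q), C.length ≤ 20 ∧
      C.matrix = cond (fun y => y (Sum.inl ()) = 1) (emb Sum.inr g.matrix) 1 := by
  have hmap : emb Sum.inr g.matrix = (g.map (Function.Embedding.inr (α := Unit))).matrix :=
    (Gate.matrix_map (Function.Embedding.inr (α := Unit) (β := Q)) g).symm
  rw [hmap]
  cases g with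
  | single q u =>
    obtain ⟨C, hC, e⟩ := exists_circuit_csingle
      (c := (Sum.inl () : Unit ⊕ Q)) (t := Sum.inr q) (by simp) u
    exact ⟨C, by omega, e⟩
  | cnot c t h =>
    obtain ⟨C, hC, e⟩ := exists_circuit_toffoli (a := (Sum.inl () : Unit ⊕ Q))
      (b := Sum.inr c) (t := Sum.inr t) (by simp) (by simp) (by simpa using h)
    refine ⟨C, hC, ?_⟩
    rw [e]
    ext x y
    simp only [Gate.map, Gate.matrix, cond, permOp, mono, Matrix.of_apply, Pi.one_apply,
      Matrix.one_apply, Function.Embedding.inr_apply]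
    rcases fin2_cases (y (Sum.inl ())) with ha | ha <;> simp [ha]

/-- Controlling every gate of a circuit controls the circuit. -/
theorem Circuit.exists_controlled (c : Circuit Q) :
    ∃ C : Circuit (Unit ⊕ Q), C.length ≤ 20 * c.length ∧
      C.matrix = cond (fun y => y (Sum.inl ()) = 1) (emb Sum.inr c.matrix) 1 := by
  induction c with
  | nil => exact ⟨[], by simp, by simp [emb_one]⟩
  | cons g c ih =>
    obtain ⟨C, hC, e⟩ := ih
    obtain ⟨D, hD, e'⟩ := g.exists_circuit_controlled
    refine ⟨D ++ C, by simp; omega, ?_⟩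
    rw [Circuit.matrix_append, e, e', cond_mul, Circuit.matrix_cons, emb_mul Sum.inr_injective,
      Matrix.one_mul]
    · exact Keeps.emb_off _ fun x y h => by rw [h (Sum.inl ()) (by simp)]
    · exact Keeps.one _

end

/-! ### Automata evaluated on dirty qubits -/

section

variable {Q : Type} [Fintype Q] [DecidableEq Q]

/-- The classical map that adds the bit `g y` to the qubit `t`. -/
def xorMap (t : Q) (g : (Q → Fin 2) → Fin 2) (y : Q → Fin 2) : Q → Fin 2 :=
  Function.update y t (y t + g y)

theorem xorMap_comp (t : Q) (g g' : (Q → Fin 2) → Fin 2)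
    (hg : ∀ y b, g (Function.update y t b) = g y) :
    xorMap t g ∘ xorMap t g' = xorMap t fun y => g' y + g y := by
  funext y
  simp [xorMap, hg, add_assoc]

theorem exists_circuit_xor_bit {a t : Q} (hat : a ≠ t) (u : Fin 2 → Fin 2) :
    ∃ C : Circuit Q, C.length ≤ 2 ∧ C.matrix = permOp (xorMap t fun y => u (y a)) := by
  refine ⟨(if u 0 = 1 then [Gate.single t pauliX] else []) ++
    (if u 0 + u 1 = 1 then [Gate.cnot a t hat] else []), ?_, ?_⟩
  · split_ifs <;> simp
  · have h1 : Circuit.matrix (if u 0 = 1 then [Gate.single t pauliX] else []) =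
        permOp (xorMap t fun _ => u 0) := by
      rcases fin2_cases (u 0) with h | h
      · rw [h, if_neg (by decide), Circuit.matrix_nil, one_eq_mono]
        congr 1; funext y; simp [xorMap]
      · rw [h, if_pos rfl, Circuit.matrix_singleton, Gate.matrix_pauliX]; rfl
    have h2 : Circuit.matrix (if u 0 + u 1 = 1 then [Gate.cnot a t hat] else []) =
        permOp (xorMap t fun y => (u 0 + u 1) * y a) := by
      rcases fin2_cases (u 0 + u 1) with h | h
      · rw [h, if_neg (by decide), Circuit.matrix_nil, one_eq_mono]
        congr 1; funext y; simp [xorMap]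
      · rw [h, if_pos rfl, Circuit.matrix_singleton, Gate.matrix_cnot]
        congr 1; funext y; simp [xorMap]
    rw [Circuit.matrix_append, h1, h2, permOp_mul, xorMap_comp]
    · congr 2; funext y
      have key : ∀ p q a r : Fin 2, (a = 0 → r = p) → (a = 1 → r = q) →
          p + (p + q) * a = r := by decide
      exact key _ _ _ _ (fun h => by rw [h]) (fun h => by rw [h])
    · intro y b; simp [hat]

/-- One step of an automaton with two states: an arbitrary function of the input bit multiplies the
bit that carries the state. -/
theorem exists_circuit_xor_mul {a c t : Q} (hac : a ≠ c) (hat : a ≠ t) (hct : c ≠ t)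
    (v : Fin 2 → Fin 2) :
    ∃ C : Circuit Q, C.length ≤ 21 ∧
      C.matrix = permOp (xorMap t fun y => v (y a) * y c) := by
  obtain ⟨T, hT, eT⟩ := exists_circuit_toffoli hac hat hct
  refine ⟨(if v 0 = 1 then [Gate.cnot c t hct] else []) ++
    (if v 0 + v 1 = 1 then T else []), ?_, ?_⟩
  · split_ifs <;> simp <;> omega
  · have h1 : Circuit.matrix (if v 0 = 1 then [Gate.cnot c t hct] else []) =
        permOp (xorMap t fun y => v 0 * y c) := by
      rcases fin2_cases (v 0) with h | h
      · rw [h, if_neg (by decide), Circuit.matrix_nil, one_eq_mono]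
        congr 1; funext y; simp [xorMap]
      · rw [h, if_pos rfl, Circuit.matrix_singleton, Gate.matrix_cnot]
        congr 1; funext y; simp [xorMap]
    have h2 : Circuit.matrix (if v 0 + v 1 = 1 then T else []) =
        permOp (xorMap t fun y => (v 0 + v 1) * (y a * y c)) := by
      rcases fin2_cases (v 0 + v 1) with h | h
      · rw [h, if_neg (by decide), Circuit.matrix_nil, one_eq_mono]
        congr 1; funext y; simp [xorMap]
      · rw [h, if_pos rfl, eT]
        congr 1; funext y; simp [xorMap]
    rw [Circuit.matrix_append, h1, h2, permOp_mul, xorMap_comp]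
    · congr 2; funext y
      have key : ∀ p q a c r : Fin 2, (a = 0 → r = p) → (a = 1 → r = q) →
          p * c + (p + q) * (a * c) = r * c := by decide
      exact key _ _ _ _ _ (fun h => by rw [h]) (fun h => by rw [h])
    · intro y b; simp [hat, hct]

/-- The state after `k` steps of the automaton with two states, initial state `0` and transition
functions `δ j`, that reads the bits `y (b 0), y (b 1), …`. -/
def autoState (b : ℕ → Q) (δ : ℕ → Fin 2 → Fin 2 → Fin 2) (y : Q → Fin 2) : ℕ → Fin 2
  | 0 => 0
  | k + 1 => δ k (y (b k)) (autoState b δ y k)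

theorem autoState_congr {b : ℕ → Q} {δ : ℕ → Fin 2 → Fin 2 → Fin 2} {y y' : Q → Fin 2} {k : ℕ}
    (h : ∀ j < k, y (b j) = y' (b j)) : autoState b δ y k = autoState b δ y' k := by
  induction k with
  | zero => rfl
  | succ k ih =>
    rw [autoState, autoState, h k (by omega), ih fun j hj => h j (by omega)]

/-- The classical map that adds the state after `j` steps to the qubit `d j`, for all `j ≤ k`. -/
def ladderMap (b d : ℕ → Q) (δ : ℕ → Fin 2 → Fin 2 → Fin 2) : ℕ → (Q → Fin 2) → (Q → Fin 2)
  | 0 => id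
  | k + 1 => fun y => Function.update (ladderMap b d δ k y) (d (k + 1))
      (y (d (k + 1)) + autoState b δ y (k + 1))

theorem ladderMap_off {b d : ℕ → Q} {δ : ℕ → Fin 2 → Fin 2 → Fin 2} {k : ℕ} {y : Q → Fin 2}
    {q : Q} (hq : ∀ j ≤ k, q ≠ d j) : ladderMap b d δ k y q = y q := by
  induction k with
  | zero => rfl
  | succ k ih =>
    simp only [ladderMap]
    rw [Function.update_of_ne (hq _ le_rfl), ih fun j hj => hq j (by omega)]

theorem ladderMap_on {b d : ℕ → Q} {δ : ℕ → Fin 2 → Fin 2 → Fin 2} {k : ℕ} {y : Q → Fin 2}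
    (hd : ∀ i j, i ≤ k → j ≤ k → d i = d j → i = j) {j : ℕ} (hj : j ≤ k) :
    ladderMap b d δ k y (d j) = y (d j) + autoState b δ y j := by
  induction k with
  | zero => obtain rfl : j = 0 := by omega
            simp [ladderMap, autoState]
  | succ k ih =>
    simp only [ladderMap]
    by_cases h : j = k + 1
    · subst h; rw [Function.update_self]
    · rw [Function.update_of_ne fun e => h (hd _ _ hj le_rfl e),
        ih (fun i j hi hj => hd i j (by omega) (by omega)) (by omega)]

/-- The ladder of Toffoli gates: `d (k + 1)` is corrected by a multiple of `d k` before and after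
`d k` is toggled, so that the initial content of the dirty qubits cancels. -/
theorem exists_circuit_ladder (b d : ℕ → Q) (δ : ℕ → Fin 2 → Fin 2 → Fin 2) (k : ℕ)
    (hd : ∀ i j, i ≤ k → j ≤ k → d i = d j → i = j)
    (hb : ∀ i j, i < k → j ≤ k → b i ≠ d j) :
    ∃ C : Circuit Q, C.length ≤ 44 * k ∧ C.matrix = permOp (ladderMap b d δ k) := by
  induction k with
  | zero => exact ⟨[], by simp, by rw [Circuit.matrix_nil, one_eq_mono]; rfl⟩
  | succ k ih =>
    have hd' : ∀ i j, i ≤ k → j ≤ k → d i = d j → i = j :=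
      fun i j hi hj => hd i j (by omega) (by omega)
    obtain ⟨R, hR, eR⟩ := ih hd' (fun i j hi hj => hb i j (by omega) (by omega))
    have n1 : b k ≠ d k := hb k k (by omega) (by omega)
    have n2 : b k ≠ d (k + 1) := hb k (k + 1) (by omega) (by omega)
    have n3 : d k ≠ d (k + 1) := fun e => by
      have := hd k (k + 1) (by omega) le_rfl e; omega
    obtain ⟨V, hV, eV⟩ := exists_circuit_xor_mul n1 n2 n3 fun x => δ k x 0 + δ k x 1
    obtain ⟨U, hU, eU⟩ := exists_circuit_xor_bit n2 fun x => δ k x 0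
    refine ⟨V ++ R ++ V ++ U, by simp; omega, ?_⟩
    simp only [Circuit.matrix_append, eV, eR, eU, permOp_mul]
    congr 1
    funext y
    simp only [Function.comp]
    set y₁ := xorMap (d (k + 1)) (fun y => (δ k (y (b k)) 0 + δ k (y (b k)) 1) * y (d k)) y
      with hy₁
    have hst : ∀ j ≤ k, autoState b δ y₁ j = autoState b δ y j := fun j hj =>
      autoState_congr fun i hi => by
        rw [hy₁, xorMap, Function.update_of_ne (hb i (k + 1) (by omega) le_rfl)]
    have off : ∀ q, q ≠ d (k + 1) → y₁ q = y q := fun q hq => by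
      rw [hy₁, xorMap, Function.update_of_ne hq]
    have hbk : ladderMap b d δ k y₁ (b k) = y (b k) := by
      rw [ladderMap_off fun j hj => hb k j (by omega) (by omega), off _ n2]
    have hdk : ladderMap b d δ k y₁ (d k) = y (d k) + autoState b δ y k := by
      rw [ladderMap_on hd' le_rfl, off _ n3, hst k le_rfl]
    have ht : ladderMap b d δ k y₁ (d (k + 1)) =
        y (d (k + 1)) + (δ k (y (b k)) 0 + δ k (y (b k)) 1) * y (d k) := by
      rw [ladderMap_off, hy₁, xorMap, Function.update_self]
      intro j hj e
      have := hd (k + 1) j le_rfl (by omega) e; omega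
    funext q
    by_cases hq : q = d (k + 1)
    · subst hq
      simp only [ladderMap, xorMap, Function.update_self, Function.update_of_ne n2, hbk, hdk, ht,
        autoState]
      have key : ∀ t p q s e r : Fin 2, (s = 0 → r = p) → (s = 1 → r = q) →
          t + (p + q) * e + (p + q) * (e + s) + p = t + r := by decide
      exact key _ _ _ _ _ _ (fun h => by rw [h]) (fun h => by rw [h])
    · simp only [ladderMap, xorMap, Function.update_of_ne hq]
      by_cases hq' : ∃ j ≤ k, q = d j
      · obtain ⟨j, hj, rfl⟩ := hq'
        rw [ladderMap_on hd' hj, ladderMap_on hd' hj, off _ hq, hst j hj]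
      · push Not at hq'
        rw [ladderMap_off hq', ladderMap_off hq', off _ hq]

/-- The final state of an automaton can be added to a target qubit. -/
theorem exists_circuit_automaton (b : ℕ → Q) (δ : ℕ → Fin 2 → Fin 2 → Fin 2) (k : ℕ) (t : Q)
    (hb : ∀ j < k, b j ≠ t) (hcard : 2 * k + 1 ≤ Fintype.card Q) :
    ∃ C : Circuit Q, C.length ≤ 88 * k ∧
      C.matrix = permOp (xorMap t fun y => autoState b δ y k) := by
  rcases k with _ | k
  · refine ⟨[], by simp, ?_⟩
    rw [Circuit.matrix_nil, one_eq_mono]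
    congr 1; funext y; simp [xorMap, autoState]
  -- `k + 1` further qubits serve as dirty workspace
  let F : Finset Q := insert t ((Finset.range (k + 1)).image b)
  have hF : F.card ≤ k + 2 := by
    refine (Finset.card_insert_le _ _).trans ?_
    have := Finset.card_image_le (s := Finset.range (k + 1)) (f := b)
    rw [Finset.card_range] at this
    omega
  obtain ⟨D, hDF, hD⟩ := Finset.exists_subset_card_eq (s := Fᶜ) (n := k + 1) (by
    rw [Finset.card_compl]; omega)
  let e : Fin (k + 1) ≃ D := (Finset.equivFinOfCardEq hD).symm
  let d : ℕ → Q := fun j => if h : j < k + 1 then (e ⟨j, h⟩ : Q) else t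
  have hdm : ∀ j, j < k + 1 → d j ∉ F := fun j hj => by
    simp only [d, dif_pos hj]
    exact Finset.mem_compl.1 (hDF (e ⟨j, hj⟩).2)
  have hdt : d (k + 1) = t := by simp [d]
  have hd : ∀ i j, i ≤ k + 1 → j ≤ k + 1 → d i = d j → i = j := by
    have key : ∀ i, i < k + 1 → d i ≠ t := fun i hi e =>
      hdm i hi (by rw [e]; exact Finset.mem_insert_self _ _)
    intro i j hi hj hij
    rcases Nat.lt_or_ge i (k + 1) with hi' | hi' <;> rcases Nat.lt_or_ge j (k + 1) with hj' | hj'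
    · simp only [d, dif_pos hi', dif_pos hj'] at hij
      have := e.injective (Subtype.ext hij)
      simpa using this
    · obtain rfl : j = k + 1 := by omega
      exact absurd (hij.trans hdt) (key i hi')
    · obtain rfl : i = k + 1 := by omega
      exact absurd (hij.symm.trans hdt) (key j hj')
    · omega
  have hbd : ∀ i j, i < k + 1 → j ≤ k + 1 → b i ≠ d j := by
    intro i j hi hj hij
    rcases Nat.lt_or_ge j (k + 1) with hj' | hj'
    · refine hdm j hj' (hij ▸ ?_)
      exact Finset.mem_insert_of_mem (Finset.mem_image_of_mem _ (Finset.mem_range.2 hi))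
    · obtain rfl : j = k + 1 := by omega
      exact hb i hi (hij.trans hdt)
  obtain ⟨R, hR, eR⟩ := exists_circuit_ladder b d δ (k + 1) hd hbd
  obtain ⟨R', hR', eR'⟩ := exists_circuit_ladder b d δ k
    (fun i j hi hj => hd i j (by omega) (by omega))
    (fun i j hi hj => hbd i j (by omega) (by omega))
  refine ⟨R ++ R', by simp; omega, ?_⟩
  rw [Circuit.matrix_append, eR, eR', permOp_mul]
  congr 1
  funext y
  have hd' : ∀ i j, i ≤ k → j ≤ k → d i = d j → i = j :=
    fun i j hi hj => hd i j (by omega) (by omega)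
  have hne : ∀ j ≤ k, d (k + 1) ≠ d j := fun j hj e => by
    have := hd (k + 1) j le_rfl (by omega) e; omega
  have hst : ∀ j ≤ k, autoState b δ (ladderMap b d δ (k + 1) y) j = autoState b δ y j :=
    fun j hj => autoState_congr fun i hi =>
      ladderMap_off fun l hl => hbd i l (by omega) hl
  funext q
  simp only [Function.comp, xorMap]
  by_cases hq : q = t
  · subst hq
    rw [Function.update_self, ← hdt, ladderMap_off hne, ladderMap_on hd le_rfl]
  · rw [Function.update_of_ne hq]
    by_cases hq' : ∃ j ≤ k, q = d j
    · obtain ⟨j, hj, rfl⟩ := hq'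
      rw [ladderMap_on hd' hj, ladderMap_on hd (by omega), hst j hj]
      generalize y (d j) = p; generalize autoState b δ y j = s
      revert p s; decide
    · push Not at hq'
      rw [ladderMap_off hq', ladderMap_off]
      intro j hj
      rcases Nat.lt_or_ge j (k + 1) with hj' | hj'
      · exact hq' j (by omega)
      · obtain rfl : j = k + 1 := by omega
        rw [hdt]; exact hq

/-! ### Comparison with a constant -/

/-- The number with the binary digits `y`. -/
def bitsVal {n : ℕ} (y : Fin n → Fin 2) : ℕ := (finFunctionFinEquiv y : Fin (2 ^ n))

theorem bitsVal_lt {n : ℕ} (y : Fin n → Fin 2) : bitsVal y < 2 ^ n :=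
  (finFunctionFinEquiv y).2

theorem bitsVal_injective {n : ℕ} : Function.Injective (bitsVal (n := n)) := fun _ _ h =>
  finFunctionFinEquiv.injective (Fin.ext h)

theorem bitsVal_eq_sum {n : ℕ} (y : Fin n → Fin 2) :
    bitsVal y = ∑ i, (y i : ℕ) * 2 ^ (i : ℕ) := by
  rw [bitsVal, finFunctionFinEquiv_apply]

theorem sum_bits_lt (z : ℕ → Fin 2) (k : ℕ) :
    ∑ i ∈ Finset.range k, (z i : ℕ) * 2 ^ i < 2 ^ k := by
  induction k with
  | zero => simp
  | succ k ih =>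
    rw [Finset.sum_range_succ, pow_succ]
    have := (z k).2
    have : (z k : ℕ) * 2 ^ k ≤ 1 * 2 ^ k := Nat.mul_le_mul_right _ (by omega)
    omega

/-- Digit by digit comparison with the binary digits of the constant `c`. -/
def ltStep (c : ℕ) (j : ℕ) (x s : Fin 2) : Fin 2 :=
  if (x : ℕ) = c / 2 ^ j % 2 then s else if (x : ℕ) < c / 2 ^ j % 2 then 1 else 0

/-- Reading from the least significant digit, the automaton holds the comparison of the digits read
so far: the last digit decides, and the earlier ones break a tie. -/
theorem autoState_ltStep (b : ℕ → Q) (c : ℕ) (y : Q → Fin 2) (k : ℕ) :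
    autoState b (ltStep c) y k =
      if ∑ i ∈ Finset.range k, (y (b i) : ℕ) * 2 ^ i < c % 2 ^ k then 1 else 0 := by
  induction k with
  | zero => simp [autoState, Nat.mod_one]
  | succ k ih =>
    rw [autoState, ltStep, ih, Finset.sum_range_succ, Nat.mod_pow_succ]
    have h1 := sum_bits_lt (fun i => y (b i)) k
    have h2 := Nat.mod_lt c (show 0 < 2 ^ k by positivity)
    have h3 : c / 2 ^ k % 2 < 2 := Nat.mod_lt _ (by norm_num)
    generalize ∑ i ∈ Finset.range k, (y (b i) : ℕ) * 2 ^ i = P at *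
    generalize c % 2 ^ k = D at *
    generalize c / 2 ^ k % 2 = g at *
    have h4 := (y (b k)).2
    generalize (y (b k) : ℕ) = v at *
    generalize 2 ^ k = N at *
    obtain rfl | rfl : v = 0 ∨ v = 1 := by omega
    · obtain rfl | rfl : g = 0 ∨ g = 1 := by omega
      · simp
      · simp only [zero_mul, mul_one, add_zero]
        rw [if_neg (by norm_num), if_pos (by norm_num), if_pos (by omega)]
    · obtain rfl | rfl : g = 0 ∨ g = 1 := by omega
      · simp only [mul_zero, one_mul, add_zero]
        rw [if_neg (by norm_num), if_neg (by norm_num), if_neg (by omega)]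
      · simp

open Classical in
/-- The indicator of `p`, as a bit. -/
def bit (p : Prop) : Fin 2 := if p then 1 else 0

theorem bit_true {p : Prop} (h : p) : bit p = 1 := by simp [bit, h]
theorem bit_false {p : Prop} (h : ¬ p) : bit p = 0 := by simp [bit, h]

theorem exists_circuit_lt {n : ℕ} (e : Fin n → Q) (t : Q) (ht : ∀ i, e i ≠ t) (c : ℕ)
    (hcard : 2 * n + 1 ≤ Fintype.card Q) :
    ∃ C : Circuit Q, C.length ≤ 88 * n + 1 ∧
      C.matrix = permOp (xorMap t fun y => bit (bitsVal (y ∘ e) < c)) := by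
  rcases Nat.lt_or_ge c (2 ^ n) with hc | hc
  · let b : ℕ → Q := fun j => if h : j < n then e ⟨j, h⟩ else t
    obtain ⟨C, hC, eC⟩ := exists_circuit_automaton b (ltStep c) n t
      (fun j hj => by simp only [b, dif_pos hj]; exact ht _) hcard
    refine ⟨C, by omega, ?_⟩
    rw [eC]
    congr 2
    funext y
    rw [autoState_ltStep, Nat.mod_eq_of_lt hc, bitsVal_eq_sum, Finset.sum_range]
    simp [b, bit, Function.comp]
  · refine ⟨[.single t pauliX], by simp, ?_⟩
    rw [Circuit.matrix_singleton, Gate.matrix_pauliX]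
    congr 1
    funext y
    rw [xorMap, bit_true ((bitsVal_lt _).trans_le hc)]

end

/-! ### Implementation with clean ancillas -/

section

variable {A B R R' : Type} [Fintype A] [DecidableEq A] [Fintype B] [DecidableEq B]
  [Fintype R] [DecidableEq R] [Fintype R'] [DecidableEq R']

theorem sum_bits_elim {M : Type*} [AddCommMonoid M] (f : (A ⊕ B → Fin 2) → M) :
    ∑ w, f w = ∑ z : A → Fin 2, ∑ x : B → Fin 2, f (Sum.elim z x) := by
  rw [← Fintype.sum_prod_type']
  exact Fintype.sum_equiv (Equiv.sumArrowEquivProdArrow A B (Fin 2)) _ _ fun w => by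
    simp [Equiv.sumArrowEquivProdArrow]

theorem elim_eq_elim {z z' : A → Fin 2} {x x' : B → Fin 2} :
    (Sum.elim z x = Sum.elim z' x') ↔ z = z' ∧ x = x' := by
  constructor
  · intro h
    exact ⟨funext fun i => congrFun h (Sum.inl i), funext fun i => congrFun h (Sum.inr i)⟩
  · rintro ⟨rfl, rfl⟩; rfl

theorem elim_comp_eq (w : A ⊕ B → Fin 2) : Sum.elim (w ∘ Sum.inl) (w ∘ Sum.inr) = w :=
  Sum.elim_comp_inl_inr w

theorem emb_inr_elim (U : Op B) (z z' : A → Fin 2) (x y : B → Fin 2) :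
    emb Sum.inr U (Sum.elim z x) (Sum.elim z' y) = if z = z' then U x y else 0 := by
  by_cases h : z = z'
  · subst h
    rw [if_pos rfl, emb_apply_pos]
    · rfl
    · rintro (q | q) hq
      · rfl
      · exact absurd ⟨q, rfl⟩ hq
  · rw [if_neg h, emb_apply_neg]
    exact fun h' => h (funext fun i => h' (Sum.inl i) (by simp))

theorem emb_inl_elim (U : Op A) (z z' : A → Fin 2) (x y : B → Fin 2) :
    emb Sum.inl U (Sum.elim z x) (Sum.elim z' y) = if x = y then U z z' else 0 := by
  by_cases h : x = y
  · subst h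
    rw [if_pos rfl, emb_apply_pos]
    · rfl
    · rintro (q | q) hq
      · exact absurd ⟨q, rfl⟩ hq
      · rfl
  · rw [if_neg h, emb_apply_neg]
    exact fun h' => h (funext fun i => h' (Sum.inr i) (by simp))

theorem emb_surjective {ι : A → B} (hι : Function.Surjective ι) (U : Op A) (x y : B → Fin 2) :
    emb ι U x y = U (x ∘ ι) (y ∘ ι) := by
  rw [emb_apply_pos]
  intro q hq
  exact absurd (hι q) hq

theorem emb_permOp_xorMap (ι : A ↪ B) (t : A) (g : (A → Fin 2) → Fin 2) :
    emb ι (permOp (xorMap t g)) = permOp (xorMap (ι t) fun y => g (y ∘ ι)) := by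
  ext x y
  simp only [permOp, mono, Matrix.of_apply, Pi.one_apply]
  have hc : xorMap (ι t) (fun y => g (y ∘ ι)) y ∘ ι = xorMap t g (y ∘ ι) := by
    funext a
    by_cases ha : a = t
    · subst ha; simp [xorMap]
    · simp [xorMap, ha]
  by_cases h : ∀ r, r ∉ Set.range ι → x r = y r
  · rw [emb_apply_pos h, Matrix.of_apply]
    refine if_congr ⟨fun e => ?_, fun e => by rw [e, hc]⟩ rfl rfl
    refine ext_of_comp_of_off (ι := ι) (e.trans hc.symm) fun q hq => ?_
    rw [h q hq, xorMap, Function.update_of_ne]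
    rintro rfl
    exact hq ⟨t, rfl⟩
  · rw [emb_apply_neg h, if_neg]
    intro e
    refine h fun r hr => ?_
    rw [e, xorMap, Function.update_of_ne]
    rintro rfl
    exact hr ⟨t, rfl⟩

theorem mul_permOp_apply (M : Op A) (f : (A → Fin 2) → A → Fin 2) (x y : A → Fin 2) :
    (M * permOp f) x y = M x (f y) := by
  rw [Matrix.mul_apply, Finset.sum_eq_single (f y)]
  · simp [mono]
  · intro z _ hz; simp [mono, hz]
  · simp

theorem permOp_mul_apply {f g : (A → Fin 2) → A → Fin 2} (hgf : Function.LeftInverse g f)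
    (hfg : Function.RightInverse g f) (M : Op A) (x y : A → Fin 2) :
    (permOp f * M) x y = M (g x) y := by
  rw [Matrix.mul_apply, Finset.sum_eq_single (g x)]
  · simp [mono, hfg x]
  · intro z _ hz
    have : x ≠ f z := fun e => hz (by rw [e, hgf])
    simp [mono, this]
  · simp

/-- With the ancillas `Fin a` in the state zero, the circuit acts as `U` on the qubits `R`, and it
leaves the ancillas in the state zero. -/
def Implements {a : ℕ} (c : Circuit (Fin a ⊕ R)) (U : Op R) : Prop :=
  ∀ (z : Fin a → Fin 2) (x y : R → Fin 2),
    c.matrix (Sum.elim z x) (Sum.elim 0 y) = if z = 0 then U x y else 0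

/-- `U` can be implemented with `a` clean ancillas and at most `L` gates. -/
def Impl (a L : ℕ) (U : Op R) : Prop :=
  ∃ c : Circuit (Fin a ⊕ R), Implements c U ∧ c.length ≤ L

theorem Impl.le {a L L' : ℕ} {U : Op R} (h : Impl a L U) (hL : L ≤ L') : Impl a L' U := by
  obtain ⟨c, hc, hl⟩ := h
  exact ⟨c, hc, hl.trans hL⟩

theorem Impl.of_circuit {a : ℕ} {U : Op R} (c : Circuit (Fin a ⊕ R))
    (h : c.matrix = emb Sum.inr U) : Impl a c.length U :=
  ⟨c, fun z x y => by rw [h, emb_inr_elim], le_rfl⟩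

theorem Impl.gate (a : ℕ) (g : Gate R) : Impl a 1 g.matrix := by
  refine Impl.of_circuit [g.map Function.Embedding.inr] ?_
  rw [Circuit.matrix_singleton, Gate.matrix_map]; rfl

theorem Impl.one (a : ℕ) : Impl a 0 (1 : Op R) :=
  Impl.of_circuit [] (by rw [emb_one]; rfl)

theorem Impl.mul {a L L' : ℕ} {U V : Op R} (hU : Impl a L U) (hV : Impl a L' V) :
    Impl a (L + L') (U * V) := by
  obtain ⟨c, hc, hl⟩ := hU
  obtain ⟨d, hd, hl'⟩ := hV
  refine ⟨d ++ c, fun z x y => ?_, by simp; omega⟩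
  rw [Circuit.matrix_append, Matrix.mul_apply, sum_bits_elim, Finset.sum_eq_single 0]
  · simp only [hd _ _ y, if_pos, hc z x]
    split_ifs
    · rw [Matrix.mul_apply]
    · simp
  · intro w _ hw
    refine Finset.sum_eq_zero fun v _ => ?_
    rw [hd, if_neg hw, mul_zero]
  · simp

theorem Impl.pow {a L : ℕ} {U : Op R} (hU : Impl a L U) (k : ℕ) : Impl a (k * L) (U ^ k) := by
  induction k with
  | zero => simpa using Impl.one a
  | succ k ih => rw [pow_succ, Nat.succ_mul]; exact ih.mul hU

theorem Implements.unitary {a : ℕ} {c : Circuit (Fin a ⊕ R)} {U : Op R} (h : Implements c U) :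
    Uᴴ * U = 1 := by
  ext x y
  have := congrFun (congrFun c.conjTranspose_mul_self (Sum.elim 0 x)) (Sum.elim 0 y)
  rw [Matrix.mul_apply, sum_bits_elim, Finset.sum_eq_single 0] at this
  · simp only [Matrix.conjTranspose_apply, h _ _ x, h _ _ y, if_pos] at this
    rw [Matrix.mul_apply]
    simp only [Matrix.conjTranspose_apply]
    rw [this, Matrix.one_apply, Matrix.one_apply]
    simp [elim_eq_elim]
  · intro w _ hw
    refine Finset.sum_eq_zero fun v _ => ?_
    rw [h w v y, if_neg hw, mul_zero]
  · simp

theorem Impl.unitary {a L : ℕ} {U : Op R} (h : Impl a L U) : Uᴴ * U = 1 := by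
  obtain ⟨c, hc, -⟩ := h
  exact hc.unitary

theorem Impl.unitary' {a L : ℕ} {U : Op R} (h : Impl a L U) : U * Uᴴ = 1 :=
  mul_eq_one_comm.mp h.unitary

theorem Impl.inv {a L : ℕ} {U : Op R} (h : Impl a L U) : Impl a L Uᴴ := by
  obtain ⟨c, hc, hl⟩ := h
  refine ⟨c.inv, fun z x y => ?_, by simpa using hl⟩
  have hU' : U * Uᴴ = 1 := mul_eq_one_comm.mp hc.unitary
  -- `|0, y⟩` is the image under `c` of `|0⟩ ⊗ Uᴴ |y⟩`
  have key : c.inv.matrix (Sum.elim z x) (Sum.elim 0 y) =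
      ∑ v, (c.inv.matrix * c.matrix) (Sum.elim z x) (Sum.elim 0 v) * Uᴴ v y := by
    have : ∀ v, (c.inv.matrix * c.matrix) (Sum.elim z x) (Sum.elim 0 v) =
        ∑ w, c.inv.matrix (Sum.elim z x) (Sum.elim 0 w) * U w v := by
      intro v
      rw [Matrix.mul_apply, sum_bits_elim, Finset.sum_eq_single 0]
      · exact Finset.sum_congr rfl fun w _ => by rw [hc, if_pos rfl]
      · intro w _ hw
        refine Finset.sum_eq_zero fun u _ => ?_
        rw [hc, if_neg hw, mul_zero]
      · simp
    simp only [this, Finset.sum_mul]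
    rw [Finset.sum_comm]
    simp only [mul_assoc, ← Finset.mul_sum, ← Matrix.mul_apply, hU', Matrix.one_apply]
    simp
  rw [key, Circuit.matrix_inv, c.conjTranspose_mul_self]
  by_cases hz : z = 0
  · subst hz
    simp [Matrix.one_apply, elim_eq_elim]
  · simp [elim_eq_elim, hz]

theorem Impl.emb {a L : ℕ} {U : Op R} (h : Impl a L U) (ι : R ↪ R') : Impl a L (emb ι U) := by
  obtain ⟨c, hc, hl⟩ := h
  let κ : Fin a ⊕ R ↪ Fin a ⊕ R' := Function.Embedding.sumMap (Function.Embedding.refl _) ι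
  have hκ : ∀ (z : Fin a → Fin 2) (x : R' → Fin 2), Sum.elim z x ∘ κ = Sum.elim z (x ∘ ι) := by
    intro z x; funext q; rcases q with q | q <;> rfl
  refine ⟨c.map κ, fun z x y => ?_, by simpa using hl⟩
  rw [Circuit.matrix_map]
  by_cases hxy : ∀ q, q ∉ Set.range ι → x q = y q
  · rw [emb_apply_pos hxy, emb_apply_pos, hκ, hκ, hc]
    rintro (q | q) hq
    · exact absurd ⟨Sum.inl q, rfl⟩ hq
    · refine hxy q ?_
      rintro ⟨r, rfl⟩
      exact hq ⟨Sum.inr r, rfl⟩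
  · rw [emb_apply_neg hxy, emb_apply_neg, ite_self]
    intro h'
    refine hxy fun q hq => h' (Sum.inr q) ?_
    rintro ⟨r | r, hr⟩
    · exact Sum.inl_ne_inr hr
    · exact hq ⟨r, Sum.inr_injective hr⟩

/-- Further clean ancillas are left untouched. -/
theorem Impl.mono {a a' L : ℕ} {U : Op R} (h : Impl a L U) (ha : a ≤ a') : Impl a' L U := by
  obtain ⟨c, hc, hl⟩ := h
  let κ : Fin a ⊕ R ↪ Fin a' ⊕ R :=
    Function.Embedding.sumMap (Fin.castLEEmb ha) (Function.Embedding.refl _)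
  have hκ : ∀ (z : Fin a' → Fin 2) (x : R → Fin 2),
      Sum.elim z x ∘ κ = Sum.elim (z ∘ Fin.castLE ha) x := by
    intro z x; funext q; rcases q with q | q <;> rfl
  refine ⟨c.map κ, fun z x y => ?_, by simpa using hl⟩
  rw [Circuit.matrix_map]
  by_cases hz : ∀ q, q ∉ Set.range (Fin.castLE ha) → z q = 0
  · have hz0 : z ∘ Fin.castLE ha = 0 ↔ z = 0 := by
      refine ⟨fun h => ext_of_comp_of_off (ι := Fin.castLE ha) h hz, fun h => by rw [h]; rfl⟩
    rw [emb_apply_pos, hκ, hκ]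
    · have : ((0 : Fin a' → Fin 2) ∘ Fin.castLE ha) = 0 := rfl
      rw [this, hc]
      simp only [hz0]
    · rintro (q | q) hq
      · refine hz q ?_
        rintro ⟨r, rfl⟩
        exact hq ⟨Sum.inl r, rfl⟩
      · exact absurd ⟨Sum.inr q, rfl⟩ hq
  · rw [if_neg, emb_apply_neg]
    · intro h'
      refine hz fun q hq => h' (Sum.inl q) ?_
      rintro ⟨r | r, hr⟩
      · exact hq ⟨r, Sum.inl_injective hr⟩
      · exact Sum.inr_ne_inl hr
    · rintro rfl
      exact hz fun _ _ => rfl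

/-- Qubits that start and end in the state zero may be counted as clean ancillas. -/
theorem Impl.promote {a L b : ℕ} {V : Op (B ⊕ R)} {U : Op R} (h : Impl a L V)
    (hB : Fintype.card B = b)
    (hV : ∀ (f : B → Fin 2) (x y : R → Fin 2),
      V (Sum.elim f x) (Sum.elim 0 y) = if f = 0 then U x y else 0) : Impl (a + b) L U := by
  obtain ⟨c, hc, hl⟩ := h
  let e : Fin a ⊕ (B ⊕ R) ≃ Fin (a + b) ⊕ R :=
    (Equiv.sumAssoc _ _ _).symm.trans (Equiv.sumCongr
      ((Equiv.sumCongr (Equiv.refl _) (Fintype.equivFinOfCardEq hB)).trans finSumFinEquiv)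
      (Equiv.refl _))
  refine ⟨c.map e.toEmbedding, fun z x y => ?_, by simpa using hl⟩
  rw [Circuit.matrix_map, emb_surjective (ι := e.toEmbedding) e.surjective]
  let z₁ : Fin a → Fin 2 := fun i => z (finSumFinEquiv (Sum.inl i))
  let z₂ : B → Fin 2 := fun i => z (finSumFinEquiv (Sum.inr (Fintype.equivFinOfCardEq hB i)))
  have h1 : Sum.elim z x ∘ e.toEmbedding = Sum.elim z₁ (Sum.elim z₂ x) := by
    funext q; rcases q with q | q | q <;> rfl
  have h2 : Sum.elim (0 : Fin (a + b) → Fin 2) y ∘ e.toEmbedding =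
      Sum.elim (0 : Fin a → Fin 2) (Sum.elim (0 : B → Fin 2) y) := by
    funext q; rcases q with q | q | q <;> rfl
  rw [h1, h2, hc, hV]
  have hz : z = 0 ↔ z₁ = 0 ∧ z₂ = 0 := by
    constructor
    · rintro rfl; exact ⟨rfl, rfl⟩
    · rintro ⟨h1, h2⟩
      funext i
      obtain ⟨j | j, rfl⟩ := finSumFinEquiv.surjective i
      · exact congrFun h1 j
      · obtain ⟨k, rfl⟩ := (Fintype.equivFinOfCardEq hB).surjective j
        exact congrFun h2 k
  by_cases e1 : z₁ = 0 <;> by_cases e2 : z₂ = 0 <;> simp [hz, e1, e2]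

/-- Controlling an implemented operator by an additional qubit. -/
theorem Impl.controlled {a L : ℕ} {U : Op R} (h : Impl a L U) :
    Impl a (20 * L) (cond (fun y : Unit ⊕ R → Fin 2 => y (Sum.inl ()) = 1)
      (SchroPDE.emb Sum.inr U) 1) := by
  obtain ⟨c, hc, hl⟩ := h
  obtain ⟨C, hC, eC⟩ := c.exists_controlled
  let e : Unit ⊕ (Fin a ⊕ R) ≃ Fin a ⊕ (Unit ⊕ R) :=
    (Equiv.sumAssoc _ _ _).symm.trans
      ((Equiv.sumCongr (Equiv.sumComm _ _) (Equiv.refl _)).trans (Equiv.sumAssoc _ _ _))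
  refine ⟨C.map e.toEmbedding, fun z x y => ?_, by simp; omega⟩
  have he : ∀ (z : Fin a → Fin 2) (f : Unit → Fin 2) (x : R → Fin 2),
      Sum.elim z (Sum.elim f x) ∘ e.toEmbedding = Sum.elim f (Sum.elim z x) := by
    intro z f x; funext q; rcases q with q | q | q <;> rfl
  rw [Circuit.matrix_map, emb_surjective (ι := e.toEmbedding) e.surjective, eC]
  rw [← elim_comp_eq x, ← elim_comp_eq y]
  generalize x ∘ Sum.inl = f; generalize x ∘ Sum.inr = x
  generalize y ∘ Sum.inl = g; generalize y ∘ Sum.inr = y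
  change cond _ _ 1 (Sum.elim z (Sum.elim f x) ∘ e.toEmbedding)
    (Sum.elim 0 (Sum.elim g y) ∘ e.toEmbedding) = _
  rw [he, he]
  by_cases hg : g () = 1
  · rw [cond_apply_pos (by simpa using hg), cond_apply_pos (by simpa using hg), emb_inr_elim,
      emb_inr_elim, hc]
    by_cases hz : z = 0 <;> by_cases hf : f = g <;> simp [hz, hf]
  · rw [cond_apply_neg (by simpa using hg), cond_apply_neg (by simpa using hg),
      Matrix.one_apply, Matrix.one_apply]
    simp only [elim_eq_elim]
    by_cases hz : z = 0 <;> by_cases hf : f = g <;> simp [hz, hf]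

/-- The indicator of the classical predicate `p` can be added to a further qubit. -/
def Recog (a L : ℕ) (p : (R → Fin 2) → Prop) : Prop :=
  Impl a L (permOp (xorMap (Sum.inl () : Unit ⊕ R) fun y => bit (p (y ∘ Sum.inr))))

theorem recog_lt {n : ℕ} (a : ℕ) (e : Fin n → R) (c : ℕ)
    (hcard : 2 * n ≤ a + Fintype.card R) :
    Recog a (88 * n + 1) fun y : R → Fin 2 => bitsVal (y ∘ e) < c := by
  obtain ⟨C, hC, eC⟩ := exists_circuit_lt (Q := Fin a ⊕ (Unit ⊕ R))
    (fun i => Sum.inr (Sum.inr (e i))) (Sum.inr (Sum.inl ())) (by simp) c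
    (by simp only [Fintype.card_sum, Fintype.card_fin, Fintype.card_unit]; omega)
  refine (Impl.of_circuit C ?_).le hC
  rw [eC]
  exact (emb_permOp_xorMap (Function.Embedding.inr (α := Fin a) (β := Unit ⊕ R)) (Sum.inl ())
    fun y => bit (bitsVal ((y ∘ Sum.inr) ∘ e) < c)).symm

theorem Recog.xor {a L L' : ℕ} {p q : (R → Fin 2) → Prop} (hp : Recog a L p)
    (hq : Recog a L' q) : Recog a (L + L') fun y => ¬ (p y ↔ q y) := by
  have := Impl.mul hp hq
  rw [permOp_mul, xorMap_comp] at this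
  · refine cast ?_ this
    unfold Recog
    congr 3
    funext y
    by_cases h1 : p (y ∘ Sum.inr) <;> by_cases h2 : q (y ∘ Sum.inr) <;> simp [bit, h1, h2]
  · intro y b
    congr 2

theorem recog_interval {n : ℕ} (a : ℕ) (e : Fin n → R) {c c' : ℕ} (hcc : c ≤ c')
    (hcard : 2 * n ≤ a + Fintype.card R) :
    Recog a (176 * n + 2) fun y : R → Fin 2 => c ≤ bitsVal (y ∘ e) ∧ bitsVal (y ∘ e) < c' := by
  have := (recog_lt a e c hcard).xor (recog_lt a e c' hcard)
  have h2 : (fun y : R → Fin 2 => ¬ (bitsVal (y ∘ e) < c ↔ bitsVal (y ∘ e) < c')) =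
      fun y : R → Fin 2 => c ≤ bitsVal (y ∘ e) ∧ bitsVal (y ∘ e) < c' := by
    funext y
    apply propext
    omega
  rw [h2] at this
  exact Impl.le this (by omega)

theorem recog_eq {n : ℕ} (a : ℕ) (e : Fin n → R) (v : Fin n → Fin 2)
    (hcard : 2 * n ≤ a + Fintype.card R) :
    Recog a (176 * n + 2) fun y : R → Fin 2 => y ∘ e = v := by
  have := recog_interval a e (Nat.le_succ (bitsVal v)) hcard
  have h2 : (fun y : R → Fin 2 => bitsVal v ≤ bitsVal (y ∘ e) ∧
      bitsVal (y ∘ e) < Nat.succ (bitsVal v)) = fun y : R → Fin 2 => y ∘ e = v := by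
    funext y
    apply propext
    constructor
    · intro h; exact bitsVal_injective (by omega)
    · intro h; rw [h]; omega
  rwa [h2] at this

/-- An operator can be applied conditionally: the condition is computed into a clean ancilla,
which controls the operator, and is uncomputed. -/
theorem Impl.cond {a L T : ℕ} {U : Op R} {p : (R → Fin 2) → Prop} (h : Impl a L U)
    (hp : Recog a T p) (hk : Keeps p U) : Impl (a + 1) (2 * T + 20 * L) (cond p U 1) := by
  have h3 := (Impl.mul hp h.controlled).mul hp
  refine Impl.le (Impl.promote h3 (by simp) fun f x y => ?_) (by omega)
  set m := xorMap (Sum.inl () : Unit ⊕ R) fun y => bit (p (y ∘ Sum.inr)) with hm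
  have hinv : Function.Involutive m := by
    intro y
    have := congrFun (xorMap_comp (Sum.inl () : Unit ⊕ R) (fun y => bit (p (y ∘ Sum.inr)))
      (fun y => bit (p (y ∘ Sum.inr))) fun y b => by congr 2) y
    rw [← hm] at this
    rw [Function.comp] at this
    rw [this]
    have h2 : ∀ b : Fin 2, b + b = 0 := by decide
    simp [xorMap, h2]
  have hme : ∀ (f : Unit → Fin 2) (x : R → Fin 2),
      m (Sum.elim f x) = Sum.elim (fun _ => f () + bit (p x)) x := by
    intro f x
    funext q
    rcases q with q | q
    · simp [hm, xorMap]
    · simp [hm, xorMap]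
  rw [mul_permOp_apply, permOp_mul_apply hinv.leftInverse hinv.rightInverse, hme, hme]
  have hun : ∀ f g : Unit → Fin 2, f = g ↔ f () = g () := fun f g =>
    ⟨fun h => by rw [h], fun h => funext fun _ => h⟩
  by_cases hpy : p y
  · rw [cond_apply_pos (by simp [bit_true hpy]), emb_inr_elim, cond_apply_pos hpy]
    by_cases hU : U x y = 0
    · simp [hU]
    · have hpx : p x := (hk x y hU).symm ▸ hpy
      simp [hun, bit_true hpx, bit_true hpy]
  · rw [cond_apply_neg (by simp [bit_false hpy]), cond_apply_neg hpy, Matrix.one_apply,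
      Matrix.one_apply]
    by_cases hxy : x = y
    · subst hxy
      simp [elim_eq_elim, hun]
    · simp [elim_eq_elim, hxy]

/-! ### Multiplexed operators -/

/-- The operator that applies `U g` to the basis states selecting `g`, and nothing to the basis
states selecting no index. -/
def mux {ι : Type} (sel : (R → Fin 2) → Option ι) (U : ι → Op R) : Op R :=
  Matrix.of fun x y => match sel y with
    | some g => U g x y
    | none => (1 : Op R) x y

theorem mux_apply_some {ι : Type} {sel : (R → Fin 2) → Option ι} {U : ι → Op R}
    {x y : R → Fin 2} {g : ι} (h : sel y = some g) : mux sel U x y = U g x y := by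
  simp [mux, h]

theorem mux_apply_none {ι : Type} {sel : (R → Fin 2) → Option ι} {U : ι → Op R}
    {x y : R → Fin 2} (h : sel y = none) : mux sel U x y = (1 : Op R) x y := by
  simp [mux, h]

theorem Keeps.mux {ι α : Type} {sel : (R → Fin 2) → Option ι} {U : ι → Op R}
    {φ : (R → Fin 2) → α} (hU : ∀ g, Keeps φ (U g)) : Keeps φ (mux sel U) := by
  intro x y h
  rcases hs : sel y with _ | g
  · rw [mux_apply_none hs] at h; exact Keeps.one φ x y h
  · rw [mux_apply_some hs] at h; exact hU g x y h

theorem mux_conjTranspose {ι : Type} {sel : (R → Fin 2) → Option ι} {U : ι → Op R}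
    (hk : ∀ g, Keeps sel (U g)) (hU : ∀ g, (U g)ᴴ = U g) : (mux sel U)ᴴ = mux sel U := by
  ext x y
  by_cases hxy : sel x = sel y
  · rw [Matrix.conjTranspose_apply]
    rcases hs : sel y with _ | g
    · rw [mux_apply_none hs, mux_apply_none (hxy.trans hs), ← Matrix.conjTranspose_apply,
        Matrix.conjTranspose_one]
    · rw [mux_apply_some hs, mux_apply_some (hxy.trans hs), ← Matrix.conjTranspose_apply, hU]
  · have h1 : mux sel U x y = 0 := by
      by_contra h; exact hxy (Keeps.mux hk x y h)
    have h2 : mux sel U y x = 0 := by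
      by_contra h; exact hxy (Keeps.mux hk y x h).symm
    rw [Matrix.conjTranspose_apply, h1, h2, star_zero]

/-- The branches are applied one after another, each under the condition that it is selected. The
gate count is additive, and one ancilla holds the condition, because every branch preserves the
selector. -/
theorem Impl.mux {ι : Type} [Fintype ι] {a : ℕ} {T L : ι → ℕ} {sel : (R → Fin 2) → Option ι}
    {U : ι → Op R} (hU : ∀ g, Impl a (L g) (U g)) (hk : ∀ g, Keeps sel (U g))
    (hs : ∀ g, Recog a (T g) fun y => sel y = some g) :
    Impl (a + 1) (∑ g, (2 * T g + 20 * L g)) (mux sel U) := by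
  classical
  have key : ∀ S : Finset ι, Impl (a + 1) (∑ g ∈ S, (2 * T g + 20 * L g))
      (SchroPDE.mux sel fun g => if g ∈ S then U g else 1) := by
    intro S
    induction S using Finset.induction_on with
    | empty =>
      refine cast ?_ (Impl.one (R := R) (a + 1))
      congr 1
      ext x y
      rcases hs : sel y with _ | g
      · rw [mux_apply_none hs]
      · rw [mux_apply_some hs]; simp
    | insert g S hg ih =>
      rw [Finset.sum_insert hg]
      have hc := ((hU g).cond (hs g) ((hk g).comp fun o => o = some g)).mul ih
      refine cast ?_ hc
      congr 1
      have hkS : ∀ h, Keeps sel (if h ∈ S then U h else 1) := fun h => by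
        split_ifs
        · exact hk h
        · exact Keeps.one _
      have e : (SchroPDE.mux sel fun h => if h ∈ S then U h else 1) =
          SchroPDE.cond (fun y => sel y = some g) 1
            (SchroPDE.mux sel fun h => if h ∈ S then U h else 1) := by
        ext x y
        by_cases h : sel y = some g
        · rw [cond_apply_pos h, mux_apply_some h, if_neg hg]
        · rw [cond_apply_neg h]
      rw [e, cond_mul _ _ (Keeps.one _) ((Keeps.mux hkS).comp fun o => o = some g),
        Matrix.mul_one, Matrix.one_mul]
      ext x y
      by_cases h : sel y = some g
      · rw [cond_apply_pos h, mux_apply_some h, if_pos (Finset.mem_insert_self _ _)]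
      · rw [cond_apply_neg h]
        rcases hs : sel y with _ | k
        · rw [mux_apply_none hs, mux_apply_none hs]
        · rw [mux_apply_some hs, mux_apply_some hs]
          have : k ≠ g := fun e => h (by rw [hs, e])
          simp [Finset.mem_insert, this]
  simpa using key Finset.univ

end

/-! ### State preparation -/

section

variable {R : Type} [Fintype R] [DecidableEq R]

theorem exists_unitary_column {p q : ℝ} (hp : 0 ≤ p) (hq : 0 ≤ q) :
    ∃ u : Matrix.unitaryGroup (Fin 2) ℂ,
      (u : Matrix (Fin 2) (Fin 2) ℂ) 0 0 * (Real.sqrt (p + q) : ℂ) = (Real.sqrt p : ℂ) ∧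
      (u : Matrix (Fin 2) (Fin 2) ℂ) 1 0 * (Real.sqrt (p + q) : ℂ) = (Real.sqrt q : ℂ) := by
  by_cases h : p + q = 0
  · obtain rfl : p = 0 := by linarith
    obtain rfl : q = 0 := by linarith
    exact ⟨1, by simp, by simp⟩
  · have hpos : 0 < p + q := lt_of_le_of_ne (by positivity) (Ne.symm h)
    refine ⟨completeU (Real.sqrt (p / (p + q)) : ℂ) (Real.sqrt (q / (p + q)) : ℂ) ?_, ?_, ?_⟩
    · rw [Complex.norm_real, Complex.norm_real, Real.norm_of_nonneg (Real.sqrt_nonneg _),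
        Real.norm_of_nonneg (Real.sqrt_nonneg _), Real.sq_sqrt (by positivity),
        Real.sq_sqrt (by positivity), ← add_div, div_self h]
    · simp only [completeU, Matrix.of_apply, Matrix.cons_val_zero, Matrix.cons_val']
      rw [← Complex.ofReal_mul, ← Real.sqrt_mul (by positivity), div_mul_cancel₀ _ h]
    · simp only [completeU, Matrix.of_apply, Matrix.cons_val_zero, Matrix.cons_val_one,
        Matrix.cons_val']
      rw [← Complex.ofReal_mul, ← Real.sqrt_mul (by positivity), div_mul_cancel₀ _ h]

theorem sum_bits_succ {M : Type*} [AddCommMonoid M] {r : ℕ} (f : (Fin (r + 1) → Fin 2) → M) :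
    ∑ b, f b = ∑ x : Fin r → Fin 2, (f (Fin.cons 0 x) + f (Fin.cons 1 x)) := by
  rw [← (Fin.consEquiv fun _ : Fin (r + 1) => Fin 2).sum_comp, Fintype.sum_prod_type,
    Fin.sum_univ_two, ← Finset.sum_add_distrib]
  rfl

/-- Any state of `r` qubits with nonnegative amplitudes can be prepared, qubit by qubit, by
one-qubit gates that are multiplexed over the qubits treated before. -/
theorem exists_impl_prep {a r : ℕ} (e : Fin r → R) (he : Function.Injective e)
    (w : (Fin r → Fin 2) → ℝ) (hw : ∀ b, 0 ≤ w b) (hsum : ∑ b, w b = 1)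
    (hcard : 2 * r ≤ a + Fintype.card R) :
    ∃ W : Op R, Impl (a + 1) (400 * (r + 1) * 2 ^ r) W ∧
      (∀ x y : R → Fin 2, y ∘ e = 0 → (∀ q, q ∉ Set.range e → x q = y q) →
        W x y = (Real.sqrt (w (x ∘ e)) : ℂ)) ∧
      (∀ {α : Type} (φ : (R → Fin 2) → α),
        (∀ x y : R → Fin 2, (∀ q, q ∉ Set.range e → x q = y q) → φ x = φ y) → Keeps φ W) := by
  induction r with
  | zero =>
    refine ⟨1, (Impl.one _).le (Nat.zero_le _), fun x y _ hxy => ?_, fun φ _ => Keeps.one φ⟩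
    have hxy' : x = y := funext fun q => hxy q (by rintro ⟨i, -⟩; exact i.elim0)
    rw [hxy', Matrix.one_apply_eq]
    have : w (y ∘ e) = 1 := by
      rw [← hsum, Fintype.sum_unique]
      congr 1; exact Subsingleton.elim _ _
    rw [this]; simp
  | succ r ih =>
    obtain ⟨W', hW', hval, hkeep⟩ := ih (e ∘ Fin.succ) (he.comp (Fin.succ_injective r))
      (fun x => w (Fin.cons 0 x) + w (Fin.cons 1 x))
      (fun x => add_nonneg (hw _) (hw _)) (by rw [← sum_bits_succ, hsum]) (by omega)
    choose u hu0 hu1 using fun x : Fin r → Fin 2 =>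
      exists_unitary_column (hw (Fin.cons 0 x)) (hw (Fin.cons 1 x))
    let sel : (R → Fin 2) → Option (Fin r → Fin 2) := fun y => some (y ∘ e ∘ Fin.succ)
    have hsel : ∀ x y : R → Fin 2, (∀ q, q ≠ e 0 → x q = y q) → sel x = sel y := by
      intro x y h
      simp only [sel, Option.some.injEq]
      funext i
      exact h _ fun h' => absurd (he h') (Fin.succ_ne_zero i)
    have hM := Impl.mux (a := a) (sel := sel) (L := fun _ => 1) (T := fun _ => 176 * r + 2)
      (U := fun x => (Gate.single (e 0) (u x)).matrix)
      (fun x => Impl.gate a _) (fun x => Gate.keeps_single _ _ hsel) (fun x => by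
        have := recog_eq a (e ∘ Fin.succ) x (by omega)
        simpa [sel] using this)
    refine ⟨_, (hM.mul hW').le ?_, ?_, ?_⟩
    · simp only [Finset.sum_const, Finset.card_univ, Fintype.card_pi, Fintype.card_fin,
        Finset.prod_const, smul_eq_mul, pow_succ]
      have : 1 ≤ 2 ^ r := Nat.one_le_two_pow
      nlinarith
    · intro x y hy hxy
      have hr0 : ∀ q, q ∉ Set.range (e ∘ Fin.succ) → q ≠ e 0 → q ∉ Set.range e := by
        rintro q h1 h2 ⟨i, rfl⟩
        obtain rfl | ⟨j, rfl⟩ := Fin.eq_zero_or_eq_succ i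
        · exact h2 rfl
        · exact h1 ⟨j, rfl⟩
      have hy0 : y (e 0) = 0 := congrFun hy 0
      let z := Function.update x (e 0) 0
      have hze : z ∘ (e ∘ Fin.succ) = x ∘ (e ∘ Fin.succ) := by
        funext i
        simp only [z, Function.comp]
        rw [Function.update_of_ne fun h' => absurd (he h') (Fin.succ_ne_zero i)]
      rw [Matrix.mul_apply, Finset.sum_eq_single z]
      · rw [hval z y, hze, mux_apply_some (g := x ∘ e ∘ Fin.succ) (by simp only [sel, hze]),
          Gate.matrix_single_apply_self fun q hq => by simp [z, hq]]
        · have hz0 : z (e 0) = 0 := by simp [z]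
          rw [hz0]
          have hx : ∀ b, x (e 0) = b → x ∘ e = Fin.cons b (x ∘ e ∘ Fin.succ) := by
            intro b hb; funext i
            refine Fin.cases ?_ (fun i => ?_) i
            · exact hb
            · rfl
          rcases fin2_cases (x (e 0)) with h | h
          · rw [h, hu0, hx _ h]
          · rw [h, hu1, hx _ h]
        · funext i; exact congrFun hy i.succ
        · intro q hq
          by_cases hq0 : q = e 0
          · subst hq0; simp [z, hy0]
          · simp only [z, Function.update_of_ne hq0]
            exact hxy q (hr0 q hq hq0)
      · intro v _ hv
        by_contra hne
        have h1 : v (e 0) = y (e 0) := by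
          refine hkeep (fun x => x (e 0)) (fun x y h => h _ ?_) _ _ (right_ne_zero_of_mul hne)
          rintro ⟨i, hi⟩
          exact absurd (he hi) (Fin.succ_ne_zero i)
        have h2 : (fun q : {q // q ≠ e 0} => x q) = fun q : {q // q ≠ e 0} => v q :=
          Keeps.mux (φ := fun x : R → Fin 2 => fun q : {q // q ≠ e 0} => x q)
            (fun g => Gate.keeps_single _ _ fun x y h => funext fun q => h q q.2) _ _
            (left_ne_zero_of_mul hne)
        refine hv (funext fun q => ?_)
        by_cases hq : q = e 0
        · subst hq; simp [z, h1, hy0]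
        · simp only [z, Function.update_of_ne hq]
          exact (congrFun h2 ⟨q, hq⟩).symm
      · simp
    · intro α φ hφ
      refine (Keeps.mux fun g => Gate.keeps_single _ _ fun x y h => hφ x y fun q hq => h q ?_).mul
        (hkeep φ fun x y h => hφ x y fun q hq => h q ?_)
      · rintro rfl; exact hq ⟨0, rfl⟩
      · rintro ⟨i, rfl⟩; exact hq ⟨i.succ, rfl⟩

/-! ### Linear combinations of unitaries -/

/-- A convex combination of the operators `U t` is the block of a product of a state preparation,
a multiplexed application of the `U t`, and the inverse state preparation. -/
theorem exists_impl_lcu {T : Type} [Fintype T] {a r : ℕ} (enc : T ↪ (Fin r → Fin 2))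
    (w : T → ℝ) (hw : ∀ t, 0 ≤ w t) (hsum : ∑ t, w t = 1) {L : T → ℕ} {U : T → Op R}
    (hU : ∀ t, Impl a (L t) (U t)) (hcard : r ≤ a + Fintype.card R) :
    ∃ V : Op (Fin r ⊕ R),
      Impl (a + 1) (800 * (r + 1) * 2 ^ r + ∑ t, (2 * (176 * r + 2) + 20 * L t)) V ∧
      (∀ x y : R → Fin 2, V (Sum.elim 0 x) (Sum.elim 0 y) = ∑ t, (w t : ℂ) * U t x y) ∧
      ((∀ t, (U t)ᴴ = U t) → Vᴴ = V) ∧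
      (∀ {α : Type} (φ : (R → Fin 2) → α), (∀ t, Keeps φ (U t)) →
        Keeps (fun y => φ (y ∘ Sum.inr)) V) := by
  classical
  let w' : (Fin r → Fin 2) → ℝ := fun b => ∑ t, if enc t = b then w t else 0
  have hw' : ∀ b, 0 ≤ w' b := fun b => Finset.sum_nonneg fun t _ => by
    split_ifs
    · exact hw t
    · exact le_rfl
  have hcard' : 2 * r ≤ a + Fintype.card (Fin r ⊕ R) := by
    rw [Fintype.card_sum, Fintype.card_fin]; omega
  obtain ⟨W, hW, hval, hkeep⟩ := exists_impl_prep (Sum.inl : Fin r → Fin r ⊕ R)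
    Sum.inl_injective w' hw' (by
      simp only [w']; rw [Finset.sum_comm]; simpa using hsum) hcard'
  let sel : (Fin r ⊕ R → Fin 2) → Option T := fun y =>
    if h : ∃ t, enc t = y ∘ Sum.inl then some h.choose else none
  have hsel : ∀ y t, sel y = some t ↔ y ∘ Sum.inl = enc t := by
    intro y t
    simp only [sel]
    split_ifs with h
    · rw [Option.some.injEq]
      constructor
      · rintro rfl; exact h.choose_spec.symm
      · intro h'; exact enc.injective (h.choose_spec.trans h')
    · constructor
      · intro h'; cases h'
      · intro h'; exact absurd ⟨t, h'.symm⟩ h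
  have hU' : ∀ t, Impl a (L t) (emb (Sum.inr : R → Fin r ⊕ R) (U t)) := fun t =>
    (hU t).emb Function.Embedding.inr
  have hks : ∀ t, Keeps sel (emb (Sum.inr : R → Fin r ⊕ R) (U t)) := fun t =>
    Keeps.emb_off _ fun x y h => by
      have : x ∘ Sum.inl = y ∘ Sum.inl := funext fun i => h _ (by simp)
      simp only [sel, this]
  have hM := Impl.mux hU' hks (T := fun _ => 176 * r + 2) (fun t => by
    have := recog_eq a (Sum.inl : Fin r → Fin r ⊕ R) (enc t) hcard'
    simpa only [hsel] using this)
  set M := mux sel fun t => emb (Sum.inr : R → Fin r ⊕ R) (U t) with hMdef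
  have hWv : ∀ (j : Fin r → Fin 2) (x y : R → Fin 2), W (Sum.elim j x) (Sum.elim 0 y) =
      if x = y then (Real.sqrt (w' j) : ℂ) else 0 := by
    intro j x y
    split_ifs with h
    · subst h
      rw [hval _ _ (by rfl)]
      · rfl
      · rintro (q | q) hq
        · exact absurd ⟨q, rfl⟩ hq
        · rfl
    · by_contra hne
      refine h ?_
      have := hkeep (fun y => y ∘ Sum.inr) (fun x y h => funext fun i => h _ (by simp)) _ _ hne
      simpa using this
  refine ⟨Wᴴ * (M * W), (hW.inv.mul (hM.mul hW)).le (by ring_nf; omega), ?_, ?_, ?_⟩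
  · intro x y
    have h1 : ∀ (j : Fin r → Fin 2) (x' : R → Fin 2), (M * W) (Sum.elim j x') (Sum.elim 0 y) =
        (Real.sqrt (w' j) : ℂ) * M (Sum.elim j x') (Sum.elim j y) := by
      intro j x'
      rw [Matrix.mul_apply, sum_bits_elim, Finset.sum_eq_single j]
      · simp only [hWv]
        simp [mul_comm]
      · intro j' _ hj'
        refine Finset.sum_eq_zero fun v _ => ?_
        have : M (Sum.elim j x') (Sum.elim j' v) = 0 := by
          by_contra hne
          have := Keeps.mux (φ := fun y : Fin r ⊕ R → Fin 2 => y ∘ Sum.inl) (fun t =>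
            Keeps.emb_off _ fun x y h => funext fun i => h _ (by simp)) _ _ hne
          exact hj' (by simpa using this.symm)
        rw [this, zero_mul]
      · simp
    rw [Matrix.mul_apply, sum_bits_elim]
    simp only [Matrix.conjTranspose_apply, hWv, h1]
    have h2 : ∀ j : Fin r → Fin 2, (w' j : ℂ) * M (Sum.elim j x) (Sum.elim j y) =
        ∑ t, if enc t = j then (w t : ℂ) * U t x y else 0 := by
      intro j
      by_cases hj : ∃ t, enc t = j
      · obtain ⟨t, rfl⟩ := hj
        have : M (Sum.elim (enc t) x) (Sum.elim (enc t) y) = U t x y := by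
          rw [hMdef, mux_apply_some ((hsel _ t).2 (by simp)), emb_inr_elim, if_pos rfl]
        rw [this]
        simp [w', enc.injective.eq_iff]
      · push Not at hj
        simp [w', hj]
    have h3 : ∀ j : Fin r → Fin 2,
        (∑ v, star (if v = x then (Real.sqrt (w' j) : ℂ) else 0) *
          ((Real.sqrt (w' j) : ℂ) * M (Sum.elim j v) (Sum.elim j y))) =
        ∑ t, if enc t = j then (w t : ℂ) * U t x y else 0 := by
      intro j
      rw [← h2, Finset.sum_eq_single x]
      · rw [if_pos rfl, ← mul_assoc]
        congr 1
        have : star (Real.sqrt (w' j) : ℂ) = (Real.sqrt (w' j) : ℂ) := Complex.conj_ofReal _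
        rw [this, ← Complex.ofReal_mul, Real.mul_self_sqrt (hw' j)]
      · intro v _ hv; simp [hv]
      · simp
    simp only [h3]
    rw [Finset.sum_comm]
    simp
  · intro hH
    have hMH : Mᴴ = M := mux_conjTranspose hks fun t => by rw [← emb_conjTranspose, hH]
    rw [Matrix.conjTranspose_mul, Matrix.conjTranspose_mul, Matrix.conjTranspose_conjTranspose,
      hMH, Matrix.mul_assoc]
  · intro α φ hφ
    have hWk : Keeps (fun y : Fin r ⊕ R → Fin 2 => φ (y ∘ Sum.inr)) W :=
      hkeep _ fun x y h => congrArg φ (funext fun i => h _ (by simp))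
    exact hWk.conjTranspose.mul ((Keeps.mux fun t => Keeps.emb (hφ t)).mul hWk)

end

/-! ### The Fejér–Riesz factorization -/

section

open Polynomial

theorem infinite_unit_circle : {z : ℂ | ‖z‖ = 1}.Infinite := by
  have h : Function.Injective fun t : Set.Icc (0 : ℝ) 1 =>
      ((t : ℝ) : ℂ) + (Real.sqrt (1 - (t : ℝ) ^ 2) : ℂ) * Complex.I := by
    intro s t h
    have := congrArg Complex.re h
    simp at this
    exact Subtype.ext this
  have hinf : Infinite (Set.Icc (0 : ℝ) 1) := (Set.Icc_infinite one_pos).to_subtype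
  refine Set.infinite_of_injective_forall_mem h fun t => ?_
  have ht : 0 ≤ 1 - (t : ℝ) ^ 2 := by nlinarith [t.2.1, t.2.2]
  rw [Set.mem_ofPred_eq, Complex.norm_add_mul_I, Real.sq_sqrt ht]
  simp

theorem poly_eq_of_circle {p q : ℂ[X]} (h : ∀ z : ℂ, ‖z‖ = 1 → p.eval z = q.eval z) : p = q :=
  Polynomial.eq_of_infinite_eval_eq p q (infinite_unit_circle.mono fun z hz => h z hz)

/-- The reversed polynomial with conjugate coefficients: `z ^ D` times the conjugate of `p z` on
the unit circle. -/
def conjReflect (D : ℕ) (p : ℂ[X]) : ℂ[X] := (p.map (starRingEnd ℂ)).reflect D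

theorem eval_conjReflect_inv {D : ℕ} {p : ℂ[X]} (hp : p.natDegree ≤ D) {r : ℂ} (hr : r ≠ 0) :
    (conjReflect D p).eval (star r)⁻¹ * star r ^ D = star (p.eval r) := by
  have hr' : star r ≠ 0 := star_ne_zero.2 hr
  let _ := invertibleOfNonzero hr'
  have := Polynomial.eval₂_reflect_mul_pow (RingHom.id ℂ) (star r) D (p.map (starRingEnd ℂ))
    (natDegree_map_le.trans hp)
  rw [invOf_eq_inv] at this
  rw [conjReflect, eval, this]
  change eval (starRingEnd ℂ r) (p.map (starRingEnd ℂ)) = starRingEnd ℂ (p.eval r)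
  rw [eval_map, eval₂_at_apply]

theorem star_eq_inv_of_norm {z : ℂ} (hz : ‖z‖ = 1) : star z = z⁻¹ := by
  rw [Complex.inv_def, Complex.normSq_eq_norm_sq, hz]; simp

theorem eval_conjReflect {D : ℕ} {p : ℂ[X]} (hp : p.natDegree ≤ D) {z : ℂ} (hz : ‖z‖ = 1) :
    (conjReflect D p).eval z = z ^ D * star (p.eval z) := by
  have h0 : z ≠ 0 := fun h => by rw [h] at hz; simp at hz
  have := eval_conjReflect_inv hp h0
  rw [star_eq_inv_of_norm hz, inv_inv] at this
  rw [← this, inv_pow]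
  field_simp

theorem coeff_conjReflect (D k : ℕ) (p : ℂ[X]) (hk : k ≤ D) :
    (conjReflect D p).coeff k = star (p.coeff (D - k)) := by
  rw [conjReflect, coeff_reflect, revAt_le hk, coeff_map]; rfl

theorem natDegree_conjReflect_le {D : ℕ} {p : ℂ[X]} (hp : p.natDegree ≤ D) :
    (conjReflect D p).natDegree ≤ D :=
  (natDegree_reflect_le.trans (max_le le_rfl (natDegree_map_le.trans hp)))

/-- The **Fejér–Riesz theorem** for strictly positive trigonometric polynomials: the roots come in
pairs `r`, `1 / r̄` off the unit circle, of which one is kept. -/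
theorem fejer_riesz (D : ℕ) (G : ℂ[X]) (hdeg : G.natDegree ≤ 2 * D)
    (hpos : ∀ z : ℂ, ‖z‖ = 1 → ∃ t : ℝ, 0 < t ∧ G.eval z = t * z ^ D) :
    ∃ E : ℂ[X], E.natDegree ≤ D ∧
      ∀ z : ℂ, ‖z‖ = 1 → G.eval z = ((‖E.eval z‖ ^ 2 : ℝ) : ℂ) * z ^ D := by
  induction D generalizing G with
  | zero =>
    obtain ⟨c, rfl⟩ : ∃ c, G = C c := ⟨_, eq_C_of_natDegree_eq_zero (by omega)⟩
    obtain ⟨t, ht, hc⟩ := hpos 1 (by simp)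
    refine ⟨C (Real.sqrt t : ℂ), by simp, fun z _ => ?_⟩
    simp only [eval_C, pow_zero, mul_one] at hc ⊢
    rw [hc, Complex.norm_real, Real.norm_of_nonneg (Real.sqrt_nonneg _), Real.sq_sqrt ht.le]
  | succ D ih =>
    have hself : conjReflect (2 * (D + 1)) G = G := by
      refine poly_eq_of_circle fun z hz => ?_
      obtain ⟨t, -, ht⟩ := hpos z hz
      have h0 : z ≠ 0 := fun h => by rw [h] at hz; simp at hz
      rw [eval_conjReflect hdeg hz, ht, star_mul, star_pow, star_eq_inv_of_norm hz]
      have : star (t : ℂ) = t := Complex.conj_ofReal _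
      rw [this, inv_pow, show 2 * (D + 1) = (D + 1) + (D + 1) by ring, pow_add]
      field_simp
    have hz0 : ∀ z : ℂ, ‖z‖ = 1 → z ≠ 0 := fun z hz h => by rw [h] at hz; simp at hz
    by_cases h0 : G.coeff 0 = 0
    · obtain ⟨G', rfl⟩ := X_dvd_iff.2 h0
      have htop : (X * G').coeff (2 * (D + 1)) = 0 := by
        rw [← hself, coeff_conjReflect _ _ _ le_rfl, Nat.sub_self, h0, star_zero]
      have hdeg' : G'.natDegree ≤ 2 * D := by
        rw [natDegree_le_iff_coeff_eq_zero] at hdeg ⊢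
        intro N hN
        rcases Nat.lt_or_ge (2 * D + 1) N with h | h
        · have := hdeg (N + 1) (by omega)
          rwa [coeff_X_mul] at this
        · obtain rfl : N = 2 * D + 1 := by omega
          rw [show 2 * (D + 1) = 2 * D + 1 + 1 by ring, coeff_X_mul] at htop
          exact htop
      obtain ⟨E, hE, hEz⟩ := ih G' hdeg' fun z hz => by
        obtain ⟨t, ht, e⟩ := hpos z hz
        refine ⟨t, ht, mul_left_cancel₀ (hz0 z hz) ?_⟩
        rw [eval_mul, eval_X] at e
        rw [e]; ring
      refine ⟨E, by omega, fun z hz => ?_⟩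
      rw [eval_mul, eval_X, hEz z hz]; ring
    · have hG0 : G ≠ 0 := by rintro rfl; simp at h0
      have htop : G.coeff (2 * (D + 1)) ≠ 0 := by
        rw [← hself, coeff_conjReflect _ _ _ le_rfl, Nat.sub_self]
        exact star_ne_zero.2 h0
      have hGdeg : G.degree ≠ 0 := by
        intro h
        have := le_natDegree_of_ne_zero htop
        have h' := natDegree_eq_zero_iff_degree_le_zero.2 h.le
        omega
      obtain ⟨r, hr⟩ := IsAlgClosed.exists_root G hGdeg
      have hr0 : r ≠ 0 := by
        rintro rfl
        rw [IsRoot, ← coeff_zero_eq_eval_zero] at hr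
        exact h0 hr
      have hrn : ‖r‖ ≠ 1 := fun h => by
        obtain ⟨t, ht, e⟩ := hpos r h
        rw [IsRoot.def.1 hr] at e
        have : (t : ℂ) ≠ 0 := by exact_mod_cast ht.ne'
        exact mul_ne_zero this (pow_ne_zero _ hr0) e.symm
      have hsr : star r ≠ 0 := star_ne_zero.2 hr0
      have hr' : G.eval (star r)⁻¹ = 0 := by
        have := eval_conjReflect_inv hdeg hr0
        rw [hself, IsRoot.def.1 hr, star_zero] at this
        exact (mul_eq_zero.1 this).resolve_right (pow_ne_zero _ hsr)
      have hne : (star r)⁻¹ - r ≠ 0 := by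
        intro h
        have h1 : (1 : ℂ) = r * star r := by
          have h' := mul_inv_cancel₀ hsr
          rw [sub_eq_zero.1 h, mul_comm] at h'
          exact h'.symm
        have h2 : ((1 : ℝ) : ℂ) = ((‖r‖ ^ 2 : ℝ) : ℂ) := by
          rw [← Complex.normSq_eq_norm_sq, ← Complex.mul_conj]; simpa using h1
        have h3 : (1 : ℝ) = ‖r‖ ^ 2 := by exact_mod_cast h2
        exact hrn (by nlinarith [norm_nonneg r])
      obtain ⟨G₁, rfl⟩ := dvd_iff_isRoot.2 hr
      have hr₁ : G₁.IsRoot (star r)⁻¹ := by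
        rw [eval_mul, eval_sub, eval_X, eval_C] at hr'
        exact (mul_eq_zero.1 hr').resolve_left hne
      obtain ⟨G₂, rfl⟩ := dvd_iff_isRoot.2 hr₁
      have hG₂ : G₂ ≠ 0 := by rintro rfl; simp at hG0
      have hzr : ∀ z : ℂ, ‖z‖ = 1 → (z - r) * (z - (star r)⁻¹) =
          z * ((‖z - r‖ ^ 2 : ℝ) : ℂ) * (-(star r)⁻¹) := by
        intro z hz
        rw [← Complex.normSq_eq_norm_sq, ← Complex.mul_conj]
        have h1 : (starRingEnd ℂ) (z - r) = z⁻¹ - star r := by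
          rw [map_sub]
          change star z - star r = _
          rw [star_eq_inv_of_norm hz]
        rw [h1]
        have := hz0 z hz
        field_simp
        ring
      have hd2 : (C (-(star r)⁻¹) * G₂).natDegree ≤ 2 * D := by
        have h1 := natDegree_mul (X_sub_C_ne_zero r) (mul_ne_zero (X_sub_C_ne_zero (star r)⁻¹) hG₂)
        rw [natDegree_mul (X_sub_C_ne_zero (star r)⁻¹) hG₂, natDegree_X_sub_C,
          natDegree_X_sub_C] at h1
        refine (natDegree_C_mul_le _ _).trans ?_
        omega
      obtain ⟨E, hE, hEz⟩ := ih (C (-(star r)⁻¹) * G₂) hd2 fun z hz => by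
        obtain ⟨t, ht, e⟩ := hpos z hz
        have hzr0 : z - r ≠ 0 := fun h => hrn (by rw [← sub_eq_zero.1 h, hz])
        have hn : 0 < ‖z - r‖ ^ 2 := by positivity
        refine ⟨t / ‖z - r‖ ^ 2, by positivity, ?_⟩
        rw [eval_mul, eval_mul, ← mul_assoc, eval_sub, eval_sub, eval_X, eval_C, eval_C,
          hzr z hz] at e
        rw [eval_mul, eval_C]
        have hnc : ((‖z - r‖ ^ 2 : ℝ) : ℂ) ≠ 0 := by exact_mod_cast hn.ne'
        rw [Complex.ofReal_div, div_mul_eq_mul_div, eq_div_iff hnc]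
        refine mul_left_cancel₀ (hz0 z hz) ?_
        rw [pow_succ z D] at e
        linear_combination e
      refine ⟨(X - C r) * E, ?_, fun z hz => ?_⟩
      · refine natDegree_mul_le.trans ?_
        rw [natDegree_X_sub_C]; omega
      · have := hEz z hz
        rw [eval_mul, eval_C] at this
        rw [eval_mul, eval_mul, ← mul_assoc, eval_mul, eval_sub, eval_sub, eval_X, eval_C, eval_C,
          hzr z hz, norm_mul, mul_pow, Complex.ofReal_mul, pow_succ z D]
        linear_combination z * ((‖z - r‖ ^ 2 : ℝ) : ℂ) * this

/-- The Fejér–Riesz factorization of `1 - |F| ^ 2` completes `F` to a unit column. -/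
theorem exists_complement {D : ℕ} {F : ℂ[X]} (hF : F.natDegree ≤ D)
    (hb : ∀ z : ℂ, ‖z‖ = 1 → ‖F.eval z‖ ≤ 1 / 2) :
    ∃ E : ℂ[X], E.natDegree ≤ D ∧ ∀ z : ℂ, ‖z‖ = 1 → ‖F.eval z‖ ^ 2 + ‖E.eval z‖ ^ 2 = 1 := by
  have hz0 : ∀ z : ℂ, ‖z‖ = 1 → z ≠ 0 := fun z hz h => by rw [h] at hz; simp at hz
  have key : ∀ z : ℂ, ‖z‖ = 1 → (X ^ D - F * conjReflect D F).eval z =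
      ((1 - ‖F.eval z‖ ^ 2 : ℝ) : ℂ) * z ^ D := by
    intro z hz
    rw [eval_sub, eval_pow, eval_X, eval_mul, eval_conjReflect hF hz, Complex.ofReal_sub,
      ← Complex.normSq_eq_norm_sq, ← Complex.mul_conj]
    change _ = (_ - _ * star (F.eval z)) * _
    push_cast
    ring
  obtain ⟨E, hE, hEz⟩ := fejer_riesz D (X ^ D - F * conjReflect D F) (by
      refine (natDegree_sub_le _ _).trans (max_le ?_ ?_)
      · rw [natDegree_X_pow]; omega
      · refine natDegree_mul_le.trans ?_
        have := natDegree_conjReflect_le hF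
        omega) fun z hz => by
    refine ⟨1 - ‖F.eval z‖ ^ 2, ?_, key z hz⟩
    nlinarith [hb z hz, norm_nonneg (F.eval z)]
  refine ⟨E, hE, fun z hz => ?_⟩
  have := mul_right_cancel₀ (pow_ne_zero D (hz0 z hz)) ((key z hz).symm.trans (hEz z hz))
  have h2 : 1 - ‖F.eval z‖ ^ 2 = ‖E.eval z‖ ^ 2 := by exact_mod_cast this
  linarith

/-! ### Quantum signal processing -/

/-- If the leading and constant coefficients of a column satisfy the stated orthogonality, one
rotation annihilates both the leading coefficient of one entry and the constant coefficient of the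
other. -/
theorem exists_common_perp (a₀ a₁ b₀ b₁ : ℂ) (h : a₀ * star b₀ + a₁ * star b₁ = 0) :
    ∃ c₀ c₁ : ℂ, ‖c₀‖ ^ 2 + ‖c₁‖ ^ 2 = 1 ∧ star c₀ * a₀ + star c₁ * a₁ = 0 ∧
      c₀ * b₁ - c₁ * b₀ = 0 := by
  have key : ∀ p q : ℂ, (p ≠ 0 ∨ q ≠ 0) → ∃ s : ℝ, s ≠ 0 ∧
      ‖p / (s : ℂ)‖ ^ 2 + ‖q / (s : ℂ)‖ ^ 2 = 1 := by
    intro p q hpq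
    have hpos : 0 < ‖p‖ ^ 2 + ‖q‖ ^ 2 := by
      rcases hpq with h | h
      · have := norm_pos_iff.2 h; positivity
      · have := norm_pos_iff.2 h; positivity
    refine ⟨Real.sqrt (‖p‖ ^ 2 + ‖q‖ ^ 2), (Real.sqrt_pos.2 hpos).ne', ?_⟩
    rw [norm_div, norm_div, div_pow, div_pow, Complex.norm_real, Real.norm_eq_abs, sq_abs,
      Real.sq_sqrt hpos.le, ← add_div, div_self hpos.ne']
  by_cases hb : b₀ ≠ 0 ∨ b₁ ≠ 0
  · obtain ⟨s, hs, hn⟩ := key b₀ b₁ hb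
    have hsc : (s : ℂ) ≠ 0 := by exact_mod_cast hs
    have hss : star (s : ℂ) = s := Complex.conj_ofReal _
    refine ⟨b₀ / s, b₁ / s, hn, ?_, by field_simp; ring⟩
    rw [star_div₀, star_div₀, hss]
    field_simp
    linear_combination h
  · push Not at hb
    obtain ⟨rfl, rfl⟩ := hb
    by_cases ha : a₀ ≠ 0 ∨ a₁ ≠ 0
    · obtain ⟨s, hs, hn⟩ := key a₁ a₀ ha.symm
      have hsc : (s : ℂ) ≠ 0 := by exact_mod_cast hs
      have hss : star (s : ℂ) = s := Complex.conj_ofReal _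
      refine ⟨star a₁ / s, -(star a₀ / s), ?_, ?_, by simp⟩
      · rw [norm_neg, norm_div, norm_div, norm_star, norm_star, ← norm_div, ← norm_div, hn]
      · rw [star_neg, star_div₀, star_div₀, star_star, star_star, hss]
        field_simp
        ring
    · push Not at ha
      obtain ⟨rfl, rfl⟩ := ha
      exact ⟨1, 0, by simp, by simp, by simp⟩

theorem norm_sq_rotate (c₀ c₁ p q : ℂ) (hc : ‖c₀‖ ^ 2 + ‖c₁‖ ^ 2 = 1) :
    ‖star c₀ * p + star c₁ * q‖ ^ 2 + ‖c₀ * q - c₁ * p‖ ^ 2 = ‖p‖ ^ 2 + ‖q‖ ^ 2 := by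
  simp only [← Complex.normSq_eq_norm_sq, Complex.normSq_apply] at hc ⊢
  simp only [Complex.star_def, Complex.add_re, Complex.add_im, Complex.mul_re, Complex.mul_im,
    Complex.conj_re, Complex.conj_im, Complex.sub_re, Complex.sub_im]
  linear_combination (p.re * p.re + p.im * p.im + q.re * q.re + q.im * q.im) * hc

/-- One step of the factorization of a unit column of polynomials into rotations. -/
theorem exists_qsp_step {D : ℕ} {F E : ℂ[X]} (hF : F.natDegree ≤ D + 1) (hE : E.natDegree ≤ D + 1)
    (h : ∀ z : ℂ, ‖z‖ = 1 → ‖F.eval z‖ ^ 2 + ‖E.eval z‖ ^ 2 = 1) :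
    ∃ (u : Matrix.unitaryGroup (Fin 2) ℂ) (F' E' : ℂ[X]), F'.natDegree ≤ D ∧ E'.natDegree ≤ D ∧
      (∀ z : ℂ, ‖z‖ = 1 → ‖F'.eval z‖ ^ 2 + ‖E'.eval z‖ ^ 2 = 1) ∧
      F = C ((u : Matrix (Fin 2) (Fin 2) ℂ) 0 0) * F' +
        C ((u : Matrix (Fin 2) (Fin 2) ℂ) 0 1) * (X * E') ∧
      E = C ((u : Matrix (Fin 2) (Fin 2) ℂ) 1 0) * F' +
        C ((u : Matrix (Fin 2) (Fin 2) ℂ) 1 1) * (X * E') := by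
  have hz0 : ∀ z : ℂ, ‖z‖ = 1 → z ≠ 0 := fun z hz h => by rw [h] at hz; simp at hz
  -- the leading coefficient of `|F|² + |E|²` vanishes
  have hid : F * conjReflect (D + 1) F + E * conjReflect (D + 1) E = X ^ (D + 1) := by
    refine poly_eq_of_circle fun z hz => ?_
    have h1 : F.eval z * star (F.eval z) + E.eval z * star (E.eval z) = 1 := by
      have := h z hz
      rw [← Complex.normSq_eq_norm_sq, ← Complex.normSq_eq_norm_sq] at this
      have e : ((Complex.normSq (F.eval z) : ℝ) : ℂ) + (Complex.normSq (E.eval z) : ℝ) = 1 := by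
        exact_mod_cast this
      rw [← Complex.mul_conj, ← Complex.mul_conj] at e
      exact e
    rw [eval_add, eval_mul, eval_mul, eval_conjReflect hF hz, eval_conjReflect hE hz, eval_pow,
      eval_X]
    linear_combination z ^ (D + 1) * h1
  have htop : F.coeff (D + 1) * star (F.coeff 0) + E.coeff (D + 1) * star (E.coeff 0) = 0 := by
    have := congrArg (fun p => p.coeff ((D + 1) + (D + 1))) hid
    simp only [coeff_add] at this
    rw [coeff_mul_add_eq_of_natDegree_le hF (natDegree_conjReflect_le hF),
      coeff_mul_add_eq_of_natDegree_le hE (natDegree_conjReflect_le hE),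
      coeff_conjReflect _ _ _ le_rfl, coeff_conjReflect _ _ _ le_rfl, Nat.sub_self,
      coeff_X_pow, if_neg (by omega)] at this
    exact this
  obtain ⟨c₀, c₁, hc, h1, h2⟩ := exists_common_perp _ _ _ _ htop
  have hX : (C c₀ * E - C c₁ * F).coeff 0 = 0 := by simpa using h2
  obtain ⟨E', hE'⟩ := X_dvd_iff.2 hX
  have hcc : star c₀ * c₀ + star c₁ * c₁ = 1 := by
    have e : ((‖c₀‖ ^ 2 : ℝ) : ℂ) + ((‖c₁‖ ^ 2 : ℝ) : ℂ) = 1 := by exact_mod_cast hc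
    rw [← Complex.normSq_eq_norm_sq, ← Complex.normSq_eq_norm_sq, ← Complex.mul_conj,
      ← Complex.mul_conj] at e
    rw [mul_comm, mul_comm (star c₁)]
    exact e
  have hCC : C (star c₀) * C c₀ + C (star c₁) * C c₁ = (1 : ℂ[X]) := by
    rw [← C_mul, ← C_mul, ← C_add, hcc, C_1]
  refine ⟨completeU c₀ c₁ hc, C (star c₀) * F + C (star c₁) * E, E', ?_, ?_, ?_, ?_, ?_⟩
  · rw [natDegree_le_iff_coeff_eq_zero]
    intro N hN
    rcases Nat.lt_or_ge (D + 1) N with hN' | hN'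
    · rw [coeff_add, coeff_C_mul, coeff_C_mul, coeff_eq_zero_of_natDegree_lt (by omega),
        coeff_eq_zero_of_natDegree_lt (by omega)]
      simp
    · obtain rfl : N = D + 1 := by omega
      rw [coeff_add, coeff_C_mul, coeff_C_mul, h1]
  · rw [natDegree_le_iff_coeff_eq_zero]
    intro N hN
    rw [← coeff_X_mul, ← hE', coeff_sub, coeff_C_mul, coeff_C_mul,
      coeff_eq_zero_of_natDegree_lt (by omega), coeff_eq_zero_of_natDegree_lt (by omega)]
    simp
  · intro z hz
    rw [← h z hz, ← norm_sq_rotate c₀ c₁ (F.eval z) (E.eval z) hc]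
    have e : (X * E').eval z = (C c₀ * E - C c₁ * F).eval z := by rw [hE']
    rw [eval_mul, eval_X, eval_sub, eval_mul, eval_mul, eval_C, eval_C] at e
    rw [← e, norm_mul, hz, one_mul, eval_add, eval_mul, eval_mul, eval_C, eval_C]
  · simp only [completeU, Matrix.of_apply, Matrix.cons_val_zero, Matrix.cons_val_one,
      Matrix.cons_val']
    rw [← hE', C_neg]
    linear_combination (-F) * hCC
  · simp only [completeU, Matrix.of_apply, Matrix.cons_val_zero, Matrix.cons_val_one,
      Matrix.cons_val']
    rw [← hE']
    linear_combination (-E) * hCC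

end

section

open Polynomial

variable {R : Type} [Fintype R] [DecidableEq R]

theorem sum_unit_bits {M : Type*} [AddCommMonoid M] (f : (Unit → Fin 2) → M) :
    ∑ g, f g = f 0 + f 1 := by
  rw [← (Equiv.funUnique Unit (Fin 2)).symm.sum_comp, Fin.sum_univ_two]
  rfl

theorem single_inl_mul_apply (u : Matrix.unitaryGroup (Fin 2) ℂ) (M : Op (Unit ⊕ R))
    (f : Unit → Fin 2) (x : R → Fin 2) (y : Unit ⊕ R → Fin 2) :
    ((Gate.single (Sum.inl () : Unit ⊕ R) u).matrix * M) (Sum.elim f x) y =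
      (u : Matrix (Fin 2) (Fin 2) ℂ) (f ()) 0 * M (Sum.elim 0 x) y +
      (u : Matrix (Fin 2) (Fin 2) ℂ) (f ()) 1 * M (Sum.elim 1 x) y := by
  have h : ∀ (g : Unit → Fin 2) (v : R → Fin 2),
      (Gate.single (Sum.inl () : Unit ⊕ R) u).matrix (Sum.elim f x) (Sum.elim g v) =
      if x = v then (u : Matrix (Fin 2) (Fin 2) ℂ) (f ()) (g ()) else 0 := by
    intro g v
    simp only [Gate.matrix, Matrix.of_apply]
    refine if_congr ⟨fun h => funext fun q => h (Sum.inr q) (by simp), ?_⟩ rfl rfl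
    rintro rfl (q | q) hq
    · exact absurd rfl hq
    · rfl
  rw [Matrix.mul_apply, sum_bits_elim, sum_unit_bits]
  simp [h]

theorem unit_zero_ne_one : (0 : Unit → Fin 2) ≠ 1 := fun h =>
  absurd (congrFun h ()) (by decide)

theorem controlled_mul_apply_zero (W : Op R) (M : Op (Unit ⊕ R)) (x : R → Fin 2)
    (y : Unit ⊕ R → Fin 2) :
    (cond (fun y : Unit ⊕ R → Fin 2 => y (Sum.inl ()) = 1) (emb Sum.inr W) 1 * M)
      (Sum.elim 0 x) y = M (Sum.elim 0 x) y := by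
  rw [Matrix.mul_apply, sum_bits_elim, sum_unit_bits]
  simp [cond, emb_inr_elim, Matrix.one_apply, elim_eq_elim, unit_zero_ne_one]

theorem controlled_mul_apply_one (W : Op R) (M : Op (Unit ⊕ R)) (x : R → Fin 2)
    (y : Unit ⊕ R → Fin 2) :
    (cond (fun y : Unit ⊕ R → Fin 2 => y (Sum.inl ()) = 1) (emb Sum.inr W) 1 * M)
      (Sum.elim 1 x) y = ∑ v, W x v * M (Sum.elim 1 v) y := by
  rw [Matrix.mul_apply, sum_bits_elim, sum_unit_bits]
  simp [cond, emb_inr_elim, Matrix.one_apply, elim_eq_elim,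
    unit_zero_ne_one.symm]

/-- Quantum signal processing: a unit column of polynomials in a unitary `W` is implemented by
alternating one-qubit rotations and controlled applications of `W`. -/
theorem exists_impl_gqsp {a L : ℕ} {W : Op R} (hW : Impl a L W) (D : ℕ) (F E : ℂ[X])
    (hF : F.natDegree ≤ D) (hE : E.natDegree ≤ D)
    (h : ∀ z : ℂ, ‖z‖ = 1 → ‖F.eval z‖ ^ 2 + ‖E.eval z‖ ^ 2 = 1) :
    ∃ V : Op (Unit ⊕ R), Impl a (D * (20 * L + 1) + 1) V ∧
      (∀ x y, V (Sum.elim 0 x) (Sum.elim 0 y) = aeval W F x y) ∧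
      (∀ x y, V (Sum.elim 1 x) (Sum.elim 0 y) = aeval W E x y) ∧
      (∀ {α : Type} (φ : (R → Fin 2) → α), Keeps φ W → Keeps (fun y => φ (y ∘ Sum.inr)) V) := by
  have hk : ∀ (u : Matrix.unitaryGroup (Fin 2) ℂ) {α : Type} (φ : (R → Fin 2) → α),
      Keeps (fun y => φ (y ∘ Sum.inr)) (Gate.single (Sum.inl () : Unit ⊕ R) u).matrix :=
    fun u α φ => Gate.keeps_single _ _ fun x y h =>
      congrArg φ (funext fun i => h _ (by simp))
  have hC : ∀ (c : ℂ) (P : ℂ[X]) (x y : R → Fin 2),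
      aeval W (C c * P) x y = c * aeval W P x y := by
    intro c P x y
    rw [← smul_eq_C_mul, map_smul]; rfl
  induction D generalizing F E with
  | zero =>
    obtain ⟨c, rfl⟩ : ∃ c, F = C c := ⟨_, eq_C_of_natDegree_eq_zero (by omega)⟩
    obtain ⟨d, rfl⟩ : ∃ c, E = C c := ⟨_, eq_C_of_natDegree_eq_zero (by omega)⟩
    have hcd : ‖c‖ ^ 2 + ‖d‖ ^ 2 = 1 := by simpa using h 1 (by simp)
    have hg : ∀ f : Unit → Fin 2, ∀ x y : R → Fin 2,
        (Gate.single (Sum.inl () : Unit ⊕ R) (completeU c d hcd)).matrix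
          (Sum.elim f x) (Sum.elim 0 y) =
        (completeU c d hcd : Matrix (Fin 2) (Fin 2) ℂ) (f ()) 0 * (1 : Op R) x y := by
      intro f x y
      have := single_inl_mul_apply (completeU c d hcd) 1 f x (Sum.elim 0 y)
      rw [Matrix.mul_one] at this
      rw [this]
      simp [Matrix.one_apply, elim_eq_elim, unit_zero_ne_one.symm]
    refine ⟨_, (Impl.gate a (.single (Sum.inl () : Unit ⊕ R) (completeU c d hcd))).le (by omega), ?_, ?_,
      fun φ _ => hk _ φ⟩
    · intro x y
      rw [hg, aeval_C, Algebra.algebraMap_eq_smul_one]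
      simp [completeU]
    · intro x y
      rw [hg, aeval_C, Algebra.algebraMap_eq_smul_one]
      simp [completeU]
  | succ D ih =>
    obtain ⟨u, F', E', hF', hE', h', eF, eE⟩ := exists_qsp_step hF hE h
    obtain ⟨V, hV, h0, h1, hkV⟩ := ih F' E' hF' hE' h'
    have h1' : ∀ x y, ∑ v, W x v * V (Sum.elim 1 v) (Sum.elim 0 y) = aeval W (X * E') x y := by
      intro x y
      rw [map_mul, aeval_X, Matrix.mul_apply]
      exact Finset.sum_congr rfl fun v _ => by rw [h1]
    refine ⟨_, ((Impl.gate a (.single (Sum.inl () : Unit ⊕ R) u)).mul (hW.controlled.mul hV)).le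
      (by ring_nf; omega), ?_, ?_, ?_⟩
    · intro x y
      rw [single_inl_mul_apply, controlled_mul_apply_zero, controlled_mul_apply_one, h0, h1', eF]
      rw [map_add, Matrix.add_apply, hC, hC]
      rfl
    · intro x y
      rw [single_inl_mul_apply, controlled_mul_apply_zero, controlled_mul_apply_one, h0, h1', eE]
      rw [map_add, Matrix.add_apply, hC, hC]
      rfl
    · intro α φ hφ
      exact (hk u φ).mul ((Keeps.cond (Keeps.emb hφ) (Keeps.one _) _).mul (hkV φ hφ))

/-- The polynomial `z ^ Q * p ((z + z⁻¹) / 2)`. -/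
def joukowski (Q : ℕ) (p : ℂ[X]) : ℂ[X] :=
  ∑ k ∈ Finset.range (Q + 1), C (p.coeff k * (1 / 2) ^ k) * (X ^ (Q - k) * (X ^ 2 + 1) ^ k)

theorem natDegree_joukowski_le (Q : ℕ) (p : ℂ[X]) : (joukowski Q p).natDegree ≤ 2 * Q := by
  refine natDegree_sum_le_of_forall_le _ _ fun k hk => ?_
  have hk' := Finset.mem_range.1 hk
  refine (natDegree_C_mul_le _ _).trans (natDegree_mul_le.trans ?_)
  have h1 : (X ^ 2 + 1 : ℂ[X]).natDegree ≤ 2 := by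
    refine (natDegree_add_le _ _).trans ?_
    rw [natDegree_X_pow, natDegree_one]; norm_num
  have h2 := natDegree_pow_le_of_le k h1
  rw [natDegree_X_pow]
  omega

/-- For a unitary `W`, the polynomial `p` of the Hermitian part of `W` is, up to the factor `W ^
Q`, a polynomial of `W`. -/
theorem aeval_joukowski {A : Type*} [Ring A] [Algebra ℂ A] {W W' : A} (h : W * W' = 1)
    (h' : W' * W = 1) {Q : ℕ} {p : ℂ[X]} (hp : p.natDegree ≤ Q) :
    aeval W (joukowski Q p) = W ^ Q * aeval ((1 / 2 : ℂ) • (W + W')) p := by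
  rw [aeval_eq_sum_range' (p := p) (n := Q + 1) (by omega), joukowski, map_sum, Finset.mul_sum]
  refine Finset.sum_congr rfl fun k hk => ?_
  have hk' := Finset.mem_range.1 hk
  have hc : Commute W (W + W') := (Commute.refl W).add_right (h.trans h'.symm)
  have e : W ^ 2 + 1 = W * (W + W') := by rw [mul_add, h, sq]
  rw [← smul_eq_C_mul, map_smul, map_mul, map_pow, map_pow, map_add, map_pow, map_one, aeval_X, e,
    hc.mul_pow, ← mul_assoc (W ^ (Q - k)), ← pow_add, Nat.sub_add_cancel (by omega),
    _root_.smul_pow, smul_smul, mul_smul_comm]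

variable {m : ℕ}

/-- The reflection about the zero state of the first register, `2 |0⟩⟨0| - 1`. -/
def zeroReflection (m : ℕ) (R : Type) [Fintype R] [DecidableEq R] : Op (Fin m ⊕ R) :=
  Matrix.diagonal fun y => if y ∘ Sum.inl = 0 then 1 else -1

theorem zeroReflection_conjTranspose : (zeroReflection m R)ᴴ = zeroReflection m R := by
  rw [zeroReflection, Matrix.diagonal_conjTranspose]
  congr 1
  funext y
  rw [Pi.star_apply]
  split_ifs <;> simp

theorem impl_zeroReflection (a m : ℕ) (q : R) (hcard : m ≤ a + Fintype.card R) :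
    Impl (a + 1) (352 * m + 25) (zeroReflection m R) := by
  have hneg : (Gate.single (Sum.inr q : Fin m ⊕ R) (diagU (-1) (-1))).matrix =
      Matrix.diagonal fun _ => -1 := by
    rw [Gate.matrix_single_diagU]; simp
  have h1 := (Impl.gate a (Gate.single (Sum.inr q : Fin m ⊕ R) (diagU (-1) (-1)))).cond
    (recog_eq a (Sum.inl : Fin m → Fin m ⊕ R) 0
      (by rw [Fintype.card_sum, Fintype.card_fin]; omega))
    (by rw [hneg]; exact Keeps.diagonal _ _)
  have h2 := (Impl.gate (a + 1) (Gate.single (Sum.inr q : Fin m ⊕ R) (diagU (-1) (-1)))).mul h1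
  refine cast ?_ (h2.le (L' := 352 * m + 25) (by omega))
  congr 1
  rw [hneg]
  ext x y
  rw [Matrix.diagonal_mul, zeroReflection]
  by_cases hxy : x = y
  · subst hxy
    by_cases hx : x ∘ Sum.inl = 0
    · rw [cond_apply_pos (p := fun y : Fin m ⊕ R → Fin 2 => y ∘ Sum.inl = 0) hx]; simp [hx]
    · rw [cond_apply_neg (p := fun y : Fin m ⊕ R → Fin 2 => y ∘ Sum.inl = 0) hx]; simp [hx]
  · by_cases hx : y ∘ Sum.inl = 0
    · rw [cond_apply_pos (p := fun y : Fin m ⊕ R → Fin 2 => y ∘ Sum.inl = 0) hx]; simp [hxy]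
    · rw [cond_apply_neg (p := fun y : Fin m ⊕ R → Fin 2 => y ∘ Sum.inl = 0) hx]; simp [hxy]

/-- `M` preserves the zero state of the first register, and acts there as `N`. -/
def RestrictsTo (M : Op (Fin m ⊕ R)) (N : Op R) : Prop :=
  ∀ (z : Fin m → Fin 2) (x y : R → Fin 2),
    M (Sum.elim z x) (Sum.elim 0 y) = if z = 0 then N x y else 0

theorem RestrictsTo.mul {M M' : Op (Fin m ⊕ R)} {N N' : Op R} (h : RestrictsTo M N)
    (h' : RestrictsTo M' N') : RestrictsTo (M * M') (N * N') := by
  intro z x y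
  rw [Matrix.mul_apply, sum_bits_elim, Finset.sum_eq_single 0]
  · simp only [h' _ _ y, if_pos, h z x]
    split_ifs
    · rw [Matrix.mul_apply]
    · simp
  · intro w _ hw
    exact Finset.sum_eq_zero fun v _ => by rw [h', if_neg hw, mul_zero]
  · simp

theorem RestrictsTo.one : RestrictsTo (1 : Op (Fin m ⊕ R)) 1 := by
  intro z x y
  simp only [Matrix.one_apply, elim_eq_elim]
  by_cases hz : z = 0 <;> simp [hz]

theorem RestrictsTo.pow {M : Op (Fin m ⊕ R)} {N : Op R} (h : RestrictsTo M N) (k : ℕ) :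
    RestrictsTo (M ^ k) (N ^ k) := by
  induction k with
  | zero => simpa using RestrictsTo.one
  | succ k ih => rw [pow_succ, pow_succ]; exact ih.mul h

theorem RestrictsTo.aeval {M : Op (Fin m ⊕ R)} {N : Op R} (h : RestrictsTo M N) (p : ℂ[X]) :
    RestrictsTo (aeval M p) (aeval N p) := by
  intro z x y
  rw [aeval_eq_sum_range, aeval_eq_sum_range, Matrix.sum_apply, Matrix.sum_apply]
  simp only [Matrix.smul_apply, h.pow _ z x y]
  split_ifs <;> simp

/-- The mean of the walk operator `(2 |0⟩⟨0| - 1) S` and its inverse preserves the zero state, and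
acts there as the block of the reflection `S`. -/
theorem restrictsTo_walk {S : Op (Fin m ⊕ R)} (hH : Sᴴ = S) {X : Op R}
    (hX : ∀ x y, S (Sum.elim 0 x) (Sum.elim 0 y) = X x y) :
    RestrictsTo ((1 / 2 : ℂ) • (zeroReflection m R * S + (zeroReflection m R * S)ᴴ)) X := by
  intro z x y
  rw [Matrix.conjTranspose_mul, hH, zeroReflection_conjTranspose, Matrix.smul_apply,
    Matrix.add_apply, zeroReflection, Matrix.diagonal_mul, Matrix.mul_diagonal]
  have h0 : (Sum.elim (0 : Fin m → Fin 2) y : Fin m ⊕ R → Fin 2) ∘ Sum.inl = 0 := rfl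
  have hz : (Sum.elim z x : Fin m ⊕ R → Fin 2) ∘ Sum.inl = z := rfl
  rw [if_pos h0, hz]
  split_ifs with h
  · subst h; rw [hX, smul_eq_mul]; ring
  · rw [smul_eq_mul]; ring

/-- A polynomial, bounded by `1 / 2` on `[-1, 1]`, of the block `X` of a reflection `S`. -/
theorem exists_impl_poly {a L : ℕ} {S : Op (Fin m ⊕ R)} (hS : Impl a L S) (hH : Sᴴ = S)
    {N : Op R} (hN : ∀ x y, S (Sum.elim 0 x) (Sum.elim 0 y) = N x y) {p : ℂ[X]} {Q : ℕ}
    (hp : p.natDegree ≤ Q) (hb : ∀ t : ℝ, |t| ≤ 1 → ‖p.eval (t : ℂ)‖ ≤ 1 / 2) (q : R)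
    (hcard : m ≤ a + Fintype.card R) :
    ∃ V : Op (Unit ⊕ (Fin m ⊕ R)), Impl (a + 1) (44 * max 1 Q * (L + 352 * m + 25)) V ∧
      (∀ x y, V (Sum.elim 0 (Sum.elim 0 x)) (Sum.elim 0 (Sum.elim 0 y)) = aeval N p x y) ∧
      (∀ {α : Type} (φ : (R → Fin 2) → α), Keeps (fun y => φ (y ∘ Sum.inr)) S →
        Keeps (fun y => φ (y ∘ Sum.inr ∘ Sum.inr)) V) := by
  set W := zeroReflection m R * S with hWdef
  have hW : Impl (a + 1) (L + 352 * m + 25) W :=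
    ((impl_zeroReflection a m q hcard).mul (hS.mono (Nat.le_succ a))).le (by omega)
  have hbF : ∀ z : ℂ, ‖z‖ = 1 → ‖(joukowski Q p).eval z‖ ≤ 1 / 2 := by
    intro z hz
    have hz0 : z ≠ 0 := fun h => by rw [h] at hz; simp at hz
    have e := aeval_joukowski (A := ℂ) (mul_inv_cancel₀ hz0) (inv_mul_cancel₀ hz0) hp
    rw [coe_aeval_eq_eval, coe_aeval_eq_eval] at e
    rw [e, norm_mul, norm_pow, hz, one_pow, one_mul]
    have h1 : (1 / 2 : ℂ) • (z + z⁻¹) = ((z.re : ℝ) : ℂ) := by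
      rw [← star_eq_inv_of_norm hz, smul_eq_mul]
      change 1 / 2 * (z + (starRingEnd ℂ) z) = _
      rw [Complex.add_conj]; push_cast; ring
    rw [h1]
    exact hb _ ((Complex.abs_re_le_norm z).trans hz.le)
  obtain ⟨E, hE, hFE⟩ := exists_complement (natDegree_joukowski_le Q p) hbF
  obtain ⟨V, hV, h0, -, hk⟩ := exists_impl_gqsp hW (2 * Q) _ E (natDegree_joukowski_le Q p) hE hFE
  have hpow : Impl (a + 1) (Q * (L + 352 * m + 25))
      (emb (Sum.inr : Fin m ⊕ R → Unit ⊕ (Fin m ⊕ R)) (Wᴴ ^ Q)) :=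
    (hW.inv.pow Q).emb Function.Embedding.inr
  refine ⟨_, (hpow.mul hV).le ?_, ?_, ?_⟩
  · set ω := L + 352 * m + 25
    have h1 : 1 ≤ ω := by omega
    have h2 : 1 ≤ max 1 Q := le_max_left _ _
    have h3 : Q ≤ max 1 Q := le_max_right _ _
    generalize max 1 Q = M at *
    have h4 : Q * ω ≤ M * ω := Nat.mul_le_mul_right _ h3
    have h5 : M * 1 ≤ M * ω := Nat.mul_le_mul_left _ h1
    calc Q * ω + (2 * Q * (20 * ω + 1) + 1) = 41 * (Q * ω) + 2 * Q + 1 := by ring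
      _ ≤ 41 * (M * ω) + 2 * M + M := by omega
      _ ≤ 44 * (M * ω) := by omega
      _ = 44 * M * ω := by ring
  · intro x y
    have h1 : ∀ v, (emb (Sum.inr : Fin m ⊕ R → Unit ⊕ (Fin m ⊕ R)) (Wᴴ ^ Q) * V)
        (Sum.elim 0 v) (Sum.elim 0 (Sum.elim 0 y)) =
        (Wᴴ ^ Q * aeval W (joukowski Q p)) v (Sum.elim 0 y) := by
      intro v
      rw [Matrix.mul_apply, sum_bits_elim, Finset.sum_eq_single 0, Matrix.mul_apply]
      · exact Finset.sum_congr rfl fun w _ => by rw [emb_inr_elim, if_pos rfl, h0]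
      · intro f _ hf
        exact Finset.sum_eq_zero fun w _ => by rw [emb_inr_elim, if_neg (Ne.symm hf), zero_mul]
      · simp
    have h2 : Wᴴ ^ Q * W ^ Q = 1 := by
      have hc : Commute Wᴴ W := hW.unitary.trans hW.unitary'.symm
      rw [← hc.mul_pow, hW.unitary, one_pow]
    rw [h1, aeval_joukowski hW.unitary' hW.unitary hp, ← Matrix.mul_assoc, h2, Matrix.one_mul,
      (restrictsTo_walk hH hN).aeval p 0 x y, if_pos rfl]
  · intro α φ hφ
    have hkW : Keeps (fun y => φ (y ∘ Sum.inr)) W := (Keeps.diagonal _ _).mul hφ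
    exact (Keeps.emb (φ := fun y : Fin m ⊕ R → Fin 2 => φ (y ∘ Sum.inr))
      (hkW.conjTranspose.pow Q)).mul (hk _ hkW)

end

/-! ### Block-encodings -/

section

variable {A A' B S S' : Type} [Fintype A] [DecidableEq A] [Fintype A'] [DecidableEq A']
  [Fintype B] [DecidableEq B] [Fintype S] [DecidableEq S] [Fintype S'] [DecidableEq S']

/-- `M` is the block, at the zero state of the signal qubits `A`, of a unitary that is implemented
with `a` clean ancillas and at most `L` gates. -/
def BlockEnc (a : ℕ) (A : Type) [Fintype A] [DecidableEq A] (L : ℕ) (M : Op S) : Prop :=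
  ∃ U : Op (A ⊕ S), Impl a L U ∧ ∀ x y, U (Sum.elim 0 x) (Sum.elim 0 y) = M x y

theorem BlockEnc.le {a L L' : ℕ} {M : Op S} (h : BlockEnc a A L M) (hL : L ≤ L') :
    BlockEnc a A L' M := by
  obtain ⟨U, hU, hb⟩ := h
  exact ⟨U, hU.le hL, hb⟩

theorem BlockEnc.mono {a a' L : ℕ} {M : Op S} (h : BlockEnc a A L M) (ha : a ≤ a') :
    BlockEnc a' A L M := by
  obtain ⟨U, hU, hb⟩ := h
  exact ⟨U, hU.mono ha, hb⟩

theorem Impl.blockEnc {a L : ℕ} {M : Op S} (h : Impl a L M) : BlockEnc a A L M :=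
  ⟨_, h.emb Function.Embedding.inr, fun x y => (emb_inr_elim M 0 0 x y).trans (if_pos rfl)⟩

theorem BlockEnc.conjTranspose {a L : ℕ} {M : Op S} (h : BlockEnc a A L M) :
    BlockEnc a A L Mᴴ := by
  obtain ⟨U, hU, hb⟩ := h
  exact ⟨Uᴴ, hU.inv, fun x y => by
    rw [Matrix.conjTranspose_apply, hb, Matrix.conjTranspose_apply]⟩

/-- Idle signal qubits may be added, and the system qubits may be renamed. -/
theorem BlockEnc.map {a L : ℕ} {M : Op S} (h : BlockEnc a A L M) (ι : A ↪ A') (e : S ≃ S') :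
    BlockEnc a A' L (Matrix.of fun x y : S' → Fin 2 => M (x ∘ e) (y ∘ e)) := by
  obtain ⟨U, hU, hb⟩ := h
  refine ⟨_, hU.emb (Function.Embedding.sumMap ι e.toEmbedding), fun x y => ?_⟩
  have hx : ∀ x : S' → Fin 2, Sum.elim (0 : A' → Fin 2) x ∘
      Function.Embedding.sumMap ι e.toEmbedding = Sum.elim (0 : A → Fin 2) (x ∘ e) := by
    intro x; funext q; rcases q with q | q <;> rfl
  rw [emb_apply_pos, hx, hx, hb]
  · rfl
  · rintro (q | q) hq
    · rfl
    · exact absurd ⟨Sum.inr (e.symm q), by simp⟩ hq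

theorem BlockEnc.embed {a L : ℕ} {M : Op S} (h : BlockEnc a A L M) (ι : A ↪ A') :
    BlockEnc a A' L M := h.map ι (Equiv.refl S)

/-- Block-encodings with different signal qubits can be multiplied. -/
theorem BlockEnc.mul {a L L' : ℕ} {M M' : Op S} (h : BlockEnc a A L M)
    (h' : BlockEnc a A' L' M') : BlockEnc a (A ⊕ A') (L + L') (M * M') := by
  obtain ⟨U, hU, hb⟩ := h
  obtain ⟨U', hU', hb'⟩ := h'
  let ι : A ⊕ S ↪ (A ⊕ A') ⊕ S :=
    Function.Embedding.sumMap Function.Embedding.inl (Function.Embedding.refl _)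
  let ι' : A' ⊕ S ↪ (A ⊕ A') ⊕ S :=
    Function.Embedding.sumMap Function.Embedding.inr (Function.Embedding.refl _)
  have e1 : ∀ (u v : A → Fin 2) (u' v' : A' → Fin 2) (x y : S → Fin 2),
      emb ι U (Sum.elim (Sum.elim u u') x) (Sum.elim (Sum.elim v v') y) =
      if u' = v' then U (Sum.elim u x) (Sum.elim v y) else 0 := by
    intro u v u' v' x y
    have hc : ∀ (u : A → Fin 2) (u' : A' → Fin 2) (x : S → Fin 2),
        Sum.elim (Sum.elim u u') x ∘ ι = Sum.elim u x := by
      intro u u' x; funext q; rcases q with q | q <;> rfl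
    split_ifs with h
    · subst h
      rw [emb_apply_pos, hc, hc]
      rintro ((q | q) | q) hq
      · exact absurd ⟨Sum.inl q, rfl⟩ hq
      · rfl
      · exact absurd ⟨Sum.inr q, rfl⟩ hq
    · rw [emb_apply_neg]
      refine fun h' => h (funext fun q => h' (Sum.inl (Sum.inr q)) ?_)
      rintro ⟨r | r, hr⟩
      · exact Sum.inl_ne_inr (Sum.inl_injective hr)
      · exact Sum.inr_ne_inl hr
  have e2 : ∀ (u v : A → Fin 2) (u' v' : A' → Fin 2) (x y : S → Fin 2),
      emb ι' U' (Sum.elim (Sum.elim u u') x) (Sum.elim (Sum.elim v v') y) =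
      if u = v then U' (Sum.elim u' x) (Sum.elim v' y) else 0 := by
    intro u v u' v' x y
    have hc : ∀ (u : A → Fin 2) (u' : A' → Fin 2) (x : S → Fin 2),
        Sum.elim (Sum.elim u u') x ∘ ι' = Sum.elim u' x := by
      intro u u' x; funext q; rcases q with q | q <;> rfl
    split_ifs with h
    · subst h
      rw [emb_apply_pos, hc, hc]
      rintro ((q | q) | q) hq
      · rfl
      · exact absurd ⟨Sum.inl q, rfl⟩ hq
      · exact absurd ⟨Sum.inr q, rfl⟩ hq
    · rw [emb_apply_neg]
      refine fun h' => h (funext fun q => h' (Sum.inl (Sum.inl q)) ?_)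
      rintro ⟨r | r, hr⟩
      · exact Sum.inr_ne_inl (Sum.inl_injective hr)
      · exact Sum.inr_ne_inl hr
  refine ⟨_, (hU.emb ι).mul (hU'.emb ι'), fun x y => ?_⟩
  have h0 : (0 : A ⊕ A' → Fin 2) = Sum.elim (0 : A → Fin 2) (0 : A' → Fin 2) := by
    funext q; rcases q with q | q <;> rfl
  rw [Matrix.mul_apply, sum_bits_elim, h0, sum_bits_elim, Finset.sum_eq_single 0,
    Finset.sum_eq_single 0, Matrix.mul_apply]
  · exact Finset.sum_congr rfl fun v _ => by rw [e1, e2, if_pos rfl, if_pos rfl, hb, hb']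
  · intro u' _ hu'
    exact Finset.sum_eq_zero fun v _ => by rw [e1, if_neg (Ne.symm hu'), zero_mul]
  · simp
  · intro u _ hu
    exact Finset.sum_eq_zero fun u' _ => Finset.sum_eq_zero fun v _ => by
      rw [e2, if_neg hu, mul_zero]
  · simp

/-- A linear combination with nonnegative coefficients, of sum `α`, can be block-encoded with
normalization `α`. -/
theorem BlockEnc.lcu {T : Type} [Fintype T] {a r : ℕ} (hT : Fintype.card T ≤ 2 ^ r) (w : T → ℝ)
    (hw : ∀ t, 0 ≤ w t) {α : ℝ} (hα : 0 < α) (hsum : ∑ t, w t = α) {L : T → ℕ} {M : T → Op S}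
    (hM : ∀ t, BlockEnc a A (L t) (M t))
    (hcard : r ≤ a + Fintype.card A + Fintype.card S) :
    BlockEnc (a + 1) (Fin r ⊕ A)
      (800 * (r + 1) * 2 ^ r + ∑ t, (2 * (176 * r + 2) + 20 * L t))
      (Matrix.of fun x y => (α : ℂ)⁻¹ * ∑ t, (w t : ℂ) * M t x y) := by
  choose U hU hb using hM
  have enc : Nonempty (T ↪ (Fin r → Fin 2)) := by
    refine Function.Embedding.nonempty_of_card_le ?_
    simpa using hT
  obtain ⟨enc⟩ := enc
  obtain ⟨V, hV, hVb, -, -⟩ := exists_impl_lcu enc (fun t => w t / α)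
    (fun t => div_nonneg (hw t) hα.le)
    (by rw [← Finset.sum_div, hsum, div_self hα.ne']) hU
    (by rw [Fintype.card_sum]; omega)
  refine ⟨_, hV.emb (Equiv.sumAssoc (Fin r) A S).symm.toEmbedding, fun x y => ?_⟩
  have hc : ∀ x : S → Fin 2, Sum.elim (0 : Fin r ⊕ A → Fin 2) x ∘
      (Equiv.sumAssoc (Fin r) A S).symm.toEmbedding =
      Sum.elim (0 : Fin r → Fin 2) (Sum.elim (0 : A → Fin 2) x) := by
    intro x; funext q; rcases q with q | q | q <;> rfl
  rw [emb_surjective (ι := (Equiv.sumAssoc (Fin r) A S).symm.toEmbedding)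
    (Equiv.sumAssoc (Fin r) A S).symm.surjective, hc, hc, hVb, Matrix.of_apply, Finset.mul_sum]
  refine Finset.sum_congr rfl fun t _ => ?_
  rw [hb, Complex.ofReal_div]
  ring

/-! ### Diagonal operators -/

theorem single_inl_block (q : A) (u : Matrix.unitaryGroup (Fin 2) ℂ) (x y : S → Fin 2) :
    (Gate.single (Sum.inl q : A ⊕ S) u).matrix (Sum.elim 0 x) (Sum.elim 0 y) =
      if x = y then (u : Matrix (Fin 2) (Fin 2) ℂ) 0 0 else 0 := by
  by_cases h : x = y
  · subst h
    rw [Gate.matrix_single_apply_self fun _ _ => rfl, if_pos rfl]; rfl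
  · simp only [Gate.matrix, Matrix.of_apply]
    rw [if_neg h, if_neg]
    exact fun h' => h (funext fun i => h' (Sum.inr i) (by simp))

/-- A diagonal operator whose entries are chosen by classical information about the system:
if `sel y = some t`, the entry at `y` is the one block-encoded by `U t`; if `sel y = none`,
it is `0`. -/
theorem BlockEnc.select (q : A) {T : Type} [Fintype T] {a C : ℕ} (sel : (S → Fin 2) → Option T)
    {L : T → ℕ} {U : T → Op (A ⊕ S)} (hU : ∀ t, Impl a (L t) (U t))
    (hk : ∀ t, Keeps (fun y => sel (y ∘ Sum.inr)) (U t))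
    (hrec : ∀ t, Recog a C fun y : A ⊕ S → Fin 2 => sel (y ∘ Sum.inr) = some t)
    {d : (S → Fin 2) → ℂ}
    (hb : ∀ t x y, sel y = some t →
      U t (Sum.elim 0 x) (Sum.elim 0 y) = if x = y then d y else 0)
    (hd : ∀ y, sel y = none → d y = 0) :
    BlockEnc (a + 1) A (∑ t, (2 * C + 20 * (L t + 1)) + 1) (Matrix.diagonal d : Op S) := by
  set X : Op (A ⊕ S) := (Gate.single (Sum.inl q : A ⊕ S) pauliX).matrix with hX
  have hXk : Keeps (fun y : A ⊕ S → Fin 2 => sel (y ∘ Sum.inr)) X :=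
    Gate.keeps_single _ _ fun x y h => congrArg sel (funext fun i => h _ (by simp))
  have hXX : X * X = 1 := by
    rw [hX, Gate.matrix_single_mul, pauliX_mul_pauliX, Gate.matrix_single_one]
  have hM := Impl.mux (U := fun t => U t * X) (sel := fun y : A ⊕ S → Fin 2 => sel (y ∘ Sum.inr))
    (T := fun _ => C) (fun t => (hU t).mul (Impl.gate a (Gate.single (Sum.inl q) pauliX)))
    (fun t => (hk t).mul hXk) hrec
  refine ⟨_, hM.mul (Impl.gate (a + 1) (Gate.single (Sum.inl q : A ⊕ S) pauliX)), fun x y => ?_⟩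
  rw [← hX]
  have hcol : ∀ (N : Op (A ⊕ S)), (∀ z, sel (z ∘ Sum.inr) = sel y →
      (mux (fun y : A ⊕ S → Fin 2 => sel (y ∘ Sum.inr)) fun t => U t * X) (Sum.elim 0 x) z =
        N (Sum.elim 0 x) z) →
      ((mux (fun y : A ⊕ S → Fin 2 => sel (y ∘ Sum.inr)) fun t => U t * X) * X)
        (Sum.elim 0 x) (Sum.elim 0 y) = (N * X) (Sum.elim 0 x) (Sum.elim 0 y) := by
    intro N hN
    rw [Matrix.mul_apply, Matrix.mul_apply]
    refine Finset.sum_congr rfl fun z _ => ?_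
    by_cases hz : X z (Sum.elim 0 y) = 0
    · simp [hz]
    · rw [hN z (hXk z _ hz)]
  rcases hs : sel y with _ | t
  · rw [hcol 1 fun z hz => mux_apply_none (hz.trans hs), Matrix.one_mul, hX, single_inl_block,
      Matrix.diagonal_apply]
    by_cases hxy : x = y
    · subst hxy; simp [pauliX, hd x hs]
    · simp [hxy]
  · rw [hcol (U t * X) fun z hz => mux_apply_some (hz.trans hs), Matrix.mul_assoc, hXX,
      Matrix.mul_one, hb t x y hs, Matrix.diagonal_apply]
    by_cases hxy : x = y <;> simp [hxy]

variable {n : ℕ}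

/-- A diagonal operator with few nonzero entries, depending on a register of `n` qubits. -/
theorem blockEnc_sparse_diagonal (a : ℕ) (q : A) (e : Fin n → S) (F : Finset (Fin (2 ^ n)))
    (d : Fin (2 ^ n) → ℂ) (hd : ∀ i, ‖d i‖ ≤ 1) (h0 : ∀ i, i ∉ F → d i = 0)
    (hcard : 2 * n ≤ a + Fintype.card A + Fintype.card S) :
    BlockEnc (a + 1) A (F.card * (352 * n + 44) + 1)
      (Matrix.diagonal fun y => d (finFunctionFinEquiv (y ∘ e)) : Op S) := by
  classical
  choose u hu using fun i => exists_unitary_entry (d i) (hd i)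
  let sel : (S → Fin 2) → Option F := fun y =>
    if h : finFunctionFinEquiv (y ∘ e) ∈ F then some ⟨_, h⟩ else none
  have hsel : ∀ (y : S → Fin 2) (t : F), sel y = some t ↔ finFunctionFinEquiv (y ∘ e) = t := by
    intro y t
    simp only [sel]
    split_ifs with h
    · rw [Option.some.injEq]; exact Subtype.ext_iff
    · constructor
      · intro h'; cases h'
      · intro h'; exact absurd (h' ▸ t.2) h
  refine (BlockEnc.select (a := a) q sel (L := fun _ => 1) (C := 176 * n + 2)
    (U := fun t : F => (Gate.single (Sum.inl q : A ⊕ S) (u t)).matrix) (fun t => Impl.gate a _)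
    (fun t => Gate.keeps_single _ _ fun x y h => congrArg sel (funext fun i => h _ (by simp)))
    (fun t => ?_) (fun t x y h => ?_) fun y h => ?_).le ?_
  · have := recog_eq a (fun i => (Sum.inr (e i) : A ⊕ S)) (finFunctionFinEquiv.symm (t : Fin _))
      (by rw [Fintype.card_sum]; omega)
    refine cast ?_ this
    congr 1
    funext y
    rw [hsel, ← Equiv.eq_symm_apply]
    rfl
  · rw [single_inl_block, hu, (hsel y t).1 h]
  · refine h0 _ fun h' => ?_
    simp only [sel, dif_pos h'] at h
    cases h
  · simp only [Finset.sum_const, Finset.card_univ, Fintype.card_coe, smul_eq_mul]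
    refine Nat.add_le_add_right (Nat.mul_le_mul_left _ ?_) 1
    omega

/-- The projector onto the states whose `n`-qubit register holds a number in an interval. -/
theorem blockEnc_interval (a : ℕ) (q : A) (e : Fin n → S) {c c' : ℕ} (hc : c ≤ c')
    (hcard : 2 * n ≤ a + Fintype.card A + Fintype.card S) [DecidablePred fun y : S → Fin 2 =>
      c ≤ bitsVal (y ∘ e) ∧ bitsVal (y ∘ e) < c'] :
    BlockEnc (a + 1) A (352 * n + 25) (Matrix.diagonal fun y : S → Fin 2 =>
      if c ≤ bitsVal (y ∘ e) ∧ bitsVal (y ∘ e) < c' then (1 : ℂ) else 0 : Op S) := by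
  let sel : (S → Fin 2) → Option Unit := fun y =>
    if c ≤ bitsVal (y ∘ e) ∧ bitsVal (y ∘ e) < c' then some () else none
  refine (BlockEnc.select (a := a) q sel (L := fun _ => 0) (C := 176 * n + 2)
    (U := fun _ => 1) (fun t => Impl.one a) (fun t => Keeps.one _)
    (fun t => ?_) (fun t x y h => ?_) fun y h => ?_).le ?_
  · have := recog_interval a (fun i => (Sum.inr (e i) : A ⊕ S)) hc
      (by rw [Fintype.card_sum]; omega)
    refine cast ?_ this
    congr 1
    funext y
    apply propext
    simp only [sel]
    split_ifs with h
    · exact ⟨fun _ => rfl, fun _ => h⟩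
    · exact ⟨fun h' => absurd h' h, fun h' => by cases h'⟩
  · have hp : c ≤ bitsVal (y ∘ e) ∧ bitsVal (y ∘ e) < c' := by
      by_contra hn
      simp only [sel, if_neg hn] at h
      cases h
    rw [if_pos hp, Matrix.one_apply]
    simp [elim_eq_elim]
  · rw [if_neg]
    intro hp
    simp only [sel, if_pos hp] at h
    cases h
  · simp only [Finset.univ_unique, Finset.sum_singleton]
    omega

end

/-! ### Piecewise polynomials of the position -/

section

open Polynomial

variable {S : Type} [Fintype S] [DecidableEq S] {n m : ℕ}

theorem aeval_diagonal {ι : Type} [Fintype ι] [DecidableEq ι] (d : ι → ℂ) (p : ℂ[X]) :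
    aeval (Matrix.diagonal d) p = Matrix.diagonal fun i => p.eval (d i) := by
  have := aeval_algHom_apply (Matrix.diagonalAlgHom ℂ (n := ι) (α := ℂ)) d p
  rw [Matrix.diagonalAlgHom_apply] at this
  rw [this, Matrix.diagonalAlgHom_apply]
  congr 1
  funext i
  have h2 := aeval_algHom_apply (Pi.evalAlgHom ℂ (fun _ : ι => ℂ) i) d p
  rw [Pi.evalAlgHom_apply, Pi.evalAlgHom_apply, coe_aeval_eq_eval] at h2
  exact h2.symm

/-- The affine function of `i` that maps `0, …, 2 ^ n - 1` to equidistant points of `[-1, 1]`. -/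
def unitCoord (n i : ℕ) : ℝ := 2 * i / (2 ^ n - 1) - 1

theorem sum_two_pow (n : ℕ) : ∑ j : Fin n, (2 : ℝ) ^ (j : ℕ) = 2 ^ n - 1 := by
  rw [Fin.sum_univ_eq_sum_range fun j => (2 : ℝ) ^ j, geom_sum_eq (by norm_num)]
  norm_num

/-- The binary expansion of the rescaled position, with the digits read as signs. -/
theorem unitCoord_bitsVal (hn : 0 < n) (y : Fin n → Fin 2) :
    ∑ j : Fin n, (2 : ℝ) ^ (j : ℕ) / (2 ^ n - 1) * (if y j = 1 then 1 else -1) =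
      unitCoord n (bitsVal y) := by
  have h1 : (1 : ℝ) < 2 ^ n := one_lt_pow₀ (by norm_num) hn.ne'
  have h3 : ∀ j : Fin n, (2 : ℝ) ^ (j : ℕ) / (2 ^ n - 1) * (if y j = 1 then 1 else -1) =
      (2 * ((y j : ℕ) * 2 ^ (j : ℕ)) - 2 ^ (j : ℕ)) / (2 ^ n - 1) := by
    intro j
    rcases fin2_cases (y j) with h | h
    · simp [h, neg_div]
    · simp [h]; ring
  rw [Finset.sum_congr rfl fun j _ => h3 j, ← Finset.sum_div, Finset.sum_sub_distrib,
    ← Finset.mul_sum, sum_two_pow, unitCoord, sub_div, div_self (by linarith), bitsVal_eq_sum]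
  push_cast
  rfl

/-- The position, rescaled to `[-1, 1]`, is a linear combination of Pauli operators `Z`. -/
theorem exists_impl_coordinate (a : ℕ) (e : Fin n → S) (hn : 0 < n) (hm : n ≤ 2 ^ m)
    (hcard : m ≤ a + Fintype.card S) :
    ∃ V : Op (Fin m ⊕ S),
      Impl (a + 1) (800 * (m + 1) * 2 ^ m + n * (2 * (176 * m + 2) + 20)) V ∧ Vᴴ = V ∧
      (∀ x y, V (Sum.elim 0 x) (Sum.elim 0 y) = (Matrix.diagonal fun y : S → Fin 2 =>
        (unitCoord n (bitsVal (y ∘ e)) : ℂ) : Op S) x y) ∧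
      Keeps (fun y => y ∘ Sum.inr) V := by
  have h1 : (1 : ℝ) < 2 ^ n := one_lt_pow₀ (by norm_num) hn.ne'
  obtain ⟨enc⟩ : Nonempty (Fin n ↪ (Fin m → Fin 2)) :=
    Function.Embedding.nonempty_of_card_le (by simpa using hm)
  have hU : ∀ j, (Gate.single (e j) (diagU (-1) 1)).matrix =
      (Matrix.diagonal fun y : S → Fin 2 => if y (e j) = 1 then (1 : ℂ) else -1) := by
    intro j; rw [Gate.matrix_single_diagU]; simp
  obtain ⟨V, hV, hb, hH, hk⟩ := exists_impl_lcu (a := a) enc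
    (fun j => (2 : ℝ) ^ (j : ℕ) / (2 ^ n - 1))
    (fun j => div_nonneg (by positivity) (by linarith))
    (by
      rw [← Finset.sum_div, sum_two_pow, div_self (sub_ne_zero.2 h1.ne')])
    (L := fun _ => 1) (fun j => Impl.gate a (Gate.single (e j) (diagU (-1) 1))) hcard
  refine ⟨V, hV.le ?_, hH fun j => ?_, fun x y => ?_, hk id fun j => ?_⟩
  · rw [Finset.sum_const, Finset.card_univ, Fintype.card_fin, smul_eq_mul]
  · rw [hU, Matrix.diagonal_conjTranspose]
    congr 1
    funext y
    rw [Pi.star_apply]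
    split_ifs <;> simp
  · rw [hb, Matrix.diagonal_apply]
    split_ifs with h
    · subst h
      rw [← unitCoord_bitsVal hn, Complex.ofReal_sum]
      refine Finset.sum_congr rfl fun j _ => ?_
      rw [hU, Matrix.diagonal_apply_eq]
      push_cast
      simp only [Function.comp_apply]
      split_ifs <;> simp
    · exact Finset.sum_eq_zero fun j _ => by rw [hU, Matrix.diagonal_apply_ne _ h, mul_zero]
  · rw [hU]; exact Keeps.diagonal _ _

/-- The gate count of a polynomial of degree `Q` in the position, with `m` signal qubits for the
position. -/
def polyCost (n m Q : ℕ) : ℕ :=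
  2 * (176 * n + 2) + 20 * (44 * max 1 Q * (800 * (m + 1) * 2 ^ m + n * (2 * (176 * m + 2) + 20) +
    352 * m + 25) + 1)

/-- Diagonal operators given by different polynomials of the position on disjoint intervals. -/
theorem blockEnc_piecewise (a : ℕ) (e : Fin n → S) (hn : 0 < n) (hm : n ≤ 2 ^ m) {T : Type}
    [Fintype T] (c c' : T → ℕ) (hc : ∀ t, c t ≤ c' t)
    (hdisj : ∀ (i : ℕ) t t', c t ≤ i → i < c' t → c t' ≤ i → i < c' t' → t = t')
    (p : T → ℂ[X]) (hp : ∀ t (s : ℝ), |s| ≤ 1 → ‖(p t).eval (s : ℂ)‖ ≤ 1 / 2)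
    (d : ℕ → ℂ)
    (hd : ∀ t i, c t ≤ i → i < c' t → d i = (p t).eval (unitCoord n i : ℂ))
    (hd0 : ∀ i < 2 ^ n, (∀ t, ¬ (c t ≤ i ∧ i < c' t)) → d i = 0)
    (hcard : 2 * n ≤ a + Fintype.card S) (hmn : m ≤ n) :
    BlockEnc (a + 3) (Unit ⊕ Fin m) (∑ t, polyCost n m (p t).natDegree + 1)
      (Matrix.diagonal fun y => d (bitsVal (y ∘ e)) : Op S) := by
  classical
  obtain ⟨V, hV, hH, hb, hk⟩ := exists_impl_coordinate a e hn hm (by omega)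
  obtain ⟨j⟩ : Nonempty S := ⟨e ⟨0, hn⟩⟩
  choose U hU hUb hUk using fun t => exists_impl_poly hV hH hb le_rfl (hp t) j (by omega)
  let ε : Unit ⊕ (Fin m ⊕ S) ≃ (Unit ⊕ Fin m) ⊕ S := (Equiv.sumAssoc _ _ _).symm
  have hε : ∀ x : S → Fin 2, Sum.elim (0 : Unit ⊕ Fin m → Fin 2) x ∘ ε.toEmbedding =
      Sum.elim (0 : Unit → Fin 2) (Sum.elim (0 : Fin m → Fin 2) x) := by
    intro x; funext q; rcases q with q | q | q <;> rfl
  let sel : (S → Fin 2) → Option T := fun y =>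
    if h : ∃ t, c t ≤ bitsVal (y ∘ e) ∧ bitsVal (y ∘ e) < c' t then some h.choose else none
  have hsel : ∀ (y : S → Fin 2) t, sel y = some t ↔
      c t ≤ bitsVal (y ∘ e) ∧ bitsVal (y ∘ e) < c' t := by
    intro y t
    simp only [sel]
    split_ifs with h
    · rw [Option.some.injEq]
      constructor
      · rintro rfl; exact h.choose_spec
      · intro h'
        exact hdisj _ _ _ h.choose_spec.1 h.choose_spec.2 h'.1 h'.2
    · exact ⟨fun h' => (by cases h'), fun h' => absurd ⟨t, h'⟩ h⟩
  refine (BlockEnc.select (a := a + 2) (A := Unit ⊕ Fin m) (Sum.inl ()) sel (C := 176 * n + 2)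
    (U := fun t => emb ε.toEmbedding (U t)) (fun t => (hU t).emb ε.toEmbedding) (fun t => ?_)
    (fun t => ?_) (fun t x y h => ?_) fun y h => ?_).le ?_
  · intro x y hxy
    rw [emb_surjective (ι := ε.toEmbedding) ε.surjective] at hxy
    exact hUk t sel (hk.comp sel) _ _ hxy
  · have := recog_interval (a + 2) (fun i => (Sum.inr (e i) : (Unit ⊕ Fin m) ⊕ S)) (hc t)
      (by rw [Fintype.card_sum]; omega)
    refine cast ?_ this
    congr 1
    funext y
    rw [hsel]
    rfl
  · rw [emb_surjective (ι := ε.toEmbedding) ε.surjective, hε, hε, hUb, aeval_diagonal,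
      Matrix.diagonal_apply]
    split_ifs with hxy
    · subst hxy
      exact (hd t _ ((hsel x t).1 h).1 ((hsel x t).1 h).2).symm
    · rfl
  · refine hd0 _ (bitsVal_lt _) fun t ht => ?_
    rw [(hsel y t).2 ht] at h
    cases h
  · exact le_rfl

end

section

variable {a b : ℝ} (f : PiecewisePoly a b)

theorem PiecewisePoly.eval_of_mem {x : ℝ} {g : Fin f.G} (h : x ∈ f.piece g) :
    f.eval x = (f.poly g).eval (x : ℂ) := by
  have hlt : ∀ g g' : Fin f.G, g < g' → x ∈ f.piece g → x ∈ f.piece g' → False := by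
    intro g g' hgg h h'
    have h0 : g'.val ≠ 0 := by have := Fin.lt_def.1 hgg; omega
    rw [PiecewisePoly.piece, if_neg h0] at h'
    have h1 : x ≤ f.K g.succ := by
      rw [PiecewisePoly.piece] at h
      split_ifs at h
      · exact h.2
      · exact h.2
    have h2 : f.K g.succ ≤ f.K g'.castSucc :=
      f.K_strictMono.monotone (by rw [Fin.le_def]; simp; exact Fin.lt_def.1 hgg)
    exact absurd h'.1 (not_lt.2 (h1.trans h2))
  rw [PiecewisePoly.eval, Finset.sum_eq_single g, if_pos h]
  · intro g' _ hg
    refine if_neg fun h' => ?_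
    rcases lt_or_gt_of_ne hg with h1 | h1
    · exact hlt _ _ h1 h' h
    · exact hlt _ _ h1 h h'
  · simp

theorem PiecewisePoly.eval_of_notMem {x : ℝ} (h : ∀ g, x ∉ f.piece g) : f.eval x = 0 :=
  Finset.sum_eq_zero fun g _ => if_neg (h g)

theorem PiecewisePoly.norm_poly_le (g : Fin f.G) {x : ℝ} (hx : |x| ≤ max |a| |b|) :
    ‖(f.poly g).eval (x : ℂ)‖ ≤ f.normalization := by
  have hx' : x ∈ Set.Icc (-max |a| |b|) (max |a| |b|) := abs_le.1 hx
  -- the supremum is attained on a compact interval, hence it is not a junk value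
  have hb : BddAbove (Set.range fun x : Set.Icc (-max |a| |b|) (max |a| |b|) =>
      ‖(f.poly g).eval ((x : ℝ) : ℂ)‖) := by
    have := isCompact_range (X := Set.Icc (-max |a| |b|) (max |a| |b|))
      (f := fun x => ‖(f.poly g).eval ((x : ℝ) : ℂ)‖)
      (((f.poly g).continuous.comp
        (Complex.continuous_ofReal.comp continuous_subtype_val)).norm)
    exact this.bddAbove
  exact (le_ciSup hb ⟨x, hx'⟩).trans
    (le_ciSup (f := fun g => ⨆ x : Set.Icc (-max |a| |b|) (max |a| |b|),
      ‖(f.poly g).eval ((x : ℝ) : ℂ)‖) (Set.finite_range _).bddAbove g)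

theorem PiecewisePoly.normalization_nonneg : 0 ≤ f.normalization :=
  Real.iSup_nonneg fun _ => Real.iSup_nonneg fun _ => norm_nonneg _

theorem PiecewisePoly.norm_eval_le {x : ℝ} (hx : x ∈ Set.Icc a b) :
    ‖f.eval x‖ ≤ f.normalization := by
  by_cases h : ∃ g, x ∈ f.piece g
  · obtain ⟨g, hg⟩ := h
    rw [f.eval_of_mem hg]
    exact f.norm_poly_le g (abs_le_max_abs_abs hx.1 hx.2)
  · rw [f.eval_of_notMem fun g hg => h ⟨g, hg⟩, norm_zero]
    exact f.normalization_nonneg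

/-- The threshold of the grid index at a breakpoint. -/
def thresh (a dx : ℝ) (x : ℝ) : ℕ := ⌊(x - a) / dx⌋₊ + 1

theorem lt_thresh {dx x : ℝ} (hdx : 0 < dx) (hx : a ≤ x) (i : ℕ) :
    i < thresh a dx x ↔ a + i * dx ≤ x := by
  rw [thresh, Nat.lt_succ_iff, Nat.le_floor_iff (div_nonneg (sub_nonneg.2 hx) hdx.le),
    le_div_iff₀ hdx]
  constructor <;> intro h <;> linarith

variable {S : Type} [Fintype S] [DecidableEq S] {n m : ℕ}

/-- The values of a piecewise polynomial on the grid, divided by `2 * f.normalization`. The pieces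
act on disjoint intervals of grid indices, so that no superposition over them is needed. If the
normalization vanishes, so does the function, and the operator is zero. -/
theorem blockEnc_piecewisePoly (hab : a < b) (c : ℕ) (e : Fin n → S) (hn : 0 < n)
    (hm : n ≤ 2 ^ m) (hcard : 2 * n ≤ c + Fintype.card S) (hmn : m ≤ n) :
    BlockEnc (c + 3) (Unit ⊕ Fin m) (∑ g, polyCost n m (f.poly g).natDegree + 1)
      (Matrix.diagonal fun y => ((2 * f.normalization : ℝ) : ℂ)⁻¹ *
        f.eval (a + (bitsVal (y ∘ e) : ℝ) * ((b - a) / (2 ^ n - 1))) : Op S) := by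
  have h1 : (1 : ℝ) < 2 ^ n := one_lt_pow₀ (by norm_num) hn.ne'
  have hdx : 0 < (b - a) / (2 ^ n - 1 : ℝ) := div_pos (by linarith) (by linarith)
  set dx := (b - a) / (2 ^ n - 1 : ℝ) with hdxd
  have hKa : ∀ j, a ≤ f.K j := fun j =>
    f.K_first.ge.trans (f.K_strictMono.monotone (Fin.zero_le j))
  -- the first piece contains its left end, the others do not
  let lo : Fin f.G → ℕ := fun g => if g.val = 0 then 0 else thresh a dx (f.K g.castSucc)
  let hi : Fin f.G → ℕ := fun g => thresh a dx (f.K g.succ)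
  have hmem : ∀ g i, (lo g ≤ i ∧ i < hi g) ↔ a + (i : ℝ) * dx ∈ f.piece g := by
    intro g i
    have h0 : g.val = 0 → f.K g.castSucc = a := by
      intro h
      exact (congrArg f.K (Fin.ext h : g.castSucc = 0)).trans f.K_first
    simp only [lo, hi]
    rw [lt_thresh hdx (hKa _), PiecewisePoly.piece]
    split_ifs with h
    · rw [h0 h]
      constructor
      · intro h'; exact ⟨by have := mul_nonneg (Nat.cast_nonneg' (α := ℝ) i) hdx.le; linarith, h'.2⟩
      · intro h'; exact ⟨Nat.zero_le _, h'.2⟩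
    · rw [← not_lt, lt_thresh hdx (hKa _), not_le]; rfl
  -- the affine map from `[-1, 1]` onto `[a, b]`
  let q : Polynomial ℂ := Polynomial.C (((a + b) / 2 : ℝ) : ℂ) +
    Polynomial.C (((b - a) / 2 : ℝ) : ℂ) * Polynomial.X
  have hq : ∀ s : ℝ, q.eval (s : ℂ) = (((a + b) / 2 + (b - a) / 2 * s : ℝ) : ℂ) := by
    intro s; simp [q]
  have hqd : q.natDegree ≤ 1 := by
    refine (Polynomial.natDegree_add_le _ _).trans ?_
    rw [Polynomial.natDegree_C]
    exact max_le (by omega) ((Polynomial.natDegree_C_mul_le _ _).trans Polynomial.natDegree_X_le)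
  let p : Fin f.G → Polynomial ℂ := fun g =>
    Polynomial.C (((2 * f.normalization : ℝ) : ℂ)⁻¹) * ((f.poly g).comp q)
  have hp : ∀ g (s : ℝ), (p g).eval (s : ℂ) = ((2 * f.normalization : ℝ) : ℂ)⁻¹ *
      (f.poly g).eval ((((a + b) / 2 + (b - a) / 2 * s : ℝ)) : ℂ) := by
    intro g s
    simp only [p]
    rw [Polynomial.eval_mul, Polynomial.eval_C, Polynomial.eval_comp, hq]
  have hu : ∀ i : ℕ, (a + b) / 2 + (b - a) / 2 * unitCoord n i = a + (i : ℝ) * dx := by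
    intro i
    have : (2 ^ n - 1 : ℝ) ≠ 0 := by linarith
    rw [unitCoord, hdxd]; field_simp; ring
  refine (blockEnc_piecewise c e hn hm lo hi (fun g => ?_) (fun i t t' h1 h2 h3 h4 => ?_) p
    (fun g s hs => ?_) (fun i => ((2 * f.normalization : ℝ) : ℂ)⁻¹ * f.eval (a + (i : ℝ) * dx))
    (fun g i h2 h3 => ?_) (fun i _ h2 => ?_) hcard hmn).le ?_
  · simp only [lo, hi]
    split_ifs
    · exact Nat.zero_le _
    · refine Nat.succ_le_succ (Nat.floor_mono (div_le_div_of_nonneg_right ?_ hdx.le))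
      exact sub_le_sub_right (f.K_strictMono.monotone (Fin.castSucc_le_succ _)) _
  · by_contra hne
    wlog hlt : t < t' generalizing t t'
    · exact this t' t h3 h4 h1 h2 (Ne.symm hne) (lt_of_le_of_ne (not_lt.1 hlt) (Ne.symm hne))
    have h0 : t'.val ≠ 0 := by have := Fin.lt_def.1 hlt; omega
    simp only [lo, hi, if_neg h0] at h2 h3
    have hK : f.K t.succ ≤ f.K t'.castSucc :=
      f.K_strictMono.monotone (by rw [Fin.le_def]; simp; exact Fin.lt_def.1 hlt)
    have : thresh a dx (f.K t.succ) ≤ thresh a dx (f.K t'.castSucc) :=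
      Nat.succ_le_succ (Nat.floor_mono (div_le_div_of_nonneg_right (sub_le_sub_right hK _) hdx.le))
    omega
  · rw [hp, norm_mul]
    have hx : (a + b) / 2 + (b - a) / 2 * s ∈ Set.Icc a b := by
      have := abs_le.1 hs
      constructor <;> nlinarith
    have h2 := f.norm_poly_le g (abs_le_max_abs_abs hx.1 hx.2)
    rw [norm_inv, Complex.norm_real, Real.norm_of_nonneg (by linarith [f.normalization_nonneg])]
    rcases eq_or_lt_of_le f.normalization_nonneg with h3 | h3
    · rw [← h3]; norm_num
    · rw [inv_mul_le_iff₀ (by linarith)]; linarith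
  · rw [hp, hu, f.eval_of_mem ((hmem g i).1 ⟨h2, h3⟩)]
  · rw [f.eval_of_notMem fun g hg => h2 g ((hmem g i).2 hg), mul_zero]
  · refine Nat.add_le_add_right (Finset.sum_le_sum fun g _ => ?_) 1
    have hdeg : (p g).natDegree ≤ (f.poly g).natDegree := by
      refine (Polynomial.natDegree_C_mul_le _ _).trans ((Polynomial.natDegree_comp_le).trans ?_)
      exact (Nat.mul_le_mul_left _ hqd).trans (by omega)
    unfold polyCost
    gcongr

end

/-! ### Addition of a constant -/

section

variable {R : Type} [Fintype R] [DecidableEq R]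

theorem Impl.of_circuit' {a : ℕ} {U : Op R} (c : Circuit R) (h : c.matrix = U) :
    Impl a c.length U := by
  have := Impl.of_circuit (a := a) (U := U) (c.map Function.Embedding.inr) (by
    rw [Circuit.matrix_map, h]; rfl)
  rwa [Circuit.length_map] at this

/-- The carry bit of the sum of three bits. -/
def carry (x y z : Fin 2) : Fin 2 := x * y + y * z + x * z

theorem full_adder (x y z : Fin 2) :
    ((x + y + z : Fin 2) : ℕ) + 2 * (carry x y z : ℕ) = x + y + z := by
  revert x y z; decide

/-- The carry may be recomputed after the first summand has been replaced by the digit of the sum.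
-/
theorem carry_complement (x y z : Fin 2) : carry (x + y + z + 1) y z = carry x y z := by
  revert x y z; decide

variable {k : ℕ}

/-- Addition of the number with binary digits `c`, modulo `2 ^ n`. -/
def addBits {n : ℕ} (c y : Fin n → Fin 2) : Fin n → Fin 2 :=
  finFunctionFinEquiv.symm (finFunctionFinEquiv y + finFunctionFinEquiv c)

/-- The carries of the addition of `c`, from a register read through `b`. -/
abbrev carries {Q : Type} (b : ℕ → Q) (c : Fin (k + 1) → Fin 2) (y : Q → Fin 2) (j : ℕ) : Fin 2 :=
  autoState b (fun j x s => carry x (c (Fin.ofNat (k + 1) j)) s) y j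

theorem sum_add_carries {Q : Type} (b : ℕ → Q) (c : Fin (k + 1) → Fin 2) (y : Q → Fin 2) (j : ℕ) :
    ∑ i ∈ Finset.range j,
        ((y (b i) + c (Fin.ofNat (k + 1) i) + carries b c y i : Fin 2) : ℕ) * 2 ^ i +
      (carries b c y j : ℕ) * 2 ^ j =
    ∑ i ∈ Finset.range j, (y (b i) : ℕ) * 2 ^ i +
      ∑ i ∈ Finset.range j, (c (Fin.ofNat (k + 1) i) : ℕ) * 2 ^ i := by
  induction j with
  | zero => simp [autoState]
  | succ j ih =>
    rw [Finset.sum_range_succ, Finset.sum_range_succ, Finset.sum_range_succ, pow_succ]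
    have h := full_adder (y (b j)) (c (Fin.ofNat (k + 1) j)) (carries b c y j)
    have h2 : carries b c y (j + 1) =
      carry (y (b j)) (c (Fin.ofNat (k + 1) j)) (carries b c y j) := rfl
    rw [h2]
    have h3 := congrArg (· * 2 ^ j) h
    simp only [add_mul] at h3
    linarith

theorem ofNat_val (i : Fin (k + 1)) : Fin.ofNat (k + 1) i.val = i := by
  ext; simp [Fin.ofNat, Nat.mod_eq_of_lt i.2]

theorem addBits_eq (c y : Fin (k + 1) → Fin 2) :
    addBits c y = fun i => y i + c i + carries (Fin.ofNat (k + 1)) c y i := by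
  rw [addBits, Equiv.symm_apply_eq]
  apply Fin.ext
  rw [Fin.val_add]
  change (bitsVal y + bitsVal c) % 2 ^ (k + 1) = bitsVal _
  refine Eq.trans ?_ (Nat.mod_eq_of_lt (bitsVal_lt _))
  have h := sum_add_carries (Fin.ofNat (k + 1)) c y (k + 1)
  simp only [Finset.sum_range, ofNat_val] at h
  rw [bitsVal_eq_sum y, bitsVal_eq_sum c, ← h, Nat.add_mul_mod_self_right, bitsVal_eq_sum]

/-- The carries are computed into clean qubits, the digits are added, and the carries are
uncomputed from the sum and the constant. -/
theorem impl_addBits (k : ℕ) (c : Fin (k + 1) → Fin 2) :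
    Impl (k + 1) (90 * (k + 1)) (permOp (addBits c)) := by
  let Q := Fin (k + 1) ⊕ Fin (k + 1)
  let b : ℕ → Q := fun j => Sum.inr (Fin.ofNat (k + 1) j)
  let d : ℕ → Q := fun j => Sum.inl (Fin.ofNat (k + 1) j)
  have hof : ∀ i j : ℕ, i ≤ k → j ≤ k → Fin.ofNat (k + 1) i = Fin.ofNat (k + 1) j → i = j := by
    intro i j hi hj h
    have := congrArg Fin.val h
    simpa [Fin.ofNat, Nat.mod_eq_of_lt (Nat.lt_succ_of_le hi),
      Nat.mod_eq_of_lt (Nat.lt_succ_of_le hj)] using this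
  have hd : ∀ i j, i ≤ k → j ≤ k → d i = d j → i = j :=
    fun i j hi hj h => hof i j hi hj (Sum.inl_injective h)
  have hbd : ∀ i j, i < k → j ≤ k → b i ≠ d j := fun i j _ _ => Sum.inr_ne_inl
  let δ : ℕ → Fin 2 → Fin 2 → Fin 2 := fun j x s => carry x (c (Fin.ofNat (k + 1) j)) s
  let δ' : ℕ → Fin 2 → Fin 2 → Fin 2 := fun j x s => carry (x + 1) (c (Fin.ofNat (k + 1) j)) s
  obtain ⟨C₁, hC₁, eC₁⟩ := exists_circuit_ladder b d δ k hd hbd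
  obtain ⟨C₃, hC₃, eC₃⟩ := exists_circuit_ladder b d δ' k hd hbd
  let μ : ℕ → (Q → Fin 2) → Q → Fin 2 := fun t y => Sum.elim (y ∘ Sum.inl) fun j =>
    if j.val < t then y (Sum.inr j) + c j + y (Sum.inl j) else y (Sum.inr j)
  obtain ⟨C₂, hC₂, eC₂⟩ : ∃ C : Circuit Q, C.length ≤ 2 * (k + 1) ∧
      C.matrix = permOp (μ (k + 1)) := by
    suffices h : ∀ t ≤ k + 1, ∃ C : Circuit Q, C.length ≤ 2 * t ∧ C.matrix = permOp (μ t) from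
      h _ le_rfl
    intro t
    induction t with
    | zero =>
      intro _
      refine ⟨[], by simp, ?_⟩
      rw [Circuit.matrix_nil, one_eq_mono]
      congr 1
      funext y q
      rcases q with q | q <;> simp [μ]
    | succ t ih =>
      intro ht
      obtain ⟨C, hC, eC⟩ := ih (by omega)
      obtain ⟨C', hC', eC'⟩ := exists_circuit_xor_bit (Q := Q)
        (a := Sum.inl ⟨t, ht⟩) (t := Sum.inr ⟨t, ht⟩) Sum.inl_ne_inr (fun x => c ⟨t, ht⟩ + x)
      refine ⟨C ++ C', by rw [List.length_append]; omega, ?_⟩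
      rw [Circuit.matrix_append, eC, eC', permOp_mul]
      congr 1
      funext y q
      rcases q with q | q
      · simp [xorMap, μ]
      · by_cases hq : q = ⟨t, ht⟩
        · subst hq
          simp [xorMap, μ, add_assoc]
        · have hq' : q.val ≠ t := fun h => hq (Fin.ext h)
          simp only [Function.comp_apply, xorMap, μ]
          rw [Function.update_of_ne fun h => hq (Sum.inr_injective h)]
          simp only [Sum.elim_inr]
          by_cases h : q.val < t
          · rw [if_pos h, if_pos (by omega)]
          · rw [if_neg h, if_neg (by omega)]
  have hI : Impl 0 (90 * (k + 1))
      (permOp (ladderMap b d δ' k ∘ μ (k + 1) ∘ ladderMap b d δ k)) := by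
    refine (Impl.of_circuit' (C₁ ++ (C₂ ++ C₃)) ?_).le
      (by simp only [List.length_append]; omega)
    rw [Circuit.matrix_append, Circuit.matrix_append, eC₁, eC₂, eC₃, permOp_mul, permOp_mul]
    rfl
  have h1 : ∀ y : Fin (k + 1) → Fin 2, ladderMap b d δ k (Sum.elim (0 : Fin (k + 1) → Fin 2) y) =
      Sum.elim (fun j : Fin (k + 1) => carries (Fin.ofNat (k + 1)) c y j) y := by
    intro y
    funext q
    have hs : ∀ j, autoState b δ (Sum.elim (0 : Fin (k + 1) → Fin 2) y) j =
        carries (Fin.ofNat (k + 1)) c y j := by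
      intro j
      induction j with
      | zero => rfl
      | succ j ih => rw [autoState, ih]; rfl
    rcases q with q | q
    · have := ladderMap_on (y := Sum.elim (0 : Fin (k + 1) → Fin 2) y) (b := b) (δ := δ) hd
        (Nat.le_of_lt_succ q.2)
      simp only [d, ofNat_val] at this
      rw [this, hs]
      simp
    · rw [ladderMap_off fun _ _ => Sum.inr_ne_inl]
      rfl
  have h3 : ∀ y : Fin (k + 1) → Fin 2,
      ladderMap b d δ' k (Sum.elim (fun j : Fin (k + 1) => carries (Fin.ofNat (k + 1)) c y j) (addBits c y)) =
        Sum.elim (0 : Fin (k + 1) → Fin 2) (addBits c y) := by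
    intro y
    funext q
    set z : Q → Fin 2 := Sum.elim (fun j : Fin (k + 1) => carries (Fin.ofNat (k + 1)) c y j) (addBits c y)
    have hs : ∀ j ≤ k, autoState b δ' z j = carries (Fin.ofNat (k + 1)) c y j := by
      intro j
      induction j with
      | zero => intro _; rfl
      | succ j ih =>
        intro hj
        have hv : (Fin.ofNat (k + 1) j).val = j := by
          simp [Fin.ofNat, Nat.mod_eq_of_lt (show j < k + 1 by omega)]
        rw [autoState, ih (by omega)]
        simp only [δ', z, b, Sum.elim_inr, addBits_eq, hv]
        rw [carry_complement]
        rfl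
    rcases q with q | q
    · have := ladderMap_on (y := z) (b := b) (δ := δ') hd (Nat.le_of_lt_succ q.2)
      simp only [d, ofNat_val] at this
      rw [this, hs _ (Nat.le_of_lt_succ q.2)]
      have h2 : ∀ x : Fin 2, x + x = 0 := by decide
      exact h2 _
    · rw [ladderMap_off fun _ _ => Sum.inr_ne_inl]
      rfl
  have hF : ∀ y : Fin (k + 1) → Fin 2, (ladderMap b d δ' k ∘ μ (k + 1) ∘ ladderMap b d δ k)
      (Sum.elim (0 : Fin (k + 1) → Fin 2) y) =
        Sum.elim (0 : Fin (k + 1) → Fin 2) (addBits c y) := by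
    intro y
    rw [← h3, Function.comp_apply, Function.comp_apply, h1]
    congr 1
    funext q
    rcases q with q | q
    · rfl
    · simp [μ, addBits_eq, q.2]
  have := hI.promote (b := k + 1) (U := permOp (addBits c)) (Fintype.card_fin _)
    (fun f x y => by
      simp only [mono, Matrix.of_apply]
      rw [hF]
      by_cases hf : f = 0
      · subst hf
        rw [if_pos rfl]
        exact if_congr (elim_eq_elim.trans (and_iff_right rfl)) rfl rfl
      · rw [if_neg hf, if_neg]
        exact fun h => hf (elim_eq_elim.1 h).1)
  rwa [zero_add] at this

end

/-! ### Linear combinations with complex coefficients -/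

section

variable {A S S' : Type} [Fintype A] [DecidableEq A] [Fintype S] [DecidableEq S]
  [Fintype S'] [DecidableEq S']

/-- A phase gate on any qubit is a global phase. -/
theorem BlockEnc.phase {a L : ℕ} {M : Op S} (h : BlockEnc a A L M) (q : S) (z : Circle) :
    BlockEnc a A (L + 1) ((z : ℂ) • M) := by
  obtain ⟨U, hU, hb⟩ := h
  refine ⟨_, hU.mul (Impl.gate a (Gate.single (Sum.inr q : A ⊕ S) (diagU z z))), fun x y => ?_⟩
  rw [Gate.matrix_single_diagU]
  simp only [ite_self, Matrix.mul_diagonal, Matrix.smul_apply, smul_eq_mul]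
  rw [hb, mul_comm]

/-- A linear combination, normalized by the sum `α` of the moduli of its coefficients. -/
theorem BlockEnc.linearCombination {T : Type} [Fintype T] {a r : ℕ}
    (hT : Fintype.card T ≤ 2 ^ r) (w : T → ℂ) {α : ℝ} (hα : 0 < α) (hsum : ∑ t, ‖w t‖ = α)
    {L : T → ℕ} {M : T → Op S} (hM : ∀ t, BlockEnc a A (L t) (M t)) (q : S)
    (hcard : r ≤ a + Fintype.card A + Fintype.card S) :
    BlockEnc (a + 1) (Fin r ⊕ A)
      (800 * (r + 1) * 2 ^ r + ∑ t, (2 * (176 * r + 2) + 20 * (L t + 1)))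
      (Matrix.of fun x y => (α : ℂ)⁻¹ * ∑ t, w t * M t x y) := by
  refine cast ?_ (BlockEnc.lcu hT (fun t => ‖w t‖) (fun t => norm_nonneg _) hα hsum
    (fun t => (hM t).phase q (Circle.exp (w t).arg)) hcard)
  congr 1
  ext x y
  simp only [Matrix.of_apply, Matrix.smul_apply, smul_eq_mul, Circle.coe_exp]
  congr 1
  refine Finset.sum_congr rfl fun t _ => ?_
  rw [← mul_assoc, Complex.norm_mul_exp_arg_mul_I]

theorem BlockEnc.extend {a L : ℕ} {M : Op S} (h : BlockEnc a A L M) (ι : S ↪ S') :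
    BlockEnc a A L (SchroPDE.emb ι M) := by
  obtain ⟨U, hU, hb⟩ := h
  let κ : A ⊕ S ↪ A ⊕ S' := Function.Embedding.sumMap (Function.Embedding.refl A) ι
  refine ⟨_, hU.emb κ, fun x y => ?_⟩
  have hc : ∀ x : S' → Fin 2, Sum.elim (0 : A → Fin 2) x ∘ κ =
      Sum.elim (0 : A → Fin 2) (x ∘ ι) := by
    intro x; funext q; rcases q with q | q <;> rfl
  by_cases hxy : ∀ q, q ∉ Set.range ι → x q = y q
  · rw [emb_apply_pos hxy, emb_apply_pos, hc, hc, hb]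
    rintro (q | q) hq
    · rfl
    · exact hxy q fun ⟨r, hr⟩ => hq ⟨Sum.inr r, congrArg Sum.inr hr⟩
  · rw [emb_apply_neg hxy, emb_apply_neg]
    refine fun h' => hxy fun q hq => h' (Sum.inr q) ?_
    rintro ⟨r | r, hr⟩
    · exact Sum.inl_ne_inr hr
    · exact hq ⟨r, Sum.inr_injective hr⟩

/-! ### The auxiliary coordinate -/

/-- The gate count of a diagonal operator that is affine in the number held by `n` qubits. -/
def affineCost (n r : ℕ) : ℕ :=
  800 * (r + 1) * 2 ^ r + (n + 1) * (2 * (176 * r + 2) + 40)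

/-- The operator `x - i`, for the coordinate `x` with range `[lo, hi]`: a combination of a phase and
of Pauli operators `Z`. -/
theorem blockEnc_coordinate_sub_I {n r : ℕ} (a : ℕ) (hn : 0 < n) (hr : n + 1 ≤ 2 ^ r)
    (hrn : r ≤ a + n) {lo hi : ℝ} (hlt : lo < hi) :
    BlockEnc (a + 1) (Fin r ⊕ Fin 0) (affineCost n r) (Matrix.diagonal fun y : Fin n → Fin 2 =>
      ((‖(((lo + hi) / 2 : ℝ) : ℂ) - Complex.I‖ + (hi - lo) / 2 : ℝ) : ℂ)⁻¹ *
        (((lo + (hi - lo) / (2 ^ n - 1) * bitsVal y : ℝ) : ℂ) - Complex.I)) := by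
  have h1 : (1 : ℝ) < 2 ^ n := one_lt_pow₀ (by norm_num) hn.ne'
  set mid : ℂ := (((lo + hi) / 2 : ℝ) : ℂ) - Complex.I with hmid
  let w : Option (Fin n) → ℂ := fun t => t.elim mid
    fun j => (((hi - lo) / 2 * ((2 : ℝ) ^ (j : ℕ) / (2 ^ n - 1)) : ℝ) : ℂ)
  let M : Option (Fin n) → Op (Fin n) := fun t => t.elim 1
    fun j => (Gate.single j (diagU (-1) 1)).matrix
  have hsum : ∑ t, ‖w t‖ = ‖mid‖ + (hi - lo) / 2 := by
    rw [Fintype.sum_option]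
    simp only [w, Option.elim]
    congr 1
    have : ∀ j : Fin n, ‖(((hi - lo) / 2 * ((2 : ℝ) ^ (j : ℕ) / (2 ^ n - 1)) : ℝ) : ℂ)‖ =
        (hi - lo) / 2 * ((2 : ℝ) ^ (j : ℕ) / (2 ^ n - 1)) := by
      intro j
      rw [Complex.norm_real, Real.norm_of_nonneg]
      exact mul_nonneg (by linarith) (div_nonneg (by positivity) (by linarith))
    rw [Finset.sum_congr rfl fun j _ => this j, ← Finset.mul_sum, ← Finset.sum_div, sum_two_pow,
      div_self (by linarith), mul_one]
  have hα : 0 < ‖mid‖ + (hi - lo) / 2 := by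
    have := norm_nonneg mid
    linarith
  have key := BlockEnc.linearCombination (A := Fin 0) (a := a) (T := Option (Fin n)) (r := r)
    (by simpa using hr) w hα hsum (L := fun _ => 1) (M := M)
    (fun t => by
      rcases t with _ | j
      · exact (Impl.one a).blockEnc.le (Nat.zero_le _)
      · exact (Impl.gate a (Gate.single j (diagU (-1) 1))).blockEnc)
    ⟨0, hn⟩ (by simpa using hrn)
  refine cast ?_ (key.le (L' := affineCost n r) ?_)
  · congr 1
    ext x y
    rw [Matrix.of_apply, Fintype.sum_option, Matrix.diagonal_apply]
    have hU : ∀ j : Fin n, (Gate.single j (diagU (-1) 1)).matrix =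
        (Matrix.diagonal fun y : Fin n → Fin 2 => if y j = 1 then (1 : ℂ) else -1) := by
      intro j; rw [Gate.matrix_single_diagU]; simp
    simp only [w, M, Option.elim, hU]
    split_ifs with hxy
    · subst hxy
      congr 1
      have h2 := unitCoord_bitsVal hn x
      have h3 : lo + (hi - lo) / (2 ^ n - 1) * bitsVal x =
          (lo + hi) / 2 + (hi - lo) / 2 * unitCoord n (bitsVal x) := by
        rw [unitCoord]; ring
      rw [h3, ← h2, Finset.mul_sum, Matrix.one_apply_eq, mul_one, hmid, Complex.ofReal_add,
        Complex.ofReal_sum, sub_add_eq_add_sub]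
      congr 2
      refine Finset.sum_congr rfl fun j _ => ?_
      rw [Matrix.diagonal_apply_eq]
      push_cast
      split_ifs <;> simp
    · rw [Matrix.one_apply_ne hxy, mul_zero, zero_add, Finset.sum_eq_zero, mul_zero]
      intro j _
      rw [Matrix.diagonal_apply_ne _ hxy, mul_zero]
  · rw [affineCost, Finset.sum_const, Finset.card_univ, Fintype.card_option, Fintype.card_fin,
      smul_eq_mul]

end

/-! ### Shifts of the grid and the two components of the Schrodingerised state -/

section

variable {A S : Type} [Fintype A] [DecidableEq A] [Fintype S] [DecidableEq S] {n : ℕ}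

theorem BlockEnc.mul_impl {a L L' : ℕ} {M V : Op S} (h : BlockEnc a A L M) (hV : Impl a L' V) :
    BlockEnc a A (L + L') (M * V) :=
  (h.mul (A' := Fin 0) hV.blockEnc).embed (Equiv.sumEmpty A (Fin 0)).toEmbedding

/-- The number of the grid point in a state of the component qubit and the position register. -/
def gridIdx (x : Unit ⊕ Fin n → Fin 2) : Fin (2 ^ n) := finFunctionFinEquiv (x ∘ Sum.inr)

theorem val_gridIdx (x : Unit ⊕ Fin n → Fin 2) : (gridIdx x : ℕ) = bitsVal (x ∘ Sum.inr) := rfl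

/-- The cyclic shift with nonzero entries at the positions `(i, i + e)`. -/
def shiftOp (e : Fin (2 ^ n)) : Op (Unit ⊕ Fin n) :=
  emb (Function.Embedding.inr : Fin n ↪ Unit ⊕ Fin n)
    (permOp (addBits (finFunctionFinEquiv.symm (-e))))

theorem shiftOp_apply (e : Fin (2 ^ n)) (x y : Unit ⊕ Fin n → Fin 2) :
    shiftOp e x y =
      if x (Sum.inl ()) = y (Sum.inl ()) ∧ gridIdx y = gridIdx x + e then 1 else 0 := by
  have h1 : (∀ q, q ∉ Set.range (Function.Embedding.inr : Fin n ↪ Unit ⊕ Fin n) → x q = y q) ↔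
      x (Sum.inl ()) = y (Sum.inl ()) := by
    constructor
    · intro h
      refine h _ ?_
      rintro ⟨r, hr⟩
      exact Sum.inr_ne_inl hr
    · rintro h (q | q) hq
      · exact h
      · exact absurd ⟨q, rfl⟩ hq
  have h2 : x ∘ (Function.Embedding.inr : Fin n ↪ Unit ⊕ Fin n) =
      addBits (finFunctionFinEquiv.symm (-e)) (y ∘ Function.Embedding.inr) ↔
      gridIdx y = gridIdx x + e := by
    rw [addBits, Equiv.eq_symm_apply, Equiv.apply_symm_apply, ← sub_eq_add_neg, eq_sub_iff_add_eq,
      eq_comm]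
    rfl
  rw [shiftOp]
  by_cases h : x (Sum.inl ()) = y (Sum.inl ())
  · rw [emb_apply_pos (h1.2 h)]
    simp only [mono, Matrix.of_apply, h2, h, true_and, Pi.one_apply]
  · rw [emb_apply_neg fun h' => h (h1.1 h'), if_neg fun h' => h h'.1]

theorem impl_shiftOp (hn : 0 < n) (e : Fin (2 ^ n)) : Impl n (90 * n) (shiftOp e) := by
  obtain ⟨k, rfl⟩ : ∃ k, n = k + 1 := ⟨n - 1, by omega⟩
  exact (impl_addBits k _).emb _

/-- The Pauli operator `X` on the component qubit. -/
def flipOp : Op (Unit ⊕ Fin n) := (Gate.single (Sum.inl () : Unit ⊕ Fin n) pauliX).matrix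

theorem flipOp_apply (x y : Unit ⊕ Fin n → Fin 2) :
    flipOp x y = if x (Sum.inl ()) ≠ y (Sum.inl ()) ∧ gridIdx y = gridIdx x then 1 else 0 := by
  have h1 : (∀ r : Unit ⊕ Fin n, r ≠ Sum.inl () → x r = y r) ↔ gridIdx y = gridIdx x := by
    rw [gridIdx, gridIdx, finFunctionFinEquiv.injective.eq_iff]
    constructor
    · intro h; funext q; exact (h _ Sum.inr_ne_inl).symm
    · rintro h (q | q) hq
      · exact absurd rfl hq
      · exact (congrFun h q).symm
  rw [flipOp]
  simp only [Gate.matrix, Matrix.of_apply, h1]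
  by_cases h : gridIdx y = gridIdx x
  · rw [if_pos h]
    have key : ∀ a b : Fin 2, (pauliX : Matrix (Fin 2) (Fin 2) ℂ) a b = if a ≠ b then 1 else 0 := by
      intro a b; fin_cases a <;> fin_cases b <;> simp [pauliX]
    rw [key]
    simp only [h, and_true]
  · rw [if_neg h, if_neg fun h' => h h'.2]

/-- The projector onto the first component. -/
theorem blockEnc_zero_projector (a : ℕ) (q : S) :
    BlockEnc a Unit 1 (Matrix.diagonal fun y => if y q = 0 then 1 else 0 : Op S) := by
  refine ⟨_, Impl.gate a (Gate.cnot (Sum.inr q) (Sum.inl ()) Sum.inr_ne_inl), fun x y => ?_⟩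
  rw [Gate.matrix_cnot, Matrix.diagonal_apply]
  have h : Sum.elim (0 : Unit → Fin 2) x =
      xorMap (Sum.inl () : Unit ⊕ S) (fun z => z (Sum.inr q)) (Sum.elim 0 y) ↔
      x = y ∧ y q = 0 := by
    constructor
    · intro h
      have h0 := congrFun h (Sum.inl ())
      refine ⟨funext fun r => ?_, ?_⟩
      · have := congrFun h (Sum.inr r)
        simpa [xorMap] using this
      · simpa [xorMap] using h0.symm
    · rintro ⟨rfl, h⟩
      funext r
      rcases r with r | r <;> simp [xorMap, h]
  have e : permOp (fun y : Unit ⊕ S → Fin 2 =>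
      Function.update y (Sum.inl ()) (y (Sum.inl ()) + y (Sum.inr q)))
      (Sum.elim (0 : Unit → Fin 2) x) (Sum.elim 0 y) = if x = y ∧ y q = 0 then (1 : ℂ) else 0 :=
    if_congr h rfl rfl
  refine e.trans ?_
  by_cases hxy : x = y
  · subst hxy; simp
  · simp [hxy]

end

/-! ### Finite-difference stencils -/

/-- A stencil of `2 w + 1` points is consistent only with derivatives of order at most `2 w`, as
its moments determine it. -/
theorem FDScheme.order_le {w p : ℕ} (s : FDScheme w p) : p ≤ 2 * w := by
  by_contra! hp
  have hsum : ∀ q : ℕ, ∑ j : Fin (2 * w + 1), s.stencil ((j : ℤ) - w) * (((j : ℤ) - w : ℤ) : ℝ) ^ q =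
      ∑ m ∈ Finset.Icc (-(w : ℤ)) (w : ℤ), s.stencil m * (m : ℝ) ^ q := by
    intro q
    refine Finset.sum_bij (fun j _ => (j : ℤ) - w) (fun j _ => ?_) (fun i _ j _ h => ?_)
      (fun m hm => ?_) (fun _ _ => rfl)
    · rw [Finset.mem_Icc]; have := j.2; omega
    · apply Fin.ext; omega
    · rw [Finset.mem_Icc] at hm
      exact ⟨⟨(m + w).toNat, by omega⟩, Finset.mem_univ _, by simp; omega⟩
  have hz := Matrix.eq_zero_of_forall_pow_sum_mul_pow_eq_zero
    (f := fun j : Fin (2 * w + 1) => (((j : ℤ) - w : ℤ) : ℝ))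
    (v := fun j : Fin (2 * w + 1) => s.stencil ((j : ℤ) - w))
    (fun i j h => by
      have h' : ((i : ℤ) - w : ℤ) = (j : ℤ) - w := Int.cast_injective h
      apply Fin.ext; omega)
    (fun i => by
      have := s.consistent i.val (by have := i.2; omega)
      rw [if_neg (by have := i.2; omega), ← hsum] at this
      exact this)
  have := s.consistent p le_rfl
  rw [if_pos rfl, ← hsum] at this
  rw [Finset.sum_eq_zero fun j _ => by rw [show s.stencil ((j : ℤ) - w) = 0 from congrFun hz j,
    zero_mul]] at this
  exact (Nat.cast_ne_zero (R := ℝ)).2 (Nat.factorial_ne_zero p) this.symm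

section

variable {ι κ : Type*} [Finite ι] [Finite κ]

theorem le_maxNorm (M : Matrix ι κ ℂ) (i : ι) (j : κ) : ‖M i j‖ ≤ maxNorm M :=
  le_ciSup (f := fun p : ι × κ => ‖M p.1 p.2‖) (Set.finite_range _).bddAbove (i, j)

theorem maxNorm_nonneg (M : Matrix ι κ ℂ) : 0 ≤ maxNorm M :=
  Real.iSup_nonneg fun _ => norm_nonneg _

end

namespace DiscretizedPDE

variable (P : DiscretizedPDE) {n : ℕ}

theorem eta_le : P.η ≤ 2 * P.w + 1 := by
  have := Fintype.card_le_of_injective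
    (fun k => (⟨P.p k, Nat.lt_succ_of_le (P.scheme k).order_le⟩ : Fin (2 * P.w + 1)))
    (fun i j h => P.p_injective (Fin.ext_iff.1 h))
  simpa using this

theorem dx_pos (hn : 0 < n) : 0 < P.dx n := by
  have h1 : (1 : ℝ) < 2 ^ n := one_lt_pow₀ (by norm_num) hn.ne'
  exact div_pos (sub_pos.2 P.a_lt_b) (by linarith)

theorem grid_mem (hn : 0 < n) (i : Fin (2 ^ n)) : P.grid n i ∈ Set.Icc P.a P.b := by
  have h1 : (1 : ℝ) < 2 ^ n := one_lt_pow₀ (by norm_num) hn.ne'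
  have h2 : (i.val : ℝ) ≤ 2 ^ n - 1 := by
    have : i.val + 1 ≤ 2 ^ n := i.2
    have : ((i.val + 1 : ℕ) : ℝ) ≤ ((2 ^ n : ℕ) : ℝ) := Nat.cast_le.2 this
    push_cast at this
    linarith
  have h3 : (2 ^ n - 1) * P.dx n = P.b - P.a := mul_div_cancel₀ _ (by linarith)
  have h4 := P.dx_pos hn
  have h5 : (0 : ℝ) ≤ i.val := Nat.cast_nonneg _
  rw [grid]
  constructor <;> nlinarith

/-- The grid points at which every derivative is discretized by its stencil. -/
def Bulk (i : Fin (2 ^ n)) : Prop := P.w ≤ i.val ∧ i.val + P.w < 2 ^ n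

/-- The cyclic diagonals reached by the stencils. -/
def Near (e : Fin (2 ^ n)) : Prop := e.val ≤ P.w ∨ 2 ^ n ≤ e.val + P.w

/-- The position in the stencil of a cyclic diagonal. -/
def offset (e : Fin (2 ^ n)) : ℤ := if e.val ≤ P.w then e.val else (e.val : ℤ) - (2 : ℤ) ^ n

theorem offset_eq_or (e : Fin (2 ^ n)) :
    e.val ≤ P.w ∧ P.offset e = e.val ∨
      P.w < e.val ∧ P.offset e = (e.val : ℤ) - ((2 ^ n : ℕ) : ℤ) := by
  unfold offset
  split_ifs with h
  · exact Or.inl ⟨h, rfl⟩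
  · exact Or.inr ⟨not_le.1 h, by push_cast; rfl⟩

theorem abs_offset_le {e : Fin (2 ^ n)} (he : P.Near e) : |P.offset e| ≤ P.w := by
  have := e.2
  rw [abs_le]
  rcases P.offset_eq_or e with ⟨h, h'⟩ | ⟨h, h'⟩ <;> rcases he with he | he <;> omega

theorem val_add_eq_or (i e : Fin (2 ^ n)) :
    (i + e).val = i.val + e.val ∨
      (2 ^ n ≤ i.val + e.val ∧ (i + e).val + 2 ^ n = i.val + e.val) := by
  rw [Fin.val_add]
  have hi := i.2
  have he := e.2
  rcases lt_or_ge (i.val + e.val) (2 ^ n) with h | h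
  · exact Or.inl (Nat.mod_eq_of_lt h)
  · right
    rw [Nat.mod_eq_sub_mod h, Nat.mod_eq_of_lt (by omega)]
    omega

theorem add_sub_eq_offset {i e : Fin (2 ^ n)} (hi : P.Bulk i) (he : P.Near e) :
    ((i + e : Fin (2 ^ n)) : ℤ) - (i : ℤ) = P.offset e := by
  have h1 := e.2
  have h2 := i.2
  have h3 := (i + e).2
  obtain ⟨h4, h5⟩ := hi
  rcases P.offset_eq_or e with ⟨h, h'⟩ | ⟨h, h'⟩ <;> rcases he with he | he <;>
    rcases val_add_eq_or i e with h6 | h6 <;> omega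

theorem lt_abs_add_sub {i e : Fin (2 ^ n)} (he : ¬ P.Near e) :
    ¬ |((i + e : Fin (2 ^ n)) : ℤ) - (i : ℤ)| ≤ P.w := by
  have h1 := e.2
  have h2 := i.2
  have h3 := (i + e).2
  unfold Near at he
  rw [abs_le]
  rcases val_add_eq_or i e with h6 | h6 <;> omega

theorem coeff_bulk (k : Fin P.η) {i e : Fin (2 ^ n)} (hi : P.Bulk i) [Decidable (P.Near e)] :
    (P.scheme k).coeff n i (i + e) =
      if P.Near e then ((P.scheme k).stencil (P.offset e) : ℂ) else 0 := by
  rw [(P.scheme k).bulk n i _ hi.1 hi.2]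
  split_ifs with h1 h2 h2
  · rw [P.add_sub_eq_offset hi h2]
  · exact absurd h1 (P.lt_abs_add_sub h2)
  · exact absurd (P.add_sub_eq_offset hi h2 ▸ P.abs_offset_le h2) h1
  · rfl

theorem Ak_apply (k : Fin P.η) (i j : Fin (2 ^ n)) :
    P.Ak n k i j = (P.f k).eval (P.grid n i) * P.D n k i j := by
  simp only [Ak, D, Matrix.of_apply]
  ring

theorem A_apply (i j : Fin (2 ^ n)) : P.A n i j = ∑ k, P.Ak n k i j := by
  rw [A, Matrix.sum_apply]

/-- The common bound `∑_k 𝒩_{f_k} ‖D_k‖_max` on the entries of `A`. -/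
def coeffScale (n : ℕ) : ℝ := ∑ k, (P.f k).normalization * maxNorm (P.D n k)

theorem coeffScale_nonneg (n : ℕ) : 0 ≤ P.coeffScale n :=
  Finset.sum_nonneg fun k _ => mul_nonneg (P.f k).normalization_nonneg (maxNorm_nonneg _)

theorem norm_A_le (hn : 0 < n) (i j : Fin (2 ^ n)) : ‖P.A n i j‖ ≤ P.coeffScale n := by
  rw [A_apply]
  refine (norm_sum_le _ _).trans (Finset.sum_le_sum fun k _ => ?_)
  rw [Ak_apply, norm_mul]
  exact mul_le_mul ((P.f k).norm_eval_le (P.grid_mem hn i)) (le_maxNorm _ _ _) (norm_nonneg _)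
    (P.f k).normalization_nonneg

theorem stencil_le_maxNorm (hn : 0 < n) (hw : 2 * P.w < 2 ^ n) (k : Fin P.η) {e : Fin (2 ^ n)}
    (he : P.Near e) : |(P.scheme k).stencil (P.offset e)| / P.dx n ^ P.p k ≤ maxNorm (P.D n k) := by
  classical
  have hb : P.Bulk (⟨P.w, by omega⟩ : Fin (2 ^ n)) :=
    ⟨le_rfl, show P.w + P.w < 2 ^ n by omega⟩
  have h := le_maxNorm (P.D n k) ⟨P.w, by omega⟩ (⟨P.w, by omega⟩ + e)
  rw [D, Matrix.of_apply, P.coeff_bulk k hb, if_pos he, norm_div, norm_pow, Complex.norm_real,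
    Complex.norm_real, Real.norm_eq_abs, Real.norm_of_nonneg (P.dx_pos hn).le] at h
  exact h

open Classical in
/-- The nonzero cyclic diagonals of `A`. -/
def diagonals (n : ℕ) : Finset (Fin (2 ^ n)) :=
  Finset.univ.filter fun e => ∃ i, P.A n i (i + e) ≠ 0

open Classical in
/-- The nonzero cyclic diagonals of `A` reached by the stencils. -/
def nearDiagonals (n : ℕ) : Finset (Fin (2 ^ n)) := (P.diagonals n).filter P.Near

open Classical in
theorem card_nearDiagonals_le_diagonals : (P.nearDiagonals n).card ≤ (P.diagonals n).card :=
  Finset.card_filter_le _ _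

open Classical in
theorem card_nearDiagonals_le : (P.nearDiagonals n).card ≤ 2 * P.w + 1 := by
  have h : (P.nearDiagonals n).card ≤ (Finset.Icc (-(P.w : ℤ)) P.w).card := by
    refine Finset.card_le_card_of_injOn P.offset (fun e he => ?_) fun e he e' he' h => ?_
    · rw [Finset.coe_Icc, Set.mem_Icc, ← abs_le]
      exact P.abs_offset_le (Finset.mem_filter.1 he).2
    · have h1 := e.2
      have h2 := e'.2
      apply Fin.ext
      rcases P.offset_eq_or e with h3 | h3 <;> rcases P.offset_eq_or e' with h4 | h4 <;> omega
  rw [Int.card_Icc] at h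
  omega

open Classical in
theorem card_boundary_le : (Finset.univ.filter fun i : Fin (2 ^ n) => ¬ P.Bulk i).card ≤
    2 * P.w := by
  have h : ((Finset.univ.filter fun i : Fin (2 ^ n) => ¬ P.Bulk i).map Fin.valEmbedding) ⊆
      Finset.range P.w ∪ Finset.Ico (2 ^ n - P.w) (2 ^ n) := by
    intro x hx
    rw [Finset.mem_map] at hx
    obtain ⟨i, hi, rfl⟩ := hx
    have h1 := (Finset.mem_filter.1 hi).2
    have h2 := i.2
    rw [Finset.mem_union, Finset.mem_range, Finset.mem_Ico]
    unfold Bulk at h1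
    simp only [Fin.valEmbedding_apply]
    omega
  have h2 := (Finset.card_le_card h).trans (Finset.card_union_le _ _)
  rw [Finset.card_map, Finset.card_range, Nat.card_Ico] at h2
  omega

end DiscretizedPDE

/-! ### The block-encoding of the inhomogeneous generator -/

namespace DiscretizedPDE

variable (P : DiscretizedPDE) {n m r : ℕ}

/-- The summands into which the generator is split: for each cyclic diagonal near the main one and
each derivative, the bulk rows; for each nonzero cyclic diagonal, the boundary rows; and the source
term (`true`) and its boundary correction (`false`). -/
abbrev Term (n : ℕ) : Type :=
  (↥(P.nearDiagonals n) × Fin P.η) ⊕ (↥(P.diagonals n) ⊕ Bool)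

/-- The largest boundary correction. -/
def corrMax (n : ℕ) : ℝ := ⨆ i, ‖P.vCorr n i‖

theorem corrMax_nonneg (n : ℕ) : 0 ≤ P.corrMax n := Real.iSup_nonneg fun _ => norm_nonneg _

theorem norm_vCorr_le (i : Fin (2 ^ n)) : ‖P.vCorr n i‖ ≤ P.corrMax n :=
  le_ciSup (f := fun i => ‖P.vCorr n i‖) (Set.finite_range _).bddAbove i

/-- The coefficients of the summands. -/
def weight (n : ℕ) : P.Term n → ℂ
  | .inl (e, k) => ((2 * (P.f k).normalization *
      ((P.scheme k).stencil (P.offset e.1) / P.dx n ^ P.p k) : ℝ) : ℂ)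
  | .inr (.inl _) => (P.coeffScale n : ℂ)
  | .inr (.inr true) => ((Real.sqrt (2 ^ n) * (2 * P.v.normalization) : ℝ) : ℂ)
  | .inr (.inr false) => ((Real.sqrt (2 ^ n) * P.corrMax n : ℝ) : ℂ)

open Classical in
/-- The entries of the diagonal factors of the summands. -/
def termDiag (n : ℕ) : P.Term n → Fin (2 ^ n) → ℂ
  | .inl (_, k), i => (if P.Bulk i then 1 else 0) *
      (((2 * (P.f k).normalization : ℝ) : ℂ)⁻¹ * (P.f k).eval (P.grid n i))
  | .inr (.inl e), i => if P.Bulk i then 0 else (P.coeffScale n : ℂ)⁻¹ * P.A n i (i + e.1)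
  | .inr (.inr true), i => ((2 * P.v.normalization : ℝ) : ℂ)⁻¹ * P.v.eval (P.grid n i)
  | .inr (.inr false), i => (P.corrMax n : ℂ)⁻¹ * P.vCorr n i

/-- The permutation factors of the summands. -/
def termPerm (n : ℕ) : P.Term n → Op (Unit ⊕ Fin n)
  | .inl (e, _) => shiftOp e.1
  | .inr (.inl e) => shiftOp e.1
  | .inr (.inr _) => flipOp

/-- The summands. -/
def term (n : ℕ) (t : P.Term n) : Op (Unit ⊕ Fin n) :=
  Matrix.diagonal (fun y => P.termDiag n t (gridIdx y)) * P.termPerm n t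

theorem term_apply (t : P.Term n) (x y : Unit ⊕ Fin n → Fin 2) :
    P.term n t x y = P.termDiag n t (gridIdx x) * P.termPerm n t x y := by
  rw [term, Matrix.diagonal_mul]

/-- The gate count of a piecewise polynomial of the position. -/
def _root_.SchroPDE.PiecewisePoly.cost {a b : ℝ} (f : PiecewisePoly a b) (n m : ℕ) : ℕ :=
  ∑ g, polyCost n m (f.poly g).natDegree

/-- The gate counts of the summands. -/
def termCost (n m : ℕ) : P.Term n → ℕ
  | .inl (_, k) => (352 * n + 25) + ((P.f k).cost n m + 1) + 90 * n
  | .inr (.inl _) => 2 * P.w * (352 * n + 44) + 1 + 90 * n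
  | .inr (.inr true) => P.v.cost n m + 1 + 1
  | .inr (.inr false) => 2 * P.w * (352 * n + 44) + 1 + 1

/-- The bound makes this hold for `N = 0` as well, where the inverse is zero. -/
theorem mul_inv_cancel_of_le {c N : ℝ} {z : ℂ} (h : ‖z‖ ≤ N) :
    ((c * (2 * N) : ℝ) : ℂ) * (((2 * N : ℝ) : ℂ)⁻¹ * z) = (c : ℂ) * z := by
  rcases eq_or_ne N 0 with rfl | h0
  · rw [norm_le_zero_iff.1 h]; simp
  · have : (N : ℂ) ≠ 0 := by exact_mod_cast h0
    push_cast
    field_simp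

theorem mul_inv_cancel_of_le' {c N : ℝ} {z : ℂ} (h : ‖z‖ ≤ N) :
    ((c * N : ℝ) : ℂ) * ((N : ℂ)⁻¹ * z) = (c : ℂ) * z := by
  rcases eq_or_ne N 0 with rfl | h0
  · rw [norm_le_zero_iff.1 h]; simp
  · have : (N : ℂ) ≠ 0 := by exact_mod_cast h0
    push_cast
    field_simp

open Classical in
theorem sum_bulk_terms (hn : 0 < n) (i e : Fin (2 ^ n)) (hi : P.Bulk i) (he : P.Near e) :
    ∑ k, ((2 * (P.f k).normalization *
      ((P.scheme k).stencil (P.offset e) / P.dx n ^ P.p k) : ℝ) : ℂ) *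
      (((2 * (P.f k).normalization : ℝ) : ℂ)⁻¹ * (P.f k).eval (P.grid n i)) =
    P.A n i (i + e) := by
  rw [A_apply]
  refine Finset.sum_congr rfl fun k _ => ?_
  rw [mul_comm (2 * (P.f k).normalization),
    mul_inv_cancel_of_le ((P.f k).norm_eval_le (P.grid_mem hn i)), Ak_apply, D, Matrix.of_apply,
    P.coeff_bulk k hi, if_pos he]
  push_cast
  ring

/-- The summands add up to `[A, B; B, A]`. -/
theorem sum_weight_term (hn : 0 < n) (x y : Unit ⊕ Fin n → Fin 2) :
    ∑ t, P.weight n t * P.term n t x y =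
      if x (Sum.inl ()) = y (Sum.inl ()) then P.A n (gridIdx x) (gridIdx y)
      else P.B n (gridIdx x) (gridIdx y) := by
  classical
  simp only [term_apply]
  rw [Fintype.sum_sum_type, Fintype.sum_sum_type, Fintype.sum_prod_type, Fintype.sum_bool]
  simp only [termPerm, shiftOp_apply, flipOp_apply]
  set i := gridIdx x with hi
  set j := gridIdx y with hj
  by_cases hxy : x (Sum.inl ()) = y (Sum.inl ())
  · simp only [hxy, true_and, ne_eq, not_true_eq_false, false_and, if_false, mul_zero, add_zero,
      if_true]
    have hje : ∀ e : Fin (2 ^ n), j = i + e ↔ e = j - i := by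
      intro e; rw [eq_sub_iff_add_eq', eq_comm]
    simp only [hje]
    have hij : i + (j - i) = j := by rw [add_sub_cancel]
    by_cases hD : j - i ∈ P.diagonals n
    · have s2 : ∑ e : ↥(P.diagonals n), P.weight n (.inr (.inl e)) *
          (P.termDiag n (.inr (.inl e)) i * if e.1 = j - i then 1 else 0) =
          if P.Bulk i then 0 else P.A n i j := by
        rw [Finset.sum_eq_single ⟨j - i, hD⟩]
        · simp only [weight, termDiag, if_true, mul_one, hij]
          split_ifs
          · rw [mul_zero]
          · have := mul_inv_cancel_of_le' (c := 1) (P.norm_A_le hn i j)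
            simpa using this
        · intro e _ he
          rw [if_neg fun h => he (Subtype.ext h), mul_zero, mul_zero]
        · simp
      have s1 : ∑ e : ↥(P.nearDiagonals n), ∑ k, P.weight n (.inl (e, k)) *
          (P.termDiag n (.inl (e, k)) i * if e.1 = j - i then 1 else 0) =
          if P.Bulk i then P.A n i j else 0 := by
        by_cases hb : P.Bulk i
        · rw [if_pos hb]
          by_cases hN : P.Near (j - i)
          · rw [Finset.sum_eq_single ⟨j - i, Finset.mem_filter.2 ⟨hD, hN⟩⟩]
            · have hs := P.sum_bulk_terms hn i (j - i) hb hN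
              rw [hij] at hs
              rw [← hs]
              refine Finset.sum_congr rfl fun k _ => ?_
              simp only [weight, termDiag, if_true, mul_one, if_pos hb, one_mul]
            · intro e _ he
              refine Finset.sum_eq_zero fun k _ => ?_
              rw [if_neg fun h => he (Subtype.ext h), mul_zero, mul_zero]
            · simp
          · rw [Finset.sum_eq_zero]
            · rw [← hij, A_apply]
              refine (Finset.sum_eq_zero fun k _ => ?_).symm
              rw [Ak_apply, D, Matrix.of_apply, P.coeff_bulk k hb, if_neg hN, zero_div, mul_zero]
            · intro e _
              refine Finset.sum_eq_zero fun k _ => ?_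
              have he : e.1 ≠ j - i := fun h => hN (h ▸ (Finset.mem_filter.1 e.2).2)
              rw [if_neg he, mul_zero, mul_zero]
        · rw [if_neg hb]
          refine Finset.sum_eq_zero fun e _ => Finset.sum_eq_zero fun k _ => ?_
          simp only [termDiag, if_neg hb, zero_mul, mul_zero]
      rw [s1, s2]
      split_ifs <;> simp
    · rw [Finset.sum_eq_zero, Finset.sum_eq_zero, add_zero]
      · by_contra hA
        refine hD (Finset.mem_filter.2 ⟨Finset.mem_univ _, i, ?_⟩)
        rw [hij]
        exact Ne.symm hA
      · intro e _
        have he : e.1 ≠ j - i := fun h => hD (h ▸ e.2)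
        rw [if_neg he, mul_zero, mul_zero]
      · intro e _
        refine Finset.sum_eq_zero fun k _ => ?_
        have he : e.1 ≠ j - i := fun h => hD (h ▸ (Finset.mem_filter.1 e.2).1)
        rw [if_neg he, mul_zero, mul_zero]
  · simp only [hxy, false_and, if_false, mul_zero, Finset.sum_const_zero, zero_add, ne_eq,
      not_false_eq_true, true_and]
    simp only [B, Matrix.smul_apply, Matrix.diagonal_apply, smul_eq_mul, eq_comm (a := i)]
    by_cases hji : j = i
    · simp only [hji, if_true, weight, termDiag, mul_one]
      rw [mul_inv_cancel_of_le (P.v.norm_eval_le (P.grid_mem hn i)),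
        mul_inv_cancel_of_le' (P.norm_vCorr_le i), mul_add]
    · simp only [hji, if_false, mul_zero, add_zero]

/-- Each summand is a diagonal operator followed by a permutation. The comparisons of the position
act on `2 * n` qubits, of which `n + 1` are those of the system; the other `n - 1` are ancillas in
any state, and three more ancillas hold conditions. -/
theorem blockEnc_term (hn : 2 ≤ n) (hw : 2 * P.w < 2 ^ n) (hm : n ≤ 2 ^ m) (hmn : m ≤ n)
    (t : P.Term n) :
    BlockEnc (n + 2) (Unit ⊕ (Unit ⊕ Fin m)) (P.termCost n m t) (P.term n t) := by
  classical
  have hn0 : 0 < n := by omega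
  have hpoly : ∀ f : PiecewisePoly P.a P.b, BlockEnc (n + 2) (Unit ⊕ Fin m) (f.cost n m + 1)
      (Matrix.diagonal fun y => ((2 * f.normalization : ℝ) : ℂ)⁻¹ * f.eval (P.grid n (gridIdx y)) :
        Op (Unit ⊕ Fin n)) := by
    intro f
    have := blockEnc_piecewisePoly f P.a_lt_b (n - 1) (Sum.inr : Fin n → Unit ⊕ Fin n) hn0 hm
      (by simp; omega) hmn
    exact BlockEnc.mono this (by omega)
  have hsparse : ∀ d : Fin (2 ^ n) → ℂ, (∀ i, ‖d i‖ ≤ 1) → (∀ i, P.Bulk i → d i = 0) →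
      BlockEnc (n + 2) (Unit ⊕ (Unit ⊕ Fin m)) (2 * P.w * (352 * n + 44) + 1)
        (Matrix.diagonal fun y => d (gridIdx y) : Op (Unit ⊕ Fin n)) := by
    intro d hd h0
    have := blockEnc_sparse_diagonal (n - 1) () (Sum.inr : Fin n → Unit ⊕ Fin n)
      (Finset.univ.filter fun i : Fin (2 ^ n) => ¬ P.Bulk i) d hd
      (fun i hi => h0 i (by simpa using hi)) (by simp; omega)
    refine ((this.embed Function.Embedding.inl).mono (by omega)).le ?_
    have := P.card_boundary_le (n := n)
    gcongr
  rcases t with ⟨e, k⟩ | e | b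
  · have h1 := blockEnc_interval (n - 1) () (Sum.inr : Fin n → Unit ⊕ Fin n)
      (show P.w ≤ 2 ^ n - P.w by omega) (by simp; omega)
    have h2 := (h1.mono (show n - 1 + 1 ≤ n + 2 by omega)).mul (hpoly (P.f k))
    refine cast ?_ (h2.mul_impl ((impl_shiftOp hn0 e.1).mono (Nat.le_add_right n 2)))
    congr 1
    rw [Matrix.diagonal_mul_diagonal, term]
    congr 2
    funext y
    rw [termDiag]
    congr 1
    refine if_congr ?_ rfl rfl
    have := (gridIdx y).2
    rw [Bulk, val_gridIdx]
    omega
  · refine (hsparse _ (fun i => ?_) (fun i hi => ?_)).mul_impl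
      ((impl_shiftOp hn0 e.1).mono (Nat.le_add_right n 2))
    · rw [termDiag]
      split_ifs
      · simp
      · rw [norm_mul, norm_inv, Complex.norm_real, Real.norm_of_nonneg (P.coeffScale_nonneg n),
          inv_mul_eq_div]
        exact div_le_one_of_le₀ (P.norm_A_le hn0 _ _) (P.coeffScale_nonneg n)
    · rw [termDiag, if_pos hi]
  · have hX : Impl (n + 2) 1 (flipOp (n := n)) := Impl.gate _ _
    rcases b with _ | _
    · refine (hsparse _ (fun i => ?_) (fun i hi => ?_)).mul_impl hX
      · rw [termDiag, norm_mul, norm_inv, Complex.norm_real,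
          Real.norm_of_nonneg (P.corrMax_nonneg n), inv_mul_eq_div]
        exact div_le_one_of_le₀ (P.norm_vCorr_le i) (P.corrMax_nonneg n)
      · rw [termDiag, P.vCorr_bulk n i hi.1 hi.2, mul_zero]
    · exact ((hpoly P.v).embed Function.Embedding.inr).mul_impl hX

theorem card_term : Fintype.card (P.Term n) =
    (P.nearDiagonals n).card * P.η + ((P.diagonals n).card + 2) := by
  simp

/-- The normalization of the block-encoding of the generator. -/
def genNorm (n : ℕ) : ℝ := ∑ t, ‖P.weight n t‖

/-- Only diagonals that are nonzero in `A` contribute, each with at most three times the scale of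
the coefficients; the source contributes once. -/
theorem genNorm_le (hn : 0 < n) (hw : 2 * P.w < 2 ^ n) {κ : ℕ} (hκ : (P.diagonals n).card ≤ κ)
    (hκ1 : 1 ≤ κ) : P.genNorm n ≤ 3 * κ *
      (P.coeffScale n + Real.sqrt (2 ^ n) * (P.v.normalization + P.corrMax n)) := by
  classical
  have hκ' : ((P.diagonals n).card : ℝ) ≤ κ := Nat.cast_le.2 hκ
  have hκ1' : (1 : ℝ) ≤ κ := by exact_mod_cast hκ1
  have hN : ((P.nearDiagonals n).card : ℝ) ≤ κ :=
    Nat.cast_le.2 ((P.card_nearDiagonals_le_diagonals).trans hκ)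
  have h0 := P.coeffScale_nonneg n
  have h1 := P.corrMax_nonneg n
  have h2 := P.v.normalization_nonneg
  have h3 : 0 ≤ Real.sqrt (2 ^ n) := Real.sqrt_nonneg _
  rw [genNorm, Fintype.sum_sum_type, Fintype.sum_sum_type, Fintype.sum_prod_type,
    Fintype.sum_bool]
  have e1 : ∑ e : ↥(P.nearDiagonals n), ∑ k, ‖P.weight n (.inl (e, k))‖ ≤
      (P.nearDiagonals n).card * (2 * P.coeffScale n) := by
    refine (Finset.sum_le_card_nsmul _ _ (2 * P.coeffScale n) fun e _ => ?_).trans ?_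
    · rw [coeffScale, Finset.mul_sum]
      refine Finset.sum_le_sum fun k _ => ?_
      have hk := (P.f k).normalization_nonneg
      rw [weight, Complex.norm_real, Real.norm_eq_abs, abs_mul, abs_of_nonneg (by linarith),
        mul_assoc]
      refine mul_le_mul_of_nonneg_left (mul_le_mul_of_nonneg_left ?_ hk) (by norm_num)
      rw [abs_div, abs_of_pos (pow_pos (P.dx_pos hn) (P.p k))]
      exact P.stencil_le_maxNorm hn hw k (Finset.mem_filter.1 e.2).2
    · simp
  have e2 : ∑ e : ↥(P.diagonals n), ‖P.weight n (.inr (.inl e))‖ =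
      (P.diagonals n).card * P.coeffScale n := by
    simp [weight, abs_of_nonneg h0]
  have e3 : ‖P.weight n (.inr (.inr true))‖ = Real.sqrt (2 ^ n) * (2 * P.v.normalization) := by
    rw [weight, Complex.norm_real, Real.norm_of_nonneg (by positivity)]
  have e4 : ‖P.weight n (.inr (.inr false))‖ = Real.sqrt (2 ^ n) * P.corrMax n := by
    rw [weight, Complex.norm_real, Real.norm_of_nonneg (by positivity)]
  rw [e2, e3, e4]
  have e5 : (P.nearDiagonals n).card * (2 * P.coeffScale n) ≤ κ * (2 * P.coeffScale n) := by
    gcongr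
  have e6 : (P.diagonals n).card * P.coeffScale n ≤ κ * P.coeffScale n := by gcongr
  have e7 : 1 * (3 * (Real.sqrt (2 ^ n) * (P.v.normalization + P.corrMax n))) ≤
      κ * (3 * (Real.sqrt (2 ^ n) * (P.v.normalization + P.corrMax n))) := by gcongr
  have e8 := mul_nonneg h3 h2
  have e9 := mul_nonneg h3 h1
  nlinarith

/-- The gate count of the generator. -/
def genCost (n m r : ℕ) : ℕ :=
  1 + (800 * (r + 1) * 2 ^ r + ∑ t, (2 * (176 * r + 2) + 20 * (P.termCost n m t + 1)))

/-- The generator `[A, B; 0, 0]`, as an operator on the component qubit and the position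
register. -/
def gen (n : ℕ) : Op (Unit ⊕ Fin n) := Matrix.of fun x y =>
  if x (Sum.inl ()) = 0 then
    if y (Sum.inl ()) = 0 then P.A n (gridIdx x) (gridIdx y) else P.B n (gridIdx x) (gridIdx y)
  else 0

/-- The combination of the summands is `[A, B; B, A]`, and the projector onto the first component
removes its second row. -/
theorem blockEnc_gen (hn : 2 ≤ n) (hw : 2 * P.w < 2 ^ n) (hm : n ≤ 2 ^ m) (hmn : m ≤ n)
    (hT : (P.nearDiagonals n).card * P.η + ((P.diagonals n).card + 2) ≤ 2 ^ r)
    (hr : r ≤ 2 * n + 1) (hα : 0 < P.genNorm n) :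
    BlockEnc (n + 3) (Unit ⊕ (Fin r ⊕ (Unit ⊕ (Unit ⊕ Fin m)))) (P.genCost n m r)
      ((P.genNorm n : ℂ)⁻¹ • P.gen n) := by
  have h := BlockEnc.linearCombination (by rw [P.card_term]; exact hT) (P.weight n) hα rfl
    (P.blockEnc_term hn hw hm hmn) (Sum.inl ()) (by simp; omega)
  refine cast ?_ ((blockEnc_zero_projector (n + 3) (Sum.inl () : Unit ⊕ Fin n)).mul h)
  congr 1
  ext x y
  rw [Matrix.diagonal_mul, Matrix.of_apply, P.sum_weight_term (by omega), Matrix.smul_apply, gen,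
    Matrix.of_apply, smul_eq_mul]
  by_cases hx : x (Sum.inl ()) = 0
  · rw [if_pos hx, if_pos hx, one_mul, hx]
    simp only [eq_comm (a := (0 : Fin 2))]
  · rw [if_neg hx, if_neg hx, zero_mul, mul_zero]

end DiscretizedPDE

/-! ### The block-encoding of the Hamiltonian -/

/-- A block-encoding on named registers, read on qubits that are numbered from the least
significant one. -/
theorem BlockEnc.exists_circuit {a s m L : ℕ} {M : Matrix (Fin (2 ^ m)) (Fin (2 ^ m)) ℂ} {α : ℝ}
    (hα : 0 < α) (h : BlockEnc a (Fin s) L (Matrix.of fun x y : Fin m → Fin 2 =>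
      (α : ℂ)⁻¹ * M (finFunctionFinEquiv x) (finFunctionFinEquiv y))) :
    ∃ c : Circuit (Qubits a s m), IsBlockEncoding c.matrix M α 0 ∧ IsPureAncilla c.matrix ∧
      c.length ≤ L := by
  obtain ⟨U, ⟨c, hc, hL⟩, hb⟩ := h
  refine ⟨c, ⟨?_, hα.le, le_rfl, ?_, ?_⟩, ?_, hL⟩
  · rw [Matrix.mem_unitaryGroup_iff', Matrix.star_eq_conjTranspose]
    exact Circuit.conjTranspose_mul_self c
  · intro x j ⟨i, hi⟩
    have := hc (x ∘ Sum.inl) (x ∘ Sum.inr) (Sum.elim 0 (finFunctionFinEquiv.symm j))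
    rw [elim_comp_eq, if_neg fun h0 => hi (congrFun h0 i)] at this
    exact this
  · have h0 : M - (α : ℂ) • encodedBlock c.matrix = 0 := by
      ext i j
      have h1 := hc 0 (Sum.elim 0 (finFunctionFinEquiv.symm i))
        (Sum.elim 0 (finFunctionFinEquiv.symm j))
      rw [if_pos rfl, hb, Matrix.of_apply, Equiv.apply_symm_apply, Equiv.apply_symm_apply] at h1
      have h2 : encodedBlock c.matrix i j = (α : ℂ)⁻¹ * M i j := h1
      have hα' : (α : ℂ) ≠ 0 := by exact_mod_cast hα.ne'
      rw [Matrix.sub_apply, Matrix.smul_apply, h2, smul_eq_mul, mul_inv_cancel_left₀ hα', sub_self,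
        Matrix.zero_apply]
    rw [h0, map_zero, norm_zero]
  · intro x y hy ⟨i, hi⟩
    have := hc (x ∘ Sum.inl) (x ∘ Sum.inr) (y ∘ Sum.inr)
    have h0 : (0 : Fin a → Fin 2) = y ∘ Sum.inl := funext fun i => (hy i).symm
    rw [h0, elim_comp_eq, elim_comp_eq, ← h0, if_neg fun h0 => hi (congrFun h0 i)] at this
    exact this

theorem emb_diagonal {S S' : Type} [Fintype S] [DecidableEq S] [Fintype S'] [DecidableEq S']
    (ι : S ↪ S') (d : (S → Fin 2) → ℂ) :
    emb ι (Matrix.diagonal d) = Matrix.diagonal fun y => d (y ∘ ι) := by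
  ext x y
  by_cases hxy : x = y
  · subst hxy
    rw [emb_apply_pos fun _ _ => rfl, Matrix.diagonal_apply_eq, Matrix.diagonal_apply_eq]
  · rw [Matrix.diagonal_apply_ne _ hxy]
    by_cases h : ∀ q, q ∉ Set.range ι → x q = y q
    · rw [emb_apply_pos h, Matrix.diagonal_apply_ne]
      refine fun h' => hxy (funext fun q => ?_)
      by_cases hq : q ∈ Set.range ι
      · obtain ⟨r, rfl⟩ := hq; exact congrFun h' r
      · exact h q hq
    · rw [emb_apply_neg h]

namespace DiscretizedPDE

variable (P : DiscretizedPDE) {n m r nξ rξ : ℕ}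

/-- The generator `S = [A, B; 0, 0]`. -/
def S (n : ℕ) : Matrix (Fin (2 ^ n) ⊕ Fin (2 ^ n)) (Fin (2 ^ n) ⊕ Fin (2 ^ n)) ℂ :=
  Matrix.fromBlocks (P.A n) (P.B n) 0 0

/-- The points of the auxiliary coordinate. -/
def ξpt (nξ : ℕ) (l : Fin (2 ^ nξ)) : ℝ := P.aξ + (P.bξ - P.aξ) / (2 ^ nξ - 1) * (l.val : ℝ)

theorem inv_two_I : (1 / (2 * Complex.I) : ℂ) = -(Complex.I / 2) := by
  field_simp
  rw [Complex.I_sq]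
  ring

theorem S₁_apply (s s' : Fin (2 ^ n) ⊕ Fin (2 ^ n)) :
    P.S₁ n s s' = (1 / 2 : ℂ) * (P.S n s s' + star (P.S n s' s)) := by
  rcases s with s | s <;> rcases s' with s' | s' <;>
    (simp [S₁, S, Matrix.conjTranspose_apply]; try ring)

theorem S₂_apply (s s' : Fin (2 ^ n) ⊕ Fin (2 ^ n)) :
    P.S₂ n s s' = -(Complex.I / 2) * (P.S n s s' - star (P.S n s' s)) := by
  rw [← inv_two_I]
  rcases s with s | s <;> rcases s' with s' | s' <;> simp [S₂, S, Matrix.conjTranspose_apply]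

theorem H_apply_S (s s' : Fin (2 ^ n) ⊕ Fin (2 ^ n)) (l l' : Fin (2 ^ nξ)) :
    P.H n nξ (indexEquiv n nξ (s, l)) (indexEquiv n nξ (s', l')) =
      if l = l' then P.S₁ n s s' * (P.ξpt nξ l : ℂ) + P.S₂ n s s' else 0 := by
  rw [H, Matrix.reindex_apply, Matrix.submatrix_apply, Equiv.symm_apply_apply,
    Equiv.symm_apply_apply, Matrix.add_apply, Matrix.kroneckerMap_apply,
    Matrix.kroneckerMap_apply, xξ, Matrix.diagonal_apply, Matrix.one_apply]
  split_ifs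
  · rw [mul_one]; rfl
  · simp

/-- `H` is the Hermitian part of `S ⊗ (x - i)`. -/
theorem H_apply (s s' : Fin (2 ^ n) ⊕ Fin (2 ^ n)) (l l' : Fin (2 ^ nξ)) :
    P.H n nξ (indexEquiv n nξ (s, l)) (indexEquiv n nξ (s', l')) =
      if l = l' then (1 / 2 : ℂ) * (P.S n s s' * ((P.ξpt nξ l : ℂ) - Complex.I) +
        star (P.S n s' s * ((P.ξpt nξ l : ℂ) - Complex.I))) else 0 := by
  rw [H_apply_S, S₁_apply, S₂_apply]
  have h1 : star ((P.ξpt nξ l : ℂ) - Complex.I) = (P.ξpt nξ l : ℂ) + Complex.I := by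
    rw [star_sub, Complex.star_def, Complex.conj_ofReal, Complex.conj_I,
      sub_neg_eq_add]
  rw [star_mul', h1]
  split_ifs
  · ring
  · rfl

/-- The row of `S` of a state of the component qubit and the position register. -/
def comp (x : Unit ⊕ Fin n → Fin 2) : Fin (2 ^ n) ⊕ Fin (2 ^ n) :=
  if x (Sum.inl ()) = 0 then Sum.inl (gridIdx x) else Sum.inr (gridIdx x)

theorem gen_apply (x y : Unit ⊕ Fin n → Fin 2) : P.gen n x y = P.S n (comp x) (comp y) := by
  rw [gen, Matrix.of_apply, comp, comp]
  split_ifs <;> simp [S]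

/-- The order of the qubits of the system: the auxiliary register is the least significant one, the
component qubit is the most significant one. -/
def systemEquiv (n nξ : ℕ) : (Unit ⊕ Fin n) ⊕ Fin nξ ≃ Fin (n + 1 + nξ) :=
  (Equiv.sumComm _ _).trans ((Equiv.sumCongr (Equiv.refl _) ((Equiv.sumComm _ _).trans
    ((Equiv.sumCongr (Equiv.refl _) finOneEquiv.symm).trans finSumFinEquiv))).trans
      (finSumFinEquiv.trans (finCongr (by omega))))

/-- The tensor order of the Hamiltonian agrees with the numbering of the qubits. -/
theorem finFunctionFinEquiv_eq_indexEquiv (y : Fin (n + 1 + nξ) → Fin 2) :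
    finFunctionFinEquiv y = indexEquiv n nξ
      (comp (fun q => y (systemEquiv n nξ (Sum.inl q))),
        finFunctionFinEquiv fun q => y (systemEquiv n nξ (Sum.inr q))) := by
  apply Fin.ext
  change bitsVal y = _
  have hcomp : ((finSumFinEquiv (comp fun q => y (systemEquiv n nξ (Sum.inl q))) :
      Fin (2 ^ n + 2 ^ n)) : ℕ) =
      bitsVal (fun q : Fin n => y (systemEquiv n nξ (Sum.inl (Sum.inr q)))) +
        2 ^ n * (y (systemEquiv n nξ (Sum.inl (Sum.inl ()))) : ℕ) := by
    rw [comp]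
    split_ifs with h
    · rw [h]
      simp [val_gridIdx]
      rfl
    · rw [(fin2_cases _).resolve_left h]
      simp [val_gridIdx, add_comm]
      rfl
  have hval : ((indexEquiv n nξ
      (comp (fun q => y (systemEquiv n nξ (Sum.inl q))),
        finFunctionFinEquiv fun q => y (systemEquiv n nξ (Sum.inr q))) : Fin _) : ℕ) =
      bitsVal (fun q : Fin nξ => y (systemEquiv n nξ (Sum.inr q))) + 2 ^ nξ *
        ((finSumFinEquiv (comp fun q => y (systemEquiv n nξ (Sum.inl q))) :
          Fin (2 ^ n + 2 ^ n)) : ℕ) := rfl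
  rw [hval, hcomp, bitsVal_eq_sum, bitsVal_eq_sum, bitsVal_eq_sum, ← (systemEquiv n nξ).sum_comp,
    Fintype.sum_sum_type, Fintype.sum_sum_type, Fintype.sum_unique]
  have v1 : ∀ q : Fin nξ, ((systemEquiv n nξ (Sum.inr q) : Fin _) : ℕ) = q := fun q => rfl
  have v2 : ∀ q : Fin n, ((systemEquiv n nξ (Sum.inl (Sum.inr q)) : Fin _) : ℕ) = nξ + q :=
    fun q => rfl
  have v3 : ((systemEquiv n nξ (Sum.inl (Sum.inl ())) : Fin _) : ℕ) = nξ + n := rfl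
  simp only [v1, v2]
  rw [show (default : Unit) = () from rfl, v3, mul_add, Finset.mul_sum]
  have : ∀ q : Fin n, (y (systemEquiv n nξ (Sum.inl (Sum.inr q))) : ℕ) * 2 ^ (nξ + (q : ℕ)) =
      2 ^ nξ * ((y (systemEquiv n nξ (Sum.inl (Sum.inr q))) : ℕ) * 2 ^ (q : ℕ)) := by
    intro q; rw [pow_add]; ring
  rw [Finset.sum_congr rfl fun q _ => this q, pow_add]
  ring

/-- The normalization of the block-encoding of `x - i`. -/
def ξNorm : ℝ := ‖(((P.aξ + P.bξ) / 2 : ℝ) : ℂ) - Complex.I‖ + (P.bξ - P.aξ) / 2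

theorem ξNorm_pos : 0 < P.ξNorm := by
  have := P.aξ_lt_bξ
  have h := norm_nonneg ((((P.aξ + P.bξ) / 2 : ℝ) : ℂ) - Complex.I)
  rw [ξNorm]
  linarith

theorem ξNorm_le : P.ξNorm ≤ 1 + max |P.aξ| |P.bξ| := by
  have h1 := norm_sub_le (((P.aξ + P.bξ) / 2 : ℝ) : ℂ) Complex.I
  rw [Complex.norm_real, Complex.norm_I, Real.norm_eq_abs] at h1
  have h2 : |(P.aξ + P.bξ) / 2| + (P.bξ - P.aξ) / 2 ≤ max |P.aξ| |P.bξ| := by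
    have h3 := neg_abs_le P.aξ
    have h4 := le_abs_self P.bξ
    rcases abs_cases ((P.aξ + P.bξ) / 2) with ⟨h, -⟩ | ⟨h, -⟩
    · rw [h]; exact le_max_of_le_right (by linarith)
    · rw [h]; exact le_max_of_le_left (by linarith)
  rw [ξNorm]
  linarith

/-- The Hamiltonian is the mean of `S ⊗ (x - i)` and its adjoint, where `S = [A, B; 0, 0]`: a
linear combination of two block-encodings with the same normalization. -/
theorem blockEnc_H {s : ℕ} (hn : 2 ≤ n) (hnξ : 1 ≤ nξ) (hw : 2 * P.w < 2 ^ n) (hm : n ≤ 2 ^ m)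
    (hmn : m ≤ n)
    (hT : (P.nearDiagonals n).card * P.η + ((P.diagonals n).card + 2) ≤ 2 ^ r)
    (hr : r ≤ 2 * n + 1) (hα : 0 < P.genNorm n) (hξ : nξ + 1 ≤ 2 ^ rξ) (hξ' : rξ ≤ nξ)
    (hs : 4 + r + m + rξ ≤ s) :
    BlockEnc (2 * n + 2) (Fin s) (3912 + 40 * (P.genCost n m r + affineCost nξ rξ))
      (Matrix.of fun x y : Fin (n + 1 + nξ) → Fin 2 =>
        ((P.genNorm n * P.ξNorm : ℝ) : ℂ)⁻¹ *
          P.H n nξ (finFunctionFinEquiv x) (finFunctionFinEquiv y)) := by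
  have h1 := (P.blockEnc_gen hn hw hm hmn hT hr hα).extend
    (Function.Embedding.inl : Unit ⊕ Fin n ↪ (Unit ⊕ Fin n) ⊕ Fin nξ)
  have h2 := ((blockEnc_coordinate_sub_I 0 hnξ hξ (by omega) P.aξ_lt_bξ).extend
    (Function.Embedding.inr : Fin nξ ↪ (Unit ⊕ Fin n) ⊕ Fin nξ)).mono (show 0 + 1 ≤ n + 3 by omega)
  have h3 := h1.mul h2
  have h4 := BlockEnc.lcu (T := Bool) (r := 1) (by simp) (fun _ => 1 / 2) (fun _ => by norm_num)
    one_pos (by norm_num) (L := fun _ => P.genCost n m r + affineCost nξ rξ)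
    (M := fun b => if b then _ else _)
    (fun b => by
      cases b
      · exact h3
      · exact h3.conjTranspose) (by simp; omega)
  have hcard : Fintype.card (Fin 1 ⊕ ((Unit ⊕ (Fin r ⊕ (Unit ⊕ (Unit ⊕ Fin m)))) ⊕
      (Fin rξ ⊕ Fin 0))) ≤ Fintype.card (Fin s) := by
    simp; omega
  obtain ⟨ι⟩ := Function.Embedding.nonempty_of_card_le hcard
  have h5 := ((h4.map ι (systemEquiv n nξ)).mono (show n + 3 + 1 ≤ 2 * n + 2 by omega)).le
    (show _ ≤ 3912 + 40 * (P.genCost n m r + affineCost nξ rξ) by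
      rw [Fintype.sum_bool]; omega)
  refine cast ?_ h5
  congr 1
  ext x y
  -- the entries of `S ⊗ (x - i)`
  have hT : ∀ x y : (Unit ⊕ Fin n) ⊕ Fin nξ → Fin 2,
      (emb (Function.Embedding.inl : Unit ⊕ Fin n ↪ (Unit ⊕ Fin n) ⊕ Fin nξ)
        ((P.genNorm n : ℂ)⁻¹ • P.gen n) *
        emb (Function.Embedding.inr : Fin nξ ↪ (Unit ⊕ Fin n) ⊕ Fin nξ)
          (Matrix.diagonal fun y : Fin nξ → Fin 2 =>
            ((‖(((P.aξ + P.bξ) / 2 : ℝ) : ℂ) - Complex.I‖ + (P.bξ - P.aξ) / 2 : ℝ) : ℂ)⁻¹ *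
              (((P.aξ + (P.bξ - P.aξ) / (2 ^ nξ - 1) * bitsVal y : ℝ) : ℂ) - Complex.I))) x y =
      if finFunctionFinEquiv (x ∘ Sum.inr) = finFunctionFinEquiv (y ∘ Sum.inr) then
        ((P.genNorm n * P.ξNorm : ℝ) : ℂ)⁻¹ * (P.S n (comp (x ∘ Sum.inl)) (comp (y ∘ Sum.inl)) *
          ((P.ξpt nξ (finFunctionFinEquiv (y ∘ Sum.inr)) : ℂ) - Complex.I)) else 0 := by
    intro x y
    have hr : ∀ (u : Unit ⊕ Fin n → Fin 2) (v : Fin nξ → Fin 2), Sum.elim u v ∘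
        (Function.Embedding.inr : Fin nξ ↪ (Unit ⊕ Fin n) ⊕ Fin nξ) = v := fun _ _ => rfl
    rw [emb_diagonal, Matrix.mul_diagonal, ← elim_comp_eq x, ← elim_comp_eq y]
    erw [emb_inl_elim]
    simp only [finFunctionFinEquiv.injective.eq_iff, Sum.elim_comp_inr, Sum.elim_comp_inl, hr]
    split_ifs
    · rw [Matrix.smul_apply, gen_apply, smul_eq_mul]
      push_cast
      rw [mul_inv]
      simp only [ξNorm, ξpt, bitsVal]
      push_cast
      ring
    · rw [zero_mul]
  rw [Matrix.of_apply, Matrix.of_apply, Matrix.of_apply, Fintype.sum_bool]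
  simp only [if_true, Bool.false_eq_true, if_false]
  rw [Matrix.map_apply, Matrix.transpose_apply, hT, hT, finFunctionFinEquiv_eq_indexEquiv x,
    finFunctionFinEquiv_eq_indexEquiv y, H_apply]
  have e1 : ∀ z : Fin (n + 1 + nξ) → Fin 2, (fun q => z (systemEquiv n nξ (Sum.inl q))) =
      (z ∘ systemEquiv n nξ) ∘ Sum.inl := fun z => rfl
  have e2 : ∀ z : Fin (n + 1 + nξ) → Fin 2, (fun q => z (systemEquiv n nξ (Sum.inr q))) =
      (z ∘ systemEquiv n nξ) ∘ Sum.inr := fun z => rfl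
  rw [e1, e1, e2, e2]
  by_cases h : (finFunctionFinEquiv ((x ∘ systemEquiv n nξ) ∘ Sum.inr) : Fin (2 ^ nξ)) =
      finFunctionFinEquiv ((y ∘ systemEquiv n nξ) ∘ Sum.inr)
  · rw [if_pos h, if_pos h.symm, if_pos h, h, star_mul', star_inv₀]
    rw [show star (((P.genNorm n * P.ξNorm : ℝ) : ℂ)) = ((P.genNorm n * P.ξNorm : ℝ) : ℂ) from
      Complex.conj_ofReal _]
    push_cast
    ring
  · rw [if_neg h, if_neg (Ne.symm h), if_neg h]
    simp

end DiscretizedPDE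

/-! ### The Hamiltonian is as large as its coefficients -/

open Filter Topology

/-- A piecewise polynomial that does not vanish identically is bounded away from zero on some
interval. -/
theorem PiecewisePoly.exists_bound_below {a b : ℝ} (f : PiecewisePoly a b)
    (hf : f.normalization ≠ 0) : ∃ x₀ ∈ Set.Ioo a b, ∃ δ > 0, ∃ ε > 0, ∀ x, |x - x₀| < ε →
      δ ≤ ‖f.eval x‖ := by
  obtain ⟨g, hg⟩ : ∃ g, f.poly g ≠ 0 := by
    by_contra! h
    refine hf ?_
    simp [PiecewisePoly.normalization, h]
  have hlt : f.K g.castSucc < f.K g.succ := f.K_strictMono (Fin.castSucc_lt_succ (i := g))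
  have hfin : {x : ℝ | (f.poly g).eval (x : ℂ) = 0}.Finite := by
    have h1 : {z : ℂ | (f.poly g).eval z = 0}.Finite := by
      refine ((f.poly g).roots.toFinset.finite_toSet).subset fun z hz => ?_
      simpa [hg] using hz
    exact h1.preimage Complex.ofReal_injective.injOn
  obtain ⟨x₀, hx₀, hx₀'⟩ := ((Set.Ioo_infinite hlt).sdiff hfin).nonempty
  have hpos : 0 < ‖(f.poly g).eval (x₀ : ℂ)‖ := norm_pos_iff.2 hx₀'
  have hcont : Continuous fun x : ℝ => ‖(f.poly g).eval (x : ℂ)‖ :=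
    ((f.poly g).continuous.comp Complex.continuous_ofReal).norm
  have hev : ∀ᶠ x in 𝓝 x₀, x ∈ Set.Ioo (f.K g.castSucc) (f.K g.succ) ∧
      ‖(f.poly g).eval (x₀ : ℂ)‖ / 2 < ‖(f.poly g).eval (x : ℂ)‖ :=
    Filter.Eventually.and (Ioo_mem_nhds hx₀.1 hx₀.2)
      (hcont.continuousAt.eventually (lt_mem_nhds (half_lt_self hpos)))
  obtain ⟨ε, hε, h⟩ := Metric.eventually_nhds_iff.1 hev
  have hKa : a ≤ f.K g.castSucc :=
    f.K_first.ge.trans (f.K_strictMono.monotone (Fin.zero_le _))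
  have hKb : f.K g.succ ≤ b := (f.K_strictMono.monotone (Fin.le_last _)).trans f.K_last.le
  refine ⟨x₀, ⟨hKa.trans_lt hx₀.1, hx₀.2.trans_le hKb⟩, _, half_pos hpos, ε, hε, fun x hx => ?_⟩
  obtain ⟨h1, h2⟩ := h (by rwa [Real.dist_eq])
  rw [f.eval_of_mem (g := g)]
  · exact h2.le
  · rw [PiecewisePoly.piece]
    split_ifs
    · exact Set.Ioo_subset_Icc_self h1
    · exact Set.Ioo_subset_Ioc_self h1

namespace DiscretizedPDE

variable (P : DiscretizedPDE)

theorem tendsto_dx : Tendsto P.dx atTop (𝓝 0) := by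
  have h1 : Tendsto (fun n : ℕ => (2 : ℝ) ^ n - 1) atTop atTop :=
    tendsto_atTop_add_const_right _ _ (tendsto_pow_atTop_atTop_of_one_lt (by norm_num))
  exact h1.const_div_atTop _

/-- Fine grids have a bulk point near any point of the open interval. -/
theorem eventually_exists_grid {x₀ : ℝ} (hx : x₀ ∈ Set.Ioo P.a P.b) {ε : ℝ} (hε : 0 < ε) :
    ∀ᶠ n in atTop, ∃ i : Fin (2 ^ n), P.Bulk i ∧ |P.grid n i - x₀| < ε := by
  have hmin : 0 < min ε (min ((x₀ - P.a) / (P.w + 1)) ((P.b - x₀) / (P.w + 1))) := by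
    refine lt_min hε (lt_min ?_ ?_) <;> refine div_pos ?_ (by positivity)
    · linarith [hx.1]
    · linarith [hx.2]
  filter_upwards [P.tendsto_dx.eventually (gt_mem_nhds hmin), eventually_gt_atTop 0] with n hn hn0
  have hdx := P.dx_pos hn0
  rw [lt_min_iff, lt_min_iff, lt_div_iff₀ (by positivity), lt_div_iff₀ (by positivity)] at hn
  obtain ⟨h1, h2, h3⟩ := hn
  have h1n : (1 : ℝ) < 2 ^ n := one_lt_pow₀ (by norm_num) hn0.ne'
  have hba : (2 ^ n - 1) * P.dx n = P.b - P.a := mul_div_cancel₀ _ (by linarith)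
  set k := ⌊(x₀ - P.a) / P.dx n⌋₊ with hk
  have hk1 : (k : ℝ) * P.dx n ≤ x₀ - P.a := by
    rw [← le_div_iff₀ hdx]
    exact Nat.floor_le (div_nonneg (by linarith [hx.1]) hdx.le)
  have hk2 : x₀ - P.a < (k + 1) * P.dx n := by
    rw [← div_lt_iff₀ hdx]
    exact Nat.lt_floor_add_one _
  have hk3 : P.w ≤ k := by
    have : (P.w : ℝ) < k + 1 := by
      by_contra! h
      have := mul_le_mul_of_nonneg_right h hdx.le
      nlinarith
    exact_mod_cast (Nat.lt_succ_iff.1 (by exact_mod_cast this))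
  have hk4 : k + P.w < 2 ^ n := by
    have : (k + P.w + 1 : ℝ) ≤ 2 ^ n := by
      by_contra! h
      have h5 : (2 ^ n - 1) * P.dx n < (k + P.w) * P.dx n :=
        mul_lt_mul_of_pos_right (by linarith) hdx
      nlinarith
    have h6 : ((k + P.w + 1 : ℕ) : ℝ) ≤ ((2 ^ n : ℕ) : ℝ) := by push_cast; exact this
    exact Nat.cast_le.1 h6
  refine ⟨⟨k, by omega⟩, ⟨hk3, hk4⟩, ?_⟩
  have hg : P.grid n ⟨k, by omega⟩ = P.a + k * P.dx n := rfl
  rw [hg, abs_lt]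
  constructor <;> linarith

theorem eventually_exists_bulk (f : PiecewisePoly P.a P.b) (hf : f.normalization ≠ 0) :
    ∃ δ > 0, ∀ᶠ n in atTop, ∃ i : Fin (2 ^ n), P.Bulk i ∧ δ ≤ ‖f.eval (P.grid n i)‖ := by
  obtain ⟨x₀, hx₀, δ, hδ, ε, hε, h⟩ := f.exists_bound_below hf
  refine ⟨δ, hδ, (P.eventually_exists_grid hx₀ hε).mono fun n => ?_⟩
  rintro ⟨i, hi, hi'⟩
  exact ⟨i, hi, h _ hi'⟩

theorem norm_A_le_S {n : ℕ} (i j : Fin (2 ^ n)) : ‖P.A n i j‖ ≤ maxNorm (P.S n) :=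
  le_maxNorm (P.S n) (Sum.inl i) (Sum.inl j)

theorem norm_B_le_S {n : ℕ} (i : Fin (2 ^ n)) :
    Real.sqrt (2 ^ n) * ‖P.v.eval (P.grid n i) + P.vCorr n i‖ ≤ maxNorm (P.S n) := by
  have := le_maxNorm (P.S n) (Sum.inl i) (Sum.inr i)
  rwa [S, Matrix.fromBlocks_apply₁₂, B, Matrix.smul_apply, Matrix.diagonal_apply_eq, smul_eq_mul,
    norm_mul, Complex.norm_real, Real.norm_of_nonneg (Real.sqrt_nonneg _)] at this

/-- In the bulk there is no boundary correction, so that the source alone is visible in `B`. -/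
theorem eventually_source_le : ∃ c : ℝ, ∀ᶠ n in atTop,
    Real.sqrt (2 ^ n) * P.v.normalization ≤ c * maxNorm (P.S n) := by
  by_cases hv : P.v.normalization = 0
  · exact ⟨0, Eventually.of_forall fun n => by rw [hv, mul_zero, zero_mul]⟩
  · obtain ⟨δ, hδ, h⟩ := P.eventually_exists_bulk P.v hv
    refine ⟨P.v.normalization / δ, h.mono fun n => ?_⟩
    rintro ⟨i, hi, hi'⟩
    have h1 := P.norm_B_le_S i
    rw [P.vCorr_bulk n i hi.1 hi.2, add_zero] at h1
    have h2 : Real.sqrt (2 ^ n) * δ ≤ maxNorm (P.S n) :=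
      (mul_le_mul_of_nonneg_left hi' (Real.sqrt_nonneg _)).trans h1
    rw [div_mul_eq_mul_div, le_div_iff₀ hδ]
    nlinarith [P.v.normalization_nonneg]

theorem exists_stencil_ne_zero (k : Fin P.η) :
    ∃ m : ℤ, |m| ≤ P.w ∧ (P.scheme k).stencil m ≠ 0 := by
  by_contra! h
  have h1 := (P.scheme k).consistent (P.p k) le_rfl
  rw [if_pos rfl, Finset.sum_eq_zero] at h1
  · exact (Nat.cast_ne_zero (R := ℝ)).2 (Nat.factorial_ne_zero _) h1.symm
  · intro m hm
    rw [h m (abs_le.2 (Finset.mem_Icc.1 hm)), zero_mul]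

/-- As the grid is refined, the nonzero coefficient of highest order dominates the others in the
bulk. -/
theorem eventually_coeffScale_le : ∃ c : ℝ, ∀ᶠ n in atTop,
    P.coeffScale n ≤ c * maxNorm (P.S n) := by
  classical
  choose M hM using fun k => (P.scheme k).bounded
  have hM0 : ∀ k, 0 ≤ M k := fun k => (norm_nonneg _).trans (hM k 0 0 0)
  have hD : ∀ n, 0 < n → ∀ k, maxNorm (P.D n k) ≤ M k / P.dx n ^ P.p k := by
    intro n hn k
    refine Real.iSup_le (fun p => ?_) (div_nonneg (hM0 k) (pow_pos (P.dx_pos hn) _).le)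
    rw [D, Matrix.of_apply, norm_div, norm_pow, Complex.norm_real,
      Real.norm_of_nonneg (P.dx_pos hn).le]
    exact div_le_div_of_nonneg_right (hM k n _ _) (pow_pos (P.dx_pos hn) _).le
  let F := Finset.univ.filter fun k => (P.f k).normalization ≠ 0
  by_cases hF : F.Nonempty
  swap
  · refine ⟨0, Eventually.of_forall fun n => ?_⟩
    rw [zero_mul, coeffScale]
    refine (Finset.sum_eq_zero fun k _ => ?_).le
    by_cases hk : (P.f k).normalization = 0
    · rw [hk, zero_mul]
    · exact absurd ⟨k, Finset.mem_filter.2 ⟨Finset.mem_univ _, hk⟩⟩ hF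
  obtain ⟨k₀, hk₀, hmax⟩ := Finset.exists_max_image F P.p hF
  obtain ⟨δ, hδ, hbulk⟩ := P.eventually_exists_bulk (P.f k₀) (Finset.mem_filter.1 hk₀).2
  obtain ⟨m, hm, hm0⟩ := P.exists_stencil_ne_zero k₀
  set σ := fun k => |(P.scheme k).stencil m| with hσ
  have hσ0 : 0 < δ * σ k₀ := mul_pos hδ (abs_pos.2 hm0)
  -- the lower orders, relative to the highest one
  have hlow : Tendsto (fun n => ∑ k ∈ F.erase k₀,
      (P.f k).normalization * σ k * P.dx n ^ (P.p k₀ - P.p k)) atTop (𝓝 0) := by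
    have : ∀ k ∈ F.erase k₀, Tendsto (fun n => (P.f k).normalization * σ k *
        P.dx n ^ (P.p k₀ - P.p k)) atTop (𝓝 0) := by
      intro k hk
      have hlt : P.p k < P.p k₀ := lt_of_le_of_ne (hmax k (Finset.mem_of_mem_erase hk))
        fun h => Finset.ne_of_mem_erase hk (P.p_injective h)
      have := (P.tendsto_dx.pow (P.p k₀ - P.p k)).const_mul ((P.f k).normalization * σ k)
      rwa [zero_pow (by omega), mul_zero] at this
    simpa using tendsto_finsetSum _ this
  refine ⟨(∑ k, (P.f k).normalization * M k) / (δ * σ k₀ / 2), ?_⟩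
  filter_upwards [hbulk, hlow.eventually (gt_mem_nhds (half_pos hσ0)),
    P.tendsto_dx.eventually (gt_mem_nhds one_pos), eventually_gt_atTop 0] with n hb hl h1 hn
  obtain ⟨i, hi, hδi⟩ := hb
  have hdx := P.dx_pos hn
  have hpos : ∀ q : ℕ, 0 < P.dx n ^ q := fun q => pow_pos hdx q
  have hsplit : ∀ k ∈ F, P.dx n ^ P.p k * P.dx n ^ (P.p k₀ - P.p k) = P.dx n ^ P.p k₀ := by
    intro k hk
    rw [← pow_add, Nat.add_sub_cancel' (hmax k hk)]
  have hout : ∀ k, k ∉ F → (P.f k).normalization = 0 := by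
    intro k hk
    by_contra h
    exact hk (Finset.mem_filter.2 ⟨Finset.mem_univ _, h⟩)
  -- the entry of `A` in the row `i` at the position `m` of the stencils
  have hm' := abs_le.1 hm
  have hi1 := hi.1
  have hi2 := hi.2
  have hi3 : ((2 ^ n : ℕ) : ℤ) = 2 ^ n := by push_cast; rfl
  let j : Fin (2 ^ n) := ⟨((i : ℤ) + m).toNat, by omega⟩
  have hj : (j : ℤ) - i = m := by simp only [j]; omega
  have hAk : ∀ k, P.Ak n k i j = (P.f k).eval (P.grid n i) *
      (((P.scheme k).stencil m : ℂ) / (P.dx n : ℂ) ^ P.p k) := by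
    intro k
    rw [Ak_apply, D, Matrix.of_apply, (P.scheme k).bulk n i j hi.1 hi.2, hj, if_pos hm]
  have hnAk : ∀ k, ‖P.Ak n k i j‖ = ‖(P.f k).eval (P.grid n i)‖ * (σ k / P.dx n ^ P.p k) := by
    intro k
    rw [hAk, norm_mul, norm_div, norm_pow, Complex.norm_real, Complex.norm_real,
      Real.norm_of_nonneg hdx.le]
    rfl
  have hA : P.A n i j = P.Ak n k₀ i j + ∑ k ∈ F.erase k₀, P.Ak n k i j := by
    rw [A_apply, Finset.add_sum_erase F (fun k => P.Ak n k i j) hk₀]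
    refine (Finset.sum_subset (Finset.subset_univ F) fun k _ hk => ?_).symm
    rw [hAk, norm_le_zero_iff.1 (((P.f k).norm_eval_le (P.grid_mem hn i)).trans_eq (hout k hk)),
      zero_mul]
  have hlow' : ‖∑ k ∈ F.erase k₀, P.Ak n k i j‖ * P.dx n ^ P.p k₀ ≤ δ * σ k₀ / 2 := by
    refine le_trans ?_ hl.le
    refine (mul_le_mul_of_nonneg_right (norm_sum_le _ _) (hpos _).le).trans ?_
    rw [Finset.sum_mul]
    refine Finset.sum_le_sum fun k hk => ?_
    rw [hnAk, ← hsplit k (Finset.mem_of_mem_erase hk), ← mul_assoc, mul_assoc (‖_‖),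
      div_mul_cancel₀ _ (hpos _).ne']
    refine mul_le_mul_of_nonneg_right (mul_le_mul_of_nonneg_right ?_ (abs_nonneg _)) (hpos _).le
    exact (P.f k).norm_eval_le (P.grid_mem hn i)
  have htop : δ * σ k₀ ≤ ‖P.Ak n k₀ i j‖ * P.dx n ^ P.p k₀ := by
    rw [hnAk, mul_assoc, div_mul_cancel₀ _ (hpos _).ne']
    exact mul_le_mul_of_nonneg_right hδi (abs_nonneg _)
  have hlower : δ * σ k₀ / 2 ≤ maxNorm (P.S n) * P.dx n ^ P.p k₀ := by
    have h2 : ‖P.Ak n k₀ i j‖ ≤ maxNorm (P.S n) + ‖∑ k ∈ F.erase k₀, P.Ak n k i j‖ := by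
      have h3 := P.norm_A_le_S i j
      rw [hA] at h3
      have h4 := norm_le_add_norm_add (P.Ak n k₀ i j) (∑ k ∈ F.erase k₀, P.Ak n k i j)
      linarith
    have h5 := mul_le_mul_of_nonneg_right h2 (hpos (P.p k₀)).le
    rw [add_mul] at h5
    linarith
  have hupper : P.coeffScale n * P.dx n ^ P.p k₀ ≤ ∑ k, (P.f k).normalization * M k := by
    rw [coeffScale, Finset.sum_mul]
    refine Finset.sum_le_sum fun k _ => ?_
    have hNk := (P.f k).normalization_nonneg
    by_cases hk : k ∈ F
    · rw [mul_assoc]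
      refine mul_le_mul_of_nonneg_left ?_ hNk
      refine (mul_le_mul_of_nonneg_right (hD n hn k) (hpos _).le).trans ?_
      rw [← hsplit k hk, ← mul_assoc, div_mul_cancel₀ _ (hpos _).ne']
      exact mul_le_of_le_one_right (hM0 k) (pow_le_one₀ hdx.le h1.le)
    · rw [hout k hk, zero_mul, zero_mul, zero_mul]
  have hsum0 : 0 ≤ ∑ k, (P.f k).normalization * M k :=
    Finset.sum_nonneg fun k _ => mul_nonneg (P.f k).normalization_nonneg (hM0 k)
  rw [div_mul_eq_mul_div, le_div_iff₀ (half_pos hσ0)]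
  refine le_of_mul_le_mul_right ?_ (hpos (P.p k₀))
  calc P.coeffScale n * (δ * σ k₀ / 2) * P.dx n ^ P.p k₀
      = P.coeffScale n * P.dx n ^ P.p k₀ * (δ * σ k₀ / 2) := by ring
    _ ≤ (∑ k, (P.f k).normalization * M k) * (maxNorm (P.S n) * P.dx n ^ P.p k₀) :=
        mul_le_mul hupper hlower (half_pos hσ0).le hsum0
    _ = _ := by ring

/-- The boundary correction is bounded by the entries of `B` and the source. -/
theorem eventually_hamiltonianScale_le : ∃ c : ℝ, ∀ᶠ n in atTop,
    P.hamiltonianScale n ≤ c * maxNorm (P.S n) := by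
  obtain ⟨c₁, h₁⟩ := P.eventually_coeffScale_le
  obtain ⟨c₂, h₂⟩ := P.eventually_source_le
  refine ⟨(1 + max |P.aξ| |P.bξ|) * (c₁ + (2 * c₂ + 1)), ?_⟩
  filter_upwards [h₁, h₂, eventually_gt_atTop 0] with n h1 h2 hn
  have h3 : Real.sqrt (2 ^ n) * P.corrMax n ≤
      maxNorm (P.S n) + Real.sqrt (2 ^ n) * P.v.normalization := by
    rw [corrMax, Real.mul_iSup_of_nonneg (Real.sqrt_nonneg _)]
    refine Real.iSup_le (fun i => ?_) (add_nonneg (maxNorm_nonneg _)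
      (mul_nonneg (Real.sqrt_nonneg _) P.v.normalization_nonneg))
    have h4 := P.norm_B_le_S i
    have h5 : ‖P.vCorr n i‖ ≤ ‖P.v.eval (P.grid n i) + P.vCorr n i‖ + P.v.normalization := by
      have h6 := norm_sub_le (P.v.eval (P.grid n i) + P.vCorr n i) (P.v.eval (P.grid n i))
      rw [add_sub_cancel_left] at h6
      linarith [P.v.norm_eval_le (P.grid_mem hn i)]
    have h7 := mul_le_mul_of_nonneg_left h5 (Real.sqrt_nonneg (2 ^ n))
    rw [mul_add] at h7
    linarith
  have h0 : 0 ≤ 1 + max |P.aξ| |P.bξ| := by positivity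
  have : P.hamiltonianScale n = (1 + max |P.aξ| |P.bξ|) * (P.coeffScale n +
    Real.sqrt (2 ^ n) * (P.v.normalization + P.corrMax n)) := rfl
  rw [this, mul_assoc]
  refine mul_le_mul_of_nonneg_left ?_ h0
  rw [mul_add]
  linarith

/-- The two extreme values of the auxiliary coordinate determine `S₁` and `S₂` from `H`. -/
theorem norm_S_le {n nξ : ℕ} (hnξ : 1 ≤ nξ) {h : ℝ} (s s' : Fin (2 ^ n) ⊕ Fin (2 ^ n))
    (hH : ∀ l, ‖P.H n nξ (indexEquiv n nξ (s, l)) (indexEquiv n nξ (s', l))‖ ≤ h) :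
    ‖P.S n s s'‖ ≤ (1 + (2 + 2 * |P.aξ|) / (P.bξ - P.aξ)) * h := by
  have hpos : 0 < P.bξ - P.aξ := sub_pos.2 P.aξ_lt_bξ
  have h1n : (1 : ℝ) < 2 ^ nξ := one_lt_pow₀ (by norm_num) (by omega)
  have e0 := hH 0
  have e1 := hH ⟨2 ^ nξ - 1, by simp⟩
  rw [H_apply_S, if_pos rfl] at e0 e1
  have p0 : P.ξpt nξ 0 = P.aξ := by simp [ξpt]
  have p1 : P.ξpt nξ ⟨2 ^ nξ - 1, by simp⟩ = P.bξ := by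
    have : ((2 ^ nξ - 1 : ℕ) : ℝ) = 2 ^ nξ - 1 := by
      rw [Nat.cast_sub Nat.one_le_two_pow]; push_cast; rfl
    rw [ξpt]
    simp only [this]
    rw [div_mul_cancel₀ _ (by linarith)]
    ring
  rw [p0] at e0
  rw [p1] at e1
  have hS1 : ‖P.S₁ n s s'‖ * (P.bξ - P.aξ) ≤ 2 * h := by
    have h2 := norm_sub_le (P.S₁ n s s' * (P.bξ : ℂ) + P.S₂ n s s')
      (P.S₁ n s s' * (P.aξ : ℂ) + P.S₂ n s s')
    have h3 : P.S₁ n s s' * (P.bξ : ℂ) + P.S₂ n s s' - (P.S₁ n s s' * (P.aξ : ℂ) + P.S₂ n s s') =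
        P.S₁ n s s' * ((P.bξ - P.aξ : ℝ) : ℂ) := by push_cast; ring
    rw [h3, norm_mul, Complex.norm_real, Real.norm_of_nonneg hpos.le] at h2
    linarith
  have hS2 : ‖P.S₂ n s s'‖ ≤ h + ‖P.S₁ n s s'‖ * |P.aξ| := by
    have h2 := norm_sub_le (P.S₁ n s s' * (P.aξ : ℂ) + P.S₂ n s s') (P.S₁ n s s' * (P.aξ : ℂ))
    rw [add_sub_cancel_left, norm_mul, Complex.norm_real, Real.norm_eq_abs] at h2
    linarith
  have hS : P.S n s s' = P.S₁ n s s' + Complex.I * P.S₂ n s s' := by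
    rw [S₁_apply, S₂_apply]
    linear_combination (1 / 2 * (P.S n s s' - star (P.S n s' s))) * Complex.I_sq
  have h4 : ‖P.S₁ n s s'‖ ≤ 2 * h / (P.bξ - P.aξ) := (le_div_iff₀ hpos).2 hS1
  calc ‖P.S n s s'‖ ≤ ‖P.S₁ n s s'‖ + ‖P.S₂ n s s'‖ := by
        rw [hS]
        refine (norm_add_le _ _).trans_eq ?_
        rw [norm_mul, Complex.norm_I, one_mul]
    _ ≤ h + ‖P.S₁ n s s'‖ * (1 + |P.aξ|) := by linarith
    _ ≤ h + 2 * h / (P.bξ - P.aξ) * (1 + |P.aξ|) := by gcongr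
    _ = _ := by ring

theorem S_ne_zero_of_H {n nξ : ℕ} (h : P.H n nξ ≠ 0) : P.S n ≠ 0 := by
  intro hS
  refine h ?_
  ext I J
  obtain ⟨⟨s, l⟩, rfl⟩ := (indexEquiv n nξ).surjective I
  obtain ⟨⟨s', l'⟩, rfl⟩ := (indexEquiv n nξ).surjective J
  rw [H_apply, hS]
  simp

theorem hamiltonianScale_nonneg (n : ℕ) : 0 ≤ P.hamiltonianScale n := by
  have h1 := P.coeffScale_nonneg n
  have h2 := P.corrMax_nonneg n
  have h3 := P.v.normalization_nonneg
  exact mul_nonneg (by positivity) (add_nonneg h1 (mul_nonneg (Real.sqrt_nonneg _)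
    (add_nonneg h3 h2)))

/-- The scale and `S` do not depend on `nξ`, so that the finitely many exceptional values of `n`
cost only a constant. -/
theorem exists_hamiltonianScale_le : ∃ c : ℝ, ∀ n nξ : ℕ, 1 ≤ nξ → P.H n nξ ≠ 0 →
    P.hamiltonianScale n ≤ c * maxNorm (P.H n nξ) := by
  obtain ⟨c, hc⟩ := P.eventually_hamiltonianScale_le
  obtain ⟨n₀, hn₀⟩ := eventually_atTop.1 hc
  set c₁ := 1 + (2 + 2 * |P.aξ|) / (P.bξ - P.aξ) with hc₁
  have hc₁0 : 0 ≤ c₁ := by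
    have := sub_pos.2 P.aξ_lt_bξ
    positivity
  let ratio : ℕ → ℝ := fun n => P.hamiltonianScale n / maxNorm (P.S n)
  have hr : ∀ n, 0 ≤ ratio n := fun n =>
    div_nonneg (P.hamiltonianScale_nonneg n) (maxNorm_nonneg _)
  have hR : 0 ≤ ∑ n ∈ Finset.range n₀, ratio n := Finset.sum_nonneg fun n _ => hr n
  refine ⟨(|c| + ∑ n ∈ Finset.range n₀, ratio n) * c₁, fun n nξ hnξ hH => ?_⟩
  have hS : P.hamiltonianScale n ≤ (|c| + ∑ n ∈ Finset.range n₀, ratio n) * maxNorm (P.S n) := by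
    have h0 := maxNorm_nonneg (P.S n)
    rcases le_or_gt n₀ n with h | h
    · refine (hn₀ n h).trans (mul_le_mul_of_nonneg_right ?_ h0)
      linarith [le_abs_self c]
    · have hpos : 0 < maxNorm (P.S n) := by
        refine lt_of_le_of_ne h0 fun h1 => P.S_ne_zero_of_H hH ?_
        ext s s'
        exact norm_le_zero_iff.1 ((le_maxNorm (P.S n) s s').trans_eq h1.symm)
      have h2 : P.hamiltonianScale n = ratio n * maxNorm (P.S n) :=
        (div_mul_cancel₀ _ hpos.ne').symm
      rw [h2]
      refine mul_le_mul_of_nonneg_right ?_ h0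
      have := Finset.single_le_sum (fun n _ => hr n) (Finset.mem_range.2 h)
      linarith [abs_nonneg c]
  refine hS.trans ?_
  rw [mul_assoc]
  refine mul_le_mul_of_nonneg_left ?_ (by positivity)
  exact Real.iSup_le (fun p => P.norm_S_le hnξ p.1 p.2 fun l => le_maxNorm _ _ _)
    (mul_nonneg hc₁0 (maxNorm_nonneg _))

end DiscretizedPDE

/-! ### Sparsity -/

theorem finite_diagonals {N : ℕ} (M : Matrix (Fin N) (Fin N) ℂ) :
    {d : ℤ | ∃ i j : Fin N, M i j ≠ 0 ∧ d = ((j : ℤ) - (i : ℤ)) % (N : ℤ)}.Finite := by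
  refine (Set.finite_range fun p : Fin N × Fin N => ((p.2 : ℤ) - (p.1 : ℤ)) % (N : ℤ)).subset ?_
  rintro d ⟨i, j, -, rfl⟩
  exact ⟨(i, j), rfl⟩

theorem card_le_diagSparsity {N K : ℕ} {M : Matrix (Fin N) (Fin N) ℂ} (s : Finset (Fin K))
    (g : ℤ → ℤ) (h : ∀ e ∈ s, ∃ i j, M i j ≠ 0 ∧ g (((j : ℤ) - (i : ℤ)) % (N : ℤ)) = (e : ℕ)) :
    s.card ≤ diagSparsity M := by
  have h1 : ((fun e : Fin K => ((e : ℕ) : ℤ)) '' (s : Set (Fin K))).ncard = s.card := by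
    rw [Set.ncard_image_of_injective _ fun a b hab => Fin.ext (by exact_mod_cast hab),
      Set.ncard_coe_finset]
  rw [← h1]
  refine (Set.ncard_le_ncard ?_ ((finite_diagonals M).image g)).trans
    (Set.ncard_image_le (finite_diagonals M))
  rintro _ ⟨e, he, rfl⟩
  obtain ⟨i, j, hij, hg⟩ := h e he
  exact ⟨_, ⟨i, j, hij, rfl⟩, hg⟩

theorem one_le_diagSparsity {N : ℕ} {M : Matrix (Fin N) (Fin N) ℂ} (hM : M ≠ 0) :
    1 ≤ diagSparsity M := by
  obtain ⟨i, j, hij⟩ : ∃ i j, M i j ≠ 0 := by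
    by_contra! h
    exact hM (by ext i j; exact h i j)
  rw [diagSparsity, Nat.one_le_iff_ne_zero, ← Nat.pos_iff_ne_zero, Set.ncard_pos (finite_diagonals M)]
  exact ⟨_, i, j, hij, rfl⟩

theorem add_sub_emod {n : ℕ} (i e : Fin (2 ^ n)) :
    (((i + e : Fin (2 ^ n)) : ℤ) - (i : ℤ)) % ((2 ^ n : ℕ) : ℤ) = (e : ℕ) := by
  have he := e.2
  have h1 : ((e : ℕ) : ℤ) % ((2 ^ n : ℕ) : ℤ) = (e : ℕ) :=
    Int.emod_eq_of_lt (by omega) (by exact_mod_cast he)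
  rcases DiscretizedPDE.val_add_eq_or i e with h | h
  · rw [h]
    push_cast at h1 ⊢
    rw [add_sub_cancel_left, h1]
  · have : ((i + e : Fin (2 ^ n)) : ℤ) - (i : ℤ) = (e : ℕ) - ((2 ^ n : ℕ) : ℤ) := by omega
    rw [this, Int.sub_emod_right, h1]

namespace DiscretizedPDE

variable (P : DiscretizedPDE) {n m r nξ rξ : ℕ}

/-- A nonzero entry of `A` comes from a nonzero entry of some `A_k`. -/
theorem card_diagonals_le_sum : (P.diagonals n).card ≤ ∑ k, diagSparsity (P.Ak n k) := by
  classical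
  let F : Fin P.η → Finset (Fin (2 ^ n)) := fun k =>
    Finset.univ.filter fun e => ∃ i, P.Ak n k i (i + e) ≠ 0
  have hsub : P.diagonals n ⊆ Finset.univ.biUnion F := by
    intro e he
    obtain ⟨i, hi⟩ : ∃ i, P.A n i (i + e) ≠ 0 := by
      unfold diagonals at he
      exact (Finset.mem_filter.1 he).2
    rw [A_apply] at hi
    obtain ⟨k, -, hk⟩ := Finset.exists_ne_zero_of_sum_ne_zero hi
    exact Finset.mem_biUnion.2 ⟨k, Finset.mem_univ _, Finset.mem_filter.2 ⟨Finset.mem_univ _, i, hk⟩⟩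
  refine (Finset.card_le_card hsub).trans (Finset.card_biUnion_le.trans
    (Finset.sum_le_sum fun k _ => card_le_diagSparsity _ id fun e he => ?_))
  obtain ⟨i, hi⟩ := (Finset.mem_filter.1 he).2
  exact ⟨i, i + e, hi, add_sub_emod i e⟩

theorem exists_H_ne_zero (hnξ : 1 ≤ nξ) {s s' : Fin (2 ^ n) ⊕ Fin (2 ^ n)} (h : P.S n s s' ≠ 0) :
    ∃ l, P.H n nξ (indexEquiv n nξ (s, l)) (indexEquiv n nξ (s', l)) ≠ 0 := by
  by_contra! h0
  have := P.norm_S_le hnξ (h := 0) s s' fun l => by rw [h0 l, norm_zero]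
  rw [mul_zero] at this
  exact h (norm_le_zero_iff.1 this)

/-- Distinct nonzero cyclic diagonals of `A` lie on distinct cyclic diagonals of `H`. -/
theorem card_diagonals_le_sparsity (hnξ : 1 ≤ nξ) : (P.diagonals n).card ≤ P.sparsity n nξ := by
  -- the position is stored above the `nξ` auxiliary qubits and below the component qubit
  refine card_le_diagSparsity _ (fun d => d / ((2 ^ nξ : ℕ) : ℤ) % ((2 ^ n : ℕ) : ℤ))
    fun e he => ?_
  obtain ⟨i, hi⟩ : ∃ i, P.A n i (i + e) ≠ 0 := by
    unfold diagonals at he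
    exact (Finset.mem_filter.1 he).2
  obtain ⟨l, hl⟩ := P.exists_H_ne_zero hnξ (s := Sum.inl i) (s' := Sum.inl (i + e)) hi
  refine ⟨_, _, hl, ?_⟩
  have hv : ∀ j : Fin (2 ^ n), ((indexEquiv n nξ (Sum.inl j, l) : Fin _) : ℕ) =
      l + 2 ^ nξ * j := fun j => rfl
  have hsub : ((indexEquiv n nξ (Sum.inl (i + e), l) : Fin _) : ℤ) -
      ((indexEquiv n nξ (Sum.inl i, l) : Fin _) : ℤ) =
      ((2 ^ nξ : ℕ) : ℤ) * (((i + e : Fin (2 ^ n)) : ℤ) - (i : ℤ)) := by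
    rw [hv, hv]; push_cast; ring
  have hM : ((2 ^ (n + 1 + nξ) : ℕ) : ℤ) = ((2 ^ nξ : ℕ) : ℤ) * ((2 ^ n : ℕ) * 2 : ℤ) := by
    push_cast; ring
  have hpos : (0 : ℤ) < ((2 ^ nξ : ℕ) : ℤ) := by positivity
  rw [hsub, hM, Int.mul_emod_mul_of_pos _ _ hpos, Int.mul_ediv_cancel_left _ hpos.ne',
    Int.emod_emod_of_dvd _ (Dvd.intro _ rfl), add_sub_emod]

/-- A nonzero Hamiltonian has a summand of nonzero weight. -/
theorem genNorm_pos (hn : 0 < n) (h : P.H n nξ ≠ 0) : 0 < P.genNorm n := by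
  refine lt_of_le_of_ne (Finset.sum_nonneg fun t _ => norm_nonneg _) fun h0 => ?_
  have hw : ∀ t, P.weight n t = 0 := fun t => norm_eq_zero.1
    ((Finset.sum_eq_zero_iff_of_nonneg fun t _ => norm_nonneg _).1 h0.symm t (Finset.mem_univ t))
  have key := fun x y : Unit ⊕ Fin n → Fin 2 => P.sum_weight_term hn x y
  simp only [hw, zero_mul, Finset.sum_const_zero] at key
  have hg : ∀ (b : Fin 2) (i : Fin (2 ^ n)), gridIdx (Sum.elim (fun _ => b)
      (finFunctionFinEquiv.symm i) : Unit ⊕ Fin n → Fin 2) = i := by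
    intro b i
    exact finFunctionFinEquiv.apply_symm_apply i
  refine P.S_ne_zero_of_H h ?_
  have hA : P.A n = 0 := by
    ext i j
    have := key (Sum.elim (fun _ => 0) (finFunctionFinEquiv.symm i))
      (Sum.elim (fun _ => 0) (finFunctionFinEquiv.symm j))
    rw [hg, hg] at this
    exact (this.trans (if_pos rfl)).symm
  have hB : P.B n = 0 := by
    ext i j
    have := key (Sum.elim (fun _ => 0) (finFunctionFinEquiv.symm i))
      (Sum.elim (fun _ => 1) (finFunctionFinEquiv.symm j))
    rw [hg, hg] at this
    exact (this.trans (if_neg (by simp))).symm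
  rw [S, hA, hB, Matrix.fromBlocks_zero]

/-! ### Gate counts -/

theorem _root_.SchroPDE.polyCost_le (hn : 1 ≤ n) (hm : 2 ^ m ≤ 2 * n) (Q : ℕ) :
    polyCost n m Q ≤ 2100000 * (max 1 Q * (n * (m + 1))) := by
  have hq : 1 ≤ max 1 Q := le_max_left _ _
  set q := max 1 Q with hqd
  set u := n * (m + 1) with hu
  have h1 : 800 * (m + 1) * 2 ^ m ≤ 1600 * u := by
    calc 800 * (m + 1) * 2 ^ m ≤ 800 * (m + 1) * (2 * n) := Nat.mul_le_mul_left _ hm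
      _ = 1600 * u := by rw [hu]; ring
  have h2 : n * (2 * (176 * m + 2) + 20) ≤ 352 * u := by
    calc n * (2 * (176 * m + 2) + 20) ≤ n * (352 * (m + 1)) := Nat.mul_le_mul_left _ (by omega)
      _ = 352 * u := by rw [hu]; ring
  have h3 : m + 1 ≤ u := Nat.le_mul_of_pos_left _ hn
  have h4 : n ≤ u := Nat.le_mul_of_pos_right _ (Nat.succ_pos m)
  have h5 : u ≤ q * u := Nat.le_mul_of_pos_left _ hq
  have h6 : 44 * q * (800 * (m + 1) * 2 ^ m + n * (2 * (176 * m + 2) + 20) + 352 * m + 25) ≤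
      101376 * (q * u) := by
    calc _ ≤ 44 * q * (2304 * u) := Nat.mul_le_mul_left _ (by omega)
      _ = _ := by ring
  rw [polyCost, ← hqd]
  omega

theorem _root_.SchroPDE.PiecewisePoly.cost_le {a b : ℝ} (f : PiecewisePoly a b) (hn : 1 ≤ n)
    (hm : 2 ^ m ≤ 2 * n) : f.cost n m ≤ 2100000 * (f.degreeSum * (n * (m + 1))) := by
  rw [PiecewisePoly.cost, PiecewisePoly.degreeSum, Finset.sum_mul, Finset.mul_sum]
  exact Finset.sum_le_sum fun g _ => polyCost_le hn hm _

theorem _root_.SchroPDE.PiecewisePoly.one_le_degreeSum {a b : ℝ} (f : PiecewisePoly a b) :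
    1 ≤ f.degreeSum :=
  (le_max_left 1 _).trans (Finset.single_le_sum (f := fun g => max 1 (f.poly g).natDegree)
    (fun _ _ => Nat.zero_le _) (Finset.mem_univ (⟨0, f.G_pos⟩ : Fin f.G)))

theorem genCost_le (hn : 2 ≤ n) (hm : 2 ^ m ≤ 2 * n) (hr : r ≤ 2 * n + 1)
    (hr' : 2 ^ r ≤ 2 * Fintype.card (P.Term n)) :
    P.genCost n m r ≤ 100000000 * ((1 + P.w) * (P.v.degreeSum * (n * (m + 1)) +
      ∑ k, (diagSparsity (P.Ak n k) * n + (P.f k).degreeSum * (n * (m + 1))))) := by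
  set u := n * (m + 1) with hu
  have hnu : n ≤ u := Nat.le_mul_of_pos_right _ (Nat.succ_pos m)
  have hqu : ∀ {a b : ℝ} (f : PiecewisePoly a b), n ≤ f.degreeSum * u := fun f =>
    hnu.trans (Nat.le_mul_of_pos_left _ f.one_le_degreeSum)
  rw [Finset.sum_add_distrib, ← Finset.sum_mul]
  set K := ∑ k, diagSparsity (P.Ak n k) with hK
  set Z := ∑ k, (P.f k).degreeSum * u with hZ
  set V := P.v.degreeSum * u with hV
  set b := (P.nearDiagonals n).card with hb
  set d := (P.diagonals n).card with hd
  set τ := Fintype.card (P.Term n) with hτ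
  set W := 1 + P.w with hW
  have hτ' : τ = b * P.η + (d + 2) := P.card_term
  have hbW : b ≤ 2 * W := P.card_nearDiagonals_le.trans (by omega)
  have hdK : d ≤ K := P.card_diagonals_le_sum
  have hηZ : P.η * n ≤ Z := by
    have := Finset.card_nsmul_le_sum Finset.univ (fun k => (P.f k).degreeSum * u) n
      fun k _ => hqu (P.f k)
    simpa using this
  have hnV : n ≤ V := hqu P.v
  have hW1 : 1 ≤ W := by omega
  have hWV : V ≤ W * V := Nat.le_mul_of_pos_left _ hW1
  have hWK : d * n ≤ W * (K * n) :=
    (Nat.mul_le_mul_right n hdK).trans (Nat.le_mul_of_pos_left _ hW1)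
  have hnτ : n * τ ≤ 2 * (W * Z) + W * (K * n) + 2 * (W * V) := by
    calc n * τ = b * (P.η * n) + d * n + 2 * n := by rw [hτ']; ring
      _ ≤ 2 * W * Z + W * (K * n) + 2 * (W * V) :=
        Nat.add_le_add (Nat.add_le_add (Nat.mul_le_mul hbW hηZ) hWK)
          (Nat.mul_le_mul_left 2 (hnV.trans hWV))
      _ = _ := by ring
  have e1 : 800 * (r + 1) * 2 ^ r ≤ 4800 * (n * τ) := by
    calc 800 * (r + 1) * 2 ^ r ≤ 800 * (3 * n) * (2 * τ) :=
          Nat.mul_le_mul (Nat.mul_le_mul_left _ (by omega)) hr'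
      _ = _ := by ring
  have e2 : τ * (2 * (176 * r + 2) + 20) ≤ 900 * (n * τ) := by
    calc τ * (2 * (176 * r + 2) + 20) ≤ τ * (900 * n) := Nat.mul_le_mul_left _ (by omega)
      _ = _ := by ring
  have e3 : b * ∑ k, (352 * n + 25 + ((P.f k).cost n m + 1) + 90 * n) ≤ 4200910 * (W * Z) := by
    have h1 : ∑ k, (352 * n + 25 + ((P.f k).cost n m + 1) + 90 * n) ≤ 2100455 * Z := by
      rw [hZ, Finset.mul_sum]
      refine Finset.sum_le_sum fun k _ => ?_
      have h2 := (P.f k).cost_le (by omega) hm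
      have h3 := hqu (P.f k)
      rw [← hu] at h2
      omega
    calc _ ≤ 2 * W * (2100455 * Z) := Nat.mul_le_mul hbW h1
      _ = _ := by ring
  have e4 : 2 * P.w * (352 * n + 44) + 1 + 90 * n ≤ 748 * (W * n) := by
    calc _ ≤ 2 * P.w * (374 * n) + 748 * n := by
          have : 2 * P.w * (352 * n + 44) ≤ 2 * P.w * (374 * n) :=
            Nat.mul_le_mul_left _ (by omega)
          omega
      _ = _ := by rw [hW]; ring
  have e5 : d * (2 * P.w * (352 * n + 44) + 1 + 90 * n) ≤ 748 * (W * (K * n)) := by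
    calc _ ≤ K * (748 * (W * n)) := Nat.mul_le_mul hdK e4
      _ = _ := by ring
  have e6 : P.v.cost n m + 1 + 1 ≤ 2100002 * (W * V) := by
    have := P.v.cost_le (by omega) hm
    rw [← hu] at this
    omega
  have e7 : 2 * P.w * (352 * n + 44) + 1 + 1 ≤ 748 * (W * V) := by
    have : W * n ≤ W * V := Nat.mul_le_mul_left _ hnV
    omega
  have hsum : ∑ t, P.termCost n m t =
      b * ∑ k, (352 * n + 25 + ((P.f k).cost n m + 1) + 90 * n) +
      (d * (2 * P.w * (352 * n + 44) + 1 + 90 * n) +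
        (P.v.cost n m + 1 + 1 + (2 * P.w * (352 * n + 44) + 1 + 1))) := by
    rw [Fintype.sum_sum_type, Fintype.sum_sum_type, Fintype.sum_prod_type, Fintype.sum_bool]
    simp only [termCost, Finset.sum_const, Finset.card_univ, Fintype.card_coe, smul_eq_mul]
    rfl
  have hgen : P.genCost n m r = 1 + (800 * (r + 1) * 2 ^ r + (τ * (2 * (176 * r + 2) + 20) +
      20 * ∑ t, P.termCost n m t)) := by
    have h1 : ∀ t : P.Term n, 2 * (176 * r + 2) + 20 * (P.termCost n m t + 1) =
        2 * (176 * r + 2) + 20 + 20 * P.termCost n m t := fun t => by ring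
    rw [genCost, Finset.sum_congr rfl fun t _ => h1 t, Finset.sum_add_distrib, Finset.sum_const,
      Finset.card_univ, ← Finset.mul_sum, smul_eq_mul]
  have hWn : 1 ≤ W * V := (show 1 ≤ V by omega).trans hWV
  rw [hgen, hsum, mul_add W V, mul_add W (K * n) Z]
  omega

theorem _root_.SchroPDE.affineCost_le (hn : 1 ≤ n) (hr : 2 ^ r ≤ 4 * n) :
    affineCost n r ≤ 4000 * (n * (r + 1)) := by
  have h1 : 800 * (r + 1) * 2 ^ r ≤ 3200 * (n * (r + 1)) := by
    calc _ ≤ 800 * (r + 1) * (4 * n) := Nat.mul_le_mul_left _ hr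
      _ = _ := by ring
  have h2 : (n + 1) * (2 * (176 * r + 2) + 40) ≤ 704 * (n * (r + 1)) := by
    calc _ ≤ 2 * n * (352 * (r + 1)) := Nat.mul_le_mul (by omega) (by omega)
      _ = _ := by ring
  rw [affineCost]
  omega

theorem _root_.SchroPDE.clog_le_log {n : ℕ} (hn : 2 ≤ n) :
    (Nat.clog 2 n : ℝ) ≤ 3 * Real.log n ∧ 1 ≤ 3 / 2 * Real.log n := by
  have h2 := Real.log_two_gt_d9
  have hlog : Real.log 2 ≤ Real.log n := Real.log_le_log (by norm_num) (by exact_mod_cast hn)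
  constructor
  · have h := Nat.ceil_lt_add_one (a := Real.logb 2 n)
      (Real.logb_nonneg (by norm_num) (by exact_mod_cast (by omega : 1 ≤ n)))
    have h3 := Real.natCeil_logb_natCast 2 n
    push_cast at h3
    rw [h3, Real.logb] at h
    have h4 : Real.log n / Real.log 2 ≤ 3 / 2 * Real.log n := by
      rw [div_le_iff₀ (by linarith)]
      nlinarith
    nlinarith
  · linarith

/-- The natural logarithm is bounded below on `n ≥ 2`; for `nξ = 1`, where it vanishes, the
constant cost of the auxiliary register is absorbed by the other terms. -/
theorem gateCount_le (hn : 2 ≤ n) (hnξ : 1 ≤ nξ) (hr : r ≤ 2 * n + 1)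
    (hr' : 2 ^ r ≤ 2 * Fintype.card (P.Term n)) (hm : 2 ^ Nat.clog 2 n ≤ 2 * n)
    (hrξ : rξ ≤ Nat.clog 2 nξ + 1) (hrξ' : 2 ^ rξ ≤ 4 * nξ) :
    ((3912 + 40 * (P.genCost n (Nat.clog 2 n) r + affineCost nξ rξ) : ℕ) : ℝ) ≤
      30000000000 * (1 + P.w) * P.gateScale n nξ := by
  obtain ⟨hc1, hc2⟩ := clog_le_log hn
  set ℓ := Real.log n with hℓ
  have hn' : (2 : ℝ) ≤ n := by exact_mod_cast hn
  have hℓ0 : 0 < ℓ := by linarith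
  have hu : (n : ℝ) * (Nat.clog 2 n + 1) ≤ 5 * (n * ℓ) := by nlinarith
  set g₀ : ℝ := P.v.degreeSum * (n * ℓ) +
    ∑ k, ((diagSparsity (P.Ak n k) : ℝ) * n + (P.f k).degreeSum * (n * ℓ)) with hg₀
  set X : ℝ := nξ * Real.log nξ with hX
  have hscale : P.gateScale n nξ = g₀ + X := rfl
  have hX0 : 0 ≤ X := mul_nonneg (Nat.cast_nonneg _) (Real.log_natCast_nonneg _)
  have hnl : 1 ≤ n * ℓ := by nlinarith
  have hg1 : 1 ≤ g₀ := by
    have h1 : (1 : ℝ) ≤ P.v.degreeSum := by exact_mod_cast P.v.one_le_degreeSum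
    have h2 : 0 ≤ ∑ k, ((diagSparsity (P.Ak n k) : ℝ) * n + (P.f k).degreeSum * (n * ℓ)) :=
      Finset.sum_nonneg fun k _ => by positivity
    nlinarith
  have hW : (1 : ℝ) ≤ 1 + P.w := by
    have : (0 : ℝ) ≤ P.w := Nat.cast_nonneg _
    linarith
  have hgen : (P.genCost n (Nat.clog 2 n) r : ℝ) ≤ 500000000 * ((1 + P.w) * g₀) := by
    have h1 : (P.genCost n (Nat.clog 2 n) r : ℝ) ≤ _ := Nat.cast_le.2 (P.genCost_le hn hm hr hr')
    push_cast at h1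
    refine h1.trans ?_
    have h2 : (P.v.degreeSum : ℝ) * (n * (Nat.clog 2 n + 1)) +
        ∑ k, ((diagSparsity (P.Ak n k) : ℝ) * n +
          (P.f k).degreeSum * (n * (Nat.clog 2 n + 1))) ≤ 5 * g₀ := by
      rw [hg₀, mul_add (5 : ℝ), Finset.mul_sum]
      refine add_le_add ?_ (Finset.sum_le_sum fun k _ => ?_)
      · have := mul_le_mul_of_nonneg_left hu (Nat.cast_nonneg (α := ℝ) P.v.degreeSum)
        linarith
      · have := mul_le_mul_of_nonneg_left hu (Nat.cast_nonneg (α := ℝ) (P.f k).degreeSum)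
        have h3 : (0 : ℝ) ≤ (diagSparsity (P.Ak n k) : ℝ) * n := by positivity
        linarith
    have h3 := mul_le_mul_of_nonneg_left h2 (by linarith : (0 : ℝ) ≤ 1 + P.w)
    linarith
  have haff : (affineCost nξ rξ : ℝ) ≤ 24000 * X + 8000 := by
    have h1 : (affineCost nξ rξ : ℝ) ≤ _ := Nat.cast_le.2 (affineCost_le hnξ hrξ')
    push_cast at h1
    refine h1.trans ?_
    have h2 : (rξ : ℝ) ≤ Nat.clog 2 nξ + 1 := by exact_mod_cast hrξ
    rcases hnξ.eq_or_lt with h | h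
    · subst h
      simp only [Nat.cast_one, Nat.clog_one_right, Nat.cast_zero] at h2 ⊢
      linarith
    · obtain ⟨hd1, hd2⟩ := clog_le_log h
      have h3 : (rξ : ℝ) + 1 ≤ 6 * Real.log nξ := by linarith
      have h4 := mul_le_mul_of_nonneg_left h3 (Nat.cast_nonneg (α := ℝ) nξ)
      rw [hX]
      linarith
  push_cast
  rw [hscale]
  have h5 : 1 * X ≤ (1 + P.w) * X := mul_le_mul_of_nonneg_right hW hX0
  have h6 : 1 * 1 ≤ (1 + P.w) * g₀ := mul_le_mul hW hg1 zero_le_one (by linarith)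
  nlinarith

/-- The block-encoding of a nonzero Hamiltonian, with explicit constants. -/
theorem exists_circuit_H (hn : 2 ≤ n) (hnξ : 1 ≤ nξ) (hw : 2 * P.w < 2 ^ n)
    (hH : P.H n nξ ≠ 0) :
    ∃ (α : ℝ) (c : Circuit (Qubits (2 * n + 2) (P.signalQubits n nξ) (n + 1 + nξ))),
      IsBlockEncoding c.matrix (P.H n nξ) α 0 ∧ IsPureAncilla c.matrix ∧
      (c.length : ℝ) ≤ 30000000000 * (1 + P.w) * P.gateScale n nξ ∧
      α ≤ 3 * P.sparsity n nξ * P.hamiltonianScale n := by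
  have two_pow_clog : ∀ {k : ℕ}, 2 ≤ k → 2 ^ Nat.clog 2 k ≤ 2 * k := by
    intro k hk
    have h1 := Nat.pow_pred_clog_lt_self (b := 2) (by norm_num) (by omega : 1 < k)
    have h2 : 0 < Nat.clog 2 k := Nat.clog_pos (by norm_num) hk
    obtain ⟨c, hc⟩ : ∃ c, Nat.clog 2 k = c + 1 := ⟨Nat.clog 2 k - 1, by omega⟩
    rw [hc] at h1 ⊢
    rw [pow_succ]
    simp only [Nat.pred_eq_sub_one, Nat.add_sub_cancel] at h1
    omega
  have le_two_pow_clog : ∀ k : ℕ, k ≤ 2 ^ Nat.clog 2 k := fun k =>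
    Nat.le_pow_clog (by norm_num) k
  set κ := P.sparsity n nξ with hκ
  have hκ1 : 1 ≤ κ := one_le_diagSparsity hH
  have hdκ : (P.diagonals n).card ≤ κ := P.card_diagonals_le_sparsity hnξ
  set τ := Fintype.card (P.Term n) with hτ
  have hτ' : τ = (P.nearDiagonals n).card * P.η + ((P.diagonals n).card + 2) := P.card_term
  have hbκ : (P.nearDiagonals n).card ≤ κ := P.card_nearDiagonals_le_diagonals.trans hdκ
  have hη := P.η_pos
  have hτκ : τ ≤ 4 * (κ * P.η) := by
    have h1 : (P.nearDiagonals n).card * P.η ≤ κ * P.η := Nat.mul_le_mul_right _ hbκ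
    have h2 : κ ≤ κ * P.η := Nat.le_mul_of_pos_right _ hη
    omega
  have hr1 : Nat.clog 2 τ ≤ Nat.clog 2 κ + Nat.clog 2 P.η + 2 := by
    refine Nat.clog_le_of_le_pow (hτκ.trans ?_)
    calc 4 * (κ * P.η) ≤ 4 * (2 ^ Nat.clog 2 κ * 2 ^ Nat.clog 2 P.η) :=
          Nat.mul_le_mul_left _ (Nat.mul_le_mul (le_two_pow_clog _) (le_two_pow_clog _))
      _ = _ := by rw [pow_add, pow_add]; ring
  have hr2 : Nat.clog 2 τ ≤ 2 * n + 1 := by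
    refine Nat.clog_le_of_le_pow ?_
    -- the consistency conditions on a stencil bound the orders, hence `η ≤ 2 * w + 1 ≤ 2 ^ n`
    have h1 : (P.nearDiagonals n).card * P.η ≤ 2 ^ n * 2 ^ n :=
      Nat.mul_le_mul (P.card_nearDiagonals_le.trans (by omega)) (P.eta_le.trans (by omega))
    have h2 : (P.diagonals n).card ≤ 2 ^ n := by simpa using Finset.card_le_univ (P.diagonals n)
    have h3 : 2 ^ 2 ≤ 2 ^ n := Nat.pow_le_pow_right (by norm_num) hn
    have h4 : 2 ^ (2 * n + 1) = 2 * (2 ^ n * 2 ^ n) := by rw [pow_succ, two_mul, pow_add]; ring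
    rw [hτ', h4]
    nlinarith
  have hrξ : Nat.clog 2 (nξ + 1) ≤ Nat.clog 2 nξ + 1 := by
    refine Nat.clog_le_of_le_pow ?_
    have := le_two_pow_clog nξ
    rw [pow_succ]
    omega
  have hα := P.genNorm_pos (by omega) hH
  have hB := P.blockEnc_H (s := P.signalQubits n nξ) hn hnξ hw (le_two_pow_clog n)
    (Nat.clog_le_of_le_pow Nat.lt_two_pow_self.le) (hτ' ▸ le_two_pow_clog τ) hr2 hα
    (le_two_pow_clog (nξ + 1)) (Nat.clog_le_of_le_pow Nat.lt_two_pow_self)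
    (by rw [signalQubits, ← hκ]; omega)
  obtain ⟨c, hc1, hc2, hc3⟩ := hB.exists_circuit (mul_pos hα P.ξNorm_pos)
  refine ⟨_, c, hc1, hc2, (Nat.cast_le.2 hc3).trans (P.gateCount_le hn hnξ hr2
    (two_pow_clog (by omega)) (two_pow_clog hn) hrξ
    ((two_pow_clog (by omega)).trans (by omega))), ?_⟩
  have h1 := P.genNorm_le (by omega) hw hdκ hκ1
  have h2 : 0 ≤ P.coeffScale n + Real.sqrt (2 ^ n) * (P.v.normalization + P.corrMax n) :=
    add_nonneg (P.coeffScale_nonneg n) (mul_nonneg (Real.sqrt_nonneg _)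
      (add_nonneg P.v.normalization_nonneg (P.corrMax_nonneg n)))
  have h3 := mul_le_mul h1 P.ξNorm_le P.ξNorm_pos.le (mul_nonneg (by positivity) h2)
  refine h3.trans_eq ?_
  rw [hamiltonianScale]
  simp only [coeffScale, corrMax]
  ring

theorem gateScale_nonneg (n nξ : ℕ) : 0 ≤ P.gateScale n nξ := by
  have h1 := Real.log_natCast_nonneg n
  have h2 := Real.log_natCast_nonneg nξ
  exact add_nonneg (add_nonneg (by positivity) (Finset.sum_nonneg fun k _ => by positivity))
    (by positivity)

end DiscretizedPDE

theorem isBlockEncoding_zero {a s m : ℕ} :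
    IsBlockEncoding (Circuit.matrix ([] : Circuit (Qubits a s m))) 0 0 0 := by
  refine ⟨?_, le_rfl, le_rfl, fun x j ⟨i, hi⟩ => ?_, ?_⟩
  · rw [Circuit.matrix_nil]; exact one_mem _
  · rw [Circuit.matrix_nil, Matrix.one_apply_ne]
    rintro rfl
    exact hi rfl
  · simp

theorem isPureAncilla_nil {a s m : ℕ} :
    IsPureAncilla (Circuit.matrix ([] : Circuit (Qubits a s m))) := by
  intro x y hy ⟨i, hi⟩
  rw [Circuit.matrix_nil, Matrix.one_apply_ne]
  rintro rfl
  exact hi (hy i)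

end SchroPDE

end

theorem mainTheorem3 :
    ∃ C : ℝ, ∀ P : SchroPDE.DiscretizedPDE, ∃ C' : ℝ,
      ∀ n nξ : ℕ, 2 ≤ n → 1 ≤ nξ → 2 * P.w < 2 ^ n →
        ∃ (α : ℝ)
          (c : SchroPDE.Circuit
            (SchroPDE.Qubits (2 * n + 2) (P.signalQubits n nξ) (n + 1 + nξ))),
          SchroPDE.IsBlockEncoding c.matrix (P.H n nξ) α 0 ∧
          SchroPDE.IsPureAncilla c.matrix ∧
          (c.length : ℝ) ≤ C * (1 + P.w) * P.gateScale n nξ ∧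
          α ≤ C * P.sparsity n nξ * P.hamiltonianScale n ∧
          α ≤ C' * P.sparsity n nξ * SchroPDE.maxNorm (P.H n nξ) := by
  refine ⟨30000000000, fun P => ?_⟩
  obtain ⟨c₁, hc₁⟩ := P.exists_hamiltonianScale_le
  refine ⟨3 * c₁, fun n nξ hn hnξ hw => ?_⟩
  by_cases hH : P.H n nξ = 0
  · -- with `α = 0`, every circuit block-encodes the zero matrix
    refine ⟨0, [], ?_, SchroPDE.isPureAncilla_nil, ?_, ?_, ?_⟩
    · rw [hH]
      exact SchroPDE.isBlockEncoding_zero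
    · rw [List.length_nil, Nat.cast_zero]
      exact mul_nonneg (by positivity) (P.gateScale_nonneg n nξ)
    · exact mul_nonneg (by positivity) (P.hamiltonianScale_nonneg n)
    · rw [hH]
      simp [SchroPDE.maxNorm]
  · obtain ⟨α, c, h1, h2, h3, h4⟩ := P.exists_circuit_H hn hnξ hw hH
    have h5 : (0 : ℝ) ≤ P.sparsity n nξ := Nat.cast_nonneg _
    refine ⟨α, c, h1, h2, h3, h4.trans ?_, h4.trans ?_⟩
    · exact mul_le_mul_of_nonneg_right (by linarith) (P.hamiltonianScale_nonneg n)
    · have h6 := mul_le_mul_of_nonneg_left (hc₁ n nξ hnξ hH)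
        (show (0 : ℝ) ≤ 3 * P.sparsity n nξ by positivity)
      linarith
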